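/- Directed Power Vertex Cover (DPVC): given a finite simple graph $G=(V,E)$ on $n\ge 1$ vertices and, for each edge $uv\in E$, two positive integers $w_{u,v}$ and $w_{v,u}$, a feasible solution is an assignment of a power $p_v\ge 0$ to each $v\in V$ such that every edge $uv$ satisfies $p_u\ge w_{u,v}$ or $p_v\ge w_{v,u}$; the goal is to minimize $\sum_{v}p_v$. A tree decomposition of $G$ is a tree with a bag $X_i\subseteq V$ at each node $i$, such that the bags cover $V$, the endpoints of each edge of $G$ lie together in some bag, and for each $v\in V$ the nodes $i$ with $v\in X_i$ induce a connected subtree; its width is $\max_i|X_i|-1$. Running time is the number of steps of a random access machine (uniform cost; registers and memory cells hold natural numbers; the arithmetic operations are addition and truncated subtraction). The weights (as an $n\times n$ matrix), the tree decomposition (as incidence and adjacency matrices) and the numerator and denominator of $\varepsilon$ are given in memory. Theorem. There is a single algorithm (program) which, given a DPVC instance on a graph $G$ with $n\ge1$ vertices, a tree decomposition of $G$ with $N$ nodes and of width $t$, and a rational $\varepsilon>0$, outputs a feasible solution of total power at most $(1+\varepsilon)$ times the minimum, and such that: (1) there are absolute constants $C$ and $c$ such that it always halts within $$\Bigl(C\cdot\frac{\log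 n}{\min(\varepsilon,1)}\Bigr)^{t}\,(n+N)^{c}$$ steps (with $0^0=1$ when $n=1$); in particular, if $N=n^{O(1)}$ and $\varepsilon\le 1$, the running time is $\bigl(O(\tfrac{\log n}{\varepsilon})\bigr)^t n^{O(1)}$; (2) consequently it is an FPT approximation scheme for DPVC parameterized by $t$ and $1/\varepsilon$ (the tree decomposition being part of the input): there are a computable function $f:\mathbb N\to\mathbb N$ and a constant $c$ such that it always halts within $f(t+\lceil 1/\varepsilon\rceil)\,(n+N)^{c}$ steps. -/

import Mathlib

open scoped NNReal

namespace DPVC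

/-! ### Directed Power Vertex Cover -/

/-- An instance of Directed Power Vertex Cover on the vertex set `V`: a graph and, for every edge
`uv`, two positive integers: `w u v` (the power that `u` needs in order to cover the edge) and
`w v u` (the power that `v` needs). The values of `w` off the edges are irrelevant. -/
structure Instance (V : Type*) where
  graph : SimpleGraph V
  w : V → V → ℕ
  w_pos : ∀ u v, graph.Adj u v → 0 < w u v

/-- A feasible solution: every edge is covered by at least one of its endpoints. -/
def Instance.Feasible {V : Type*} (I : Instance V) (p : V → ℝ≥0) : Prop :=
  ∀ u v, I.graph.Adj u v → (I.w u v : ℝ≥0) ≤ p u ∨ (I.w v u : ℝ≥0) ≤ p v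

/-- `p` is a feasible solution whose total power is at most `ρ` times that of every feasible
solution. -/
def Instance.IsApproxSolution {V : Type*} [Fintype V] (I : Instance V) (ρ : ℝ) (p : V → ℝ≥0) :
    Prop :=
  I.Feasible p ∧
    ∀ q : V → ℝ≥0, I.Feasible q → ((∑ v, p v : ℝ≥0) : ℝ) ≤ ρ * ((∑ v, q v : ℝ≥0) : ℝ)

/-! ### Tree decompositions -/

/-- A tree decomposition of `G` whose tree has node set `ι`. -/
structure TreeDecomposition {V : Type*} (G : SimpleGraph V) (ι : Type*) where
  tree : SimpleGraph ι
  isTree : tree.IsTree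
  bag : ι → Finset V
  vertex_mem : ∀ v, ∃ i, v ∈ bag i
  edge_mem : ∀ u v, G.Adj u v → ∃ i, u ∈ bag i ∧ v ∈ bag i
  connected : ∀ v, (tree.induce {i | v ∈ bag i}).Connected

/-- The width: the maximal cardinality of a bag, minus one. (On a nonempty vertex set some bag is
nonempty, so the subtraction does not truncate.) -/
def TreeDecomposition.width {V ι : Type*} [Fintype ι] {G : SimpleGraph V}
    (D : TreeDecomposition G ι) : ℕ :=
  (Finset.univ.sup fun i => (D.bag i).card) - 1

/-! ### The machine model

A random access machine with structured control. Its state consists of registers and of memory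
banks (arrays with random access), a given program mentioning finitely many of each; every register
and every memory cell holds a natural number. The only arithmetic operations are addition and
truncated subtraction, and there is no multiplication, so that the bit length of the largest number grows by at most
one per step and the uniform cost measure is polynomially related to time on Turing machines. -/

/-- Expressions. -/
inductive Expr
  /-- a literal -/
  | const (c : ℕ)
  /-- the contents of register `x` -/
  | reg (x : ℕ)
  /-- the contents of the cell of bank `a` with address `e` -/
  | read (a : ℕ) (e : Expr)
  | add (e₁ e₂ : Expr)
  /-- truncated subtraction -/
  | sub (e₁ e₂ : Expr)

/-- Programs. -/
inductive Program
  | skip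
  /-- store the value of `e` in register `x` -/
  | assign (x : ℕ) (e : Expr)
  /-- store the value of `e` in the cell of bank `a` whose address is the value of `addr` -/
  | write (a : ℕ) (addr e : Expr)
  | seq (P Q : Program)
  /-- run `P` if the value of `e` is nonzero, and `Q` otherwise -/
  | branch (e : Expr) (P Q : Program)
  /-- as long as the value of `e` is nonzero, run `P` -/
  | loop (e : Expr) (P : Program)

/-- A state of the machine: `s.reg x` is the contents of register `x`, and `s.mem a i` is the
contents of cell `i` of memory bank `a`. -/
@[ext] structure State where
  reg : ℕ → ℕ
  mem : ℕ → ℕ → ℕ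

/-- The value of an expression. -/
def Expr.eval (s : State) : Expr → ℕ
  | const c => c
  | reg x => s.reg x
  | read a e => s.mem a (e.eval s)
  | add e₁ e₂ => e₁.eval s + e₂.eval s
  | sub e₁ e₂ => e₁.eval s - e₂.eval s

/-- The number of steps needed to evaluate an expression: one for each operation, memory access
and operand. -/
def Expr.cost : Expr → ℕ
  | const _ => 1
  | reg _ => 1
  | read _ e => e.cost + 1
  | add e₁ e₂ => e₁.cost + e₂.cost + 1
  | sub e₁ e₂ => e₁.cost + e₂.cost + 1

/-- `Exec P s s' T`: the program `P`, started in state `s`, halts in state `s'` after exactly `T`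
steps. -/
inductive Exec : Program → State → State → ℕ → Prop
  | skip (s : State) : Exec .skip s s 1
  | assign (s : State) (x : ℕ) (e : Expr) :
      Exec (.assign x e) s { s with reg := Function.update s.reg x (e.eval s) } (e.cost + 1)
  | write (s : State) (a : ℕ) (addr e : Expr) :
      Exec (.write a addr e) s
        { s with mem := Function.update s.mem a
                  (Function.update (s.mem a) (addr.eval s) (e.eval s)) }
        (addr.cost + e.cost + 1)
  | seq {P Q : Program} {s₁ s₂ s₃ : State} {T₁ T₂ : ℕ} :
      Exec P s₁ s₂ T₁ → Exec Q s₂ s₃ T₂ → Exec (.seq P Q) s₁ s₃ (T₁ + T₂)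
  | branch_true {e : Expr} {P Q : Program} {s s' : State} {T : ℕ} :
      e.eval s ≠ 0 → Exec P s s' T → Exec (.branch e P Q) s s' (e.cost + 1 + T)
  | branch_false {e : Expr} {P Q : Program} {s s' : State} {T : ℕ} :
      e.eval s = 0 → Exec Q s s' T → Exec (.branch e P Q) s s' (e.cost + 1 + T)
  | loop_true {e : Expr} {P : Program} {s₁ s₂ s₃ : State} {T₁ T₂ : ℕ} :
      e.eval s₁ ≠ 0 → Exec P s₁ s₂ T₁ → Exec (.loop e P) s₂ s₃ T₂ →
      Exec (.loop e P) s₁ s₃ (e.cost + 1 + T₁ + T₂)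
  | loop_false {e : Expr} {P : Program} {s : State} :
      e.eval s = 0 → Exec (.loop e P) s s (e.cost + 1)

/-! ### Input, output, and algorithms for the problem -/

/-- A matrix laid out in a memory bank row by row, followed by zeros. -/
def layout {m n : ℕ} (A : Fin m → Fin n → ℕ) : ℕ → ℕ :=
  fun k => if h : k < m * n then A (Fin.divNat ⟨k, h⟩) (Fin.modNat ⟨k, h⟩) else 0

open Classical in
/-- The initial state that presents an instance with vertex set `Fin n`, a tree decomposition with
node set `Fin N`, and a positive rational `ε`.
* Registers `0`, `1`, `2`, `3` hold `n`, `N`, and the numerator and the denominator of `ε`.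
* Bank `0` holds the weight matrix, with `0` for pairs that are not edges.
* Bank `1` holds the incidence matrix of bags and vertices.
* Bank `2` holds the adjacency matrix of the tree.
* Everything else is `0`. -/
noncomputable def initialState {n N : ℕ} (I : Instance (Fin n))
    (D : TreeDecomposition I.graph (Fin N)) (ε : ℚ) : State where
  reg x :=
    match x with
    | 0 => n
    | 1 => N
    | 2 => ε.num.toNat
    | 3 => ε.den
    | _ => 0
  mem a :=
    match a with
    | 0 => layout fun u v : Fin n => if I.graph.Adj u v then I.w u v else 0
    | 1 => layout fun (i : Fin N) (v : Fin n) => if v ∈ D.bag i then 1 else 0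
    | 2 => layout fun i j : Fin N => if D.tree.Adj i j then 1 else 0
    | _ => fun _ => 0

/-- The power assignment that a final state presents: the power of vertex `v` stands in cell `v` of
bank `3`. -/
def output (n : ℕ) (s : State) : Fin n → ℝ≥0 :=
  fun v => (s.mem 3 v : ℝ≥0)

/-- For every instance on `n ≥ 1` vertices, every tree decomposition of its graph, with `N` nodes
say, and every rational `ε > 0`, the program `P` halts and outputs a `(1 + ε)`-approximate solution,
after at most `bound n N t ε` steps, where `t` is the width of the decomposition. -/
def ApproximatesInTime (P : Program) (bound : ℕ → ℕ → ℕ → ℚ → ℝ) : Prop :=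
  ∀ (n N : ℕ), 0 < n → ∀ (I : Instance (Fin n)) (D : TreeDecomposition I.graph (Fin N)) (ε : ℚ),
    0 < ε → ∃ (s : State) (T : ℕ), Exec P (initialState I D ε) s T ∧
      (T : ℝ) ≤ bound n N D.width ε ∧ I.IsApproxSolution (1 + (ε : ℝ)) (output n s)

end DPVC

namespace DPVC

/-! ### Reasoning about programs -/

/-- `P.wreg x` says whether `P` mentions register `x` as the target of an assignment. -/
def Program.wreg : Program → ℕ → Bool
  | .skip, _ => false
  | .assign y _, x => decide (y = x)
  | .write _ _ _, _ => false
  | .seq P Q, x => P.wreg x || Q.wreg x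
  | .branch _ P Q, x => P.wreg x || Q.wreg x
  | .loop _ P, x => P.wreg x

/-- `P.wmem a` says whether `P` mentions bank `a` as the target of a write. -/
def Program.wmem : Program → ℕ → Bool
  | .skip, _ => false
  | .assign _ _, _ => false
  | .write b _ _, a => decide (b = a)
  | .seq P Q, a => P.wmem a || Q.wmem a
  | .branch _ P Q, a => P.wmem a || Q.wmem a
  | .loop _ P, a => P.wmem a

/-- The states `s` and `s'` agree on everything that `P` does not mention as a target. -/
structure Frame (P : Program) (s s' : State) : Prop where
  reg : ∀ {x : ℕ}, P.wreg x = false → s'.reg x = s.reg x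
  mem : ∀ {a : ℕ}, P.wmem a = false → s'.mem a = s.mem a

/-- Specifications can thus be restricted to what a program changes. For concrete programs `wreg`
and `wmem` evaluate, so the side conditions are closed by `rfl`. -/
theorem Exec.frame {P : Program} {s s' : State} {T : ℕ} (h : Exec P s s' T) : Frame P s s' := by
  induction h with
  | skip s => exact ⟨fun _ => rfl, fun _ => rfl⟩
  | assign s x e =>
    refine ⟨fun {y} hy => ?_, fun _ => rfl⟩
    have : y ≠ x := by
      rintro rfl
      simp [Program.wreg] at hy
    simp [Function.update_of_ne this]
  | write s a addr e =>
    refine ⟨fun _ => rfl, fun {b} hb => ?_⟩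
    have : b ≠ a := by
      rintro rfl
      simp [Program.wmem] at hb
    simp [Function.update_of_ne this]
  | seq _ _ ih₁ ih₂ =>
    refine ⟨fun h => ?_, fun h => ?_⟩
    · simp only [Program.wreg, Bool.or_eq_false_iff] at h
      rw [ih₂.reg h.2, ih₁.reg h.1]
    · simp only [Program.wmem, Bool.or_eq_false_iff] at h
      rw [ih₂.mem h.2, ih₁.mem h.1]
  | branch_true _ _ ih =>
    refine ⟨fun h => ?_, fun h => ?_⟩
    · simp only [Program.wreg, Bool.or_eq_false_iff] at h
      exact ih.reg h.1
    · simp only [Program.wmem, Bool.or_eq_false_iff] at h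
      exact ih.mem h.1
  | branch_false _ _ ih =>
    refine ⟨fun h => ?_, fun h => ?_⟩
    · simp only [Program.wreg, Bool.or_eq_false_iff] at h
      exact ih.reg h.2
    · simp only [Program.wmem, Bool.or_eq_false_iff] at h
      exact ih.mem h.2
  | loop_true _ _ _ ih₁ ih₂ =>
    exact ⟨fun h => by rw [ih₂.reg h, ih₁.reg h], fun h => by rw [ih₂.mem h, ih₁.mem h]⟩
  | loop_false _ => exact ⟨fun _ => rfl, fun _ => rfl⟩

/-- The state with `v` stored in register `x`. -/
def State.set (s : State) (x v : ℕ) : State := { s with reg := Function.update s.reg x v }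

/-- The state with `v` stored in cell `i` of bank `a`. -/
def State.put (s : State) (a i v : ℕ) : State :=
  { s with mem := Function.update s.mem a (Function.update (s.mem a) i v) }

/-- Started in `s`, the program `P` halts within `(K + 1) * (m + 2) ^ a` steps in a state that
satisfies `Q`. -/
def Runs (K m a : ℕ) (P : Program) (s : State) (Q : State → Prop) : Prop :=
  ∃ s' T, Exec P s s' T ∧ T ≤ (K + 1) * (m + 2) ^ a ∧ Q s'

infixr:60 " ;; " => Program.seq

/-- Run `P` for `x = 0, 1, …, y - 1`, where `y` is the contents of a register. -/
def forLt (x y : ℕ) (P : Program) : Program :=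
  .assign x (.const 0) ;;
    .loop (.sub (.reg y) (.reg x)) (P ;; .assign x (.add (.reg x) (.const 1)))

namespace Runs

variable {K m a b : ℕ} {P P₁ P₂ : Program} {s : State} {Q Q' : State → Prop}

theorem conseq (h : Runs K m a P s Q) (hQ : ∀ s', Frame P s s' → Q s' → Q' s') :
    Runs K m a P s Q' := by
  obtain ⟨s', T, h₁, h₂, h₃⟩ := h
  exact ⟨s', T, h₁, h₂, hQ s' h₁.frame h₃⟩

theorem mono {K₁ a₁ : ℕ} (h : Runs K₁ m a₁ P s Q) (hK : K₁ ≤ K) (ha : a₁ ≤ a) :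
    Runs K m a P s Q := by
  obtain ⟨s', T, h₁, h₂, h₃⟩ := h
  exact ⟨s', T, h₁, h₂.trans (Nat.mul_le_mul (by omega)
    (Nat.pow_le_pow_right (by omega) ha)), h₃⟩

theorem call {a₁ : ℕ} (h : Runs 0 m a₁ P s Q) (hQ : ∀ s', Frame P s s' → Q s' → Q' s')
    (ha : a₁ ≤ a := by omega) : Runs K m a P s Q' :=
  (h.mono (Nat.zero_le _) ha).conseq hQ

/-- Constant costs vanish in the exponent, as `c + 1 ≤ 2 ^ a` for `c ≤ a`. It is therefore enough
that expressions cost at most `a`. -/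
theorem le_bound {c : ℕ} (h : c ≤ a) : c + 1 ≤ (K + 1) * (m + 2) ^ a :=
  calc c + 1 ≤ 2 ^ a := (Nat.succ_le_of_lt (h.trans_lt a.lt_two_pow_self))
    _ ≤ (m + 2) ^ a := Nat.pow_le_pow_left (by omega) a
    _ ≤ (K + 1) * (m + 2) ^ a := Nat.le_mul_of_pos_left _ (by omega)

/-- As `m + 2 ≥ 2`, sequencing and branching raise the exponent by one only. -/
theorem two_mul_bound (a : ℕ) :
    (K + 1) * (m + 2) ^ a + (K + 1) * (m + 2) ^ a ≤ (K + 1) * (m + 2) ^ (a + 1) := by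
  rw [pow_succ]
  nlinarith [Nat.zero_le (m * ((K + 1) * (m + 2) ^ a))]

theorem skip (h : Q s) : Runs K m a .skip s Q :=
  ⟨s, 1, .skip s, by simpa using le_bound (K := K) (m := m) (Nat.zero_le a), h⟩

theorem assign {x : ℕ} {e : Expr} (h : Q (s.set x (e.eval s))) (he : e.cost ≤ a := by decide) :
    Runs K m a (.assign x e) s Q :=
  ⟨_, _, .assign s x e, le_bound he, h⟩

theorem write {c : ℕ} {e₁ e₂ : Expr} (h : Q (s.put c (e₁.eval s) (e₂.eval s)))
    (he : e₁.cost + e₂.cost ≤ a := by decide) : Runs K m a (.write c e₁ e₂) s Q :=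
  ⟨_, _, .write s c e₁ e₂, le_bound he, h⟩

theorem seq (h : Runs K m a P₁ s fun s' => Runs K m a P₂ s' Q) :
    Runs K m (a + 1) (P₁ ;; P₂) s Q := by
  obtain ⟨s₁, T₁, h₁, h₂, s₂, T₂, h₃, h₄, h₅⟩ := h
  exact ⟨s₂, _, .seq h₁ h₃, (Nat.add_le_add h₂ h₄).trans (two_mul_bound a), h₅⟩

theorem branch {e : Expr} (h₁ : e.eval s ≠ 0 → Runs K m a P₁ s Q)
    (h₂ : e.eval s = 0 → Runs K m a P₂ s Q) (he : e.cost ≤ a := by decide) :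
    Runs K m (a + 1) (.branch e P₁ P₂) s Q := by
  by_cases h : e.eval s = 0
  · obtain ⟨s', T, h₃, h₄, h₅⟩ := h₂ h
    exact ⟨s', _, .branch_false h h₃,
      (Nat.add_le_add (le_bound he) h₄).trans (two_mul_bound a), h₅⟩
  · obtain ⟨s', T, h₃, h₄, h₅⟩ := h₁ h
    exact ⟨s', _, .branch_true h h₃,
      (Nat.add_le_add (le_bound he) h₄).trans (two_mul_bound a), h₅⟩

/-- Induction on the number `d` of remaining rounds. A round costs 8 beyond its body, namely 4 for
the guard and 4 for the increment, and the final failing guard costs 4. The frame from the initial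
state is handed to each round, so that invariants need not mention untouched registers and banks. -/
theorem forLt_aux {x y k B : ℕ} (hxy : x ≠ y) (hx : P.wreg x = false) (hy : P.wreg y = false)
    (Inv : ℕ → State → Prop)
    (hstep : ∀ i < k, ∀ s', Frame (forLt x y P) s s' → s'.reg x = i → s'.reg y = k → Inv i s' →
      ∃ s'' T, Exec P s' s'' T ∧ T ≤ B ∧ Inv (i + 1) (s''.set x (i + 1)))
    (d i : ℕ) (hd : i + d = k) (s' : State) (hF : Frame (forLt x y P) s s') (hsx : s'.reg x = i)
    (hsy : s'.reg y = k) (hI : Inv i s') :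
    ∃ s'' T, Exec (.loop (.sub (.reg y) (.reg x)) (P ;; .assign x (.add (.reg x) (.const 1))))
      s' s'' T ∧ T ≤ d * (B + 8) + 4 ∧ Inv k s'' := by
  induction d generalizing i s' with
  | zero =>
    refine ⟨s', _, .loop_false (by simp [Expr.eval]; omega), by simp [Expr.cost], ?_⟩
    rwa [← hd]
  | succ d ih =>
    obtain ⟨s₁, T, h₁, h₂, h₃⟩ := hstep i (by omega) s' hF hsx hsy hI
    have hF₁ := h₁.frame
    have hx₁ : s₁.reg x = i := by rw [hF₁.reg hx, hsx]
    obtain ⟨s₂, T', h₄, h₅, h₆⟩ := ih (i + 1) (by omega) (s₁.set x (i + 1))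
      ⟨fun {z} hz => by
          have hz' := hz
          simp only [forLt, Program.wreg, Bool.or_eq_false_iff] at hz
          have : z ≠ x := by
            rintro rfl
            simp at hz
          simp only [State.set, Function.update_of_ne this]
          rw [hF₁.reg hz.2.1, hF.reg hz'],
        fun {c} hc => by
          have hc' := hc
          simp only [forLt, Program.wmem, Bool.or_eq_false_iff] at hc
          simp only [State.set]
          rw [hF₁.mem hc.2.1, hF.mem hc']⟩
      (by simp [State.set])
      (by simp only [State.set, Function.update_of_ne hxy.symm]; rw [hF₁.reg hy, hsy]) h₃
    have h₇ : Exec _ s₁ (s₁.set x ((Expr.add (.reg x) (.const 1)).eval s₁)) _ :=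
      Exec.assign s₁ x (.add (.reg x) (.const 1))
    simp only [Expr.eval, hx₁] at h₇
    refine ⟨s₂, _, .loop_true (by simp [Expr.eval]; omega) (.seq h₁ h₇) h₄, ?_, h₆⟩
    simp only [Expr.cost]
    linarith

theorem forLt_exec {x y k B : ℕ} (hxy : x ≠ y) (hx : P.wreg x = false) (hy : P.wreg y = false)
    (Inv : ℕ → State → Prop) (hk : s.reg y = k) (h0 : Inv 0 (s.set x 0))
    (hstep : ∀ i < k, ∀ s', Frame (forLt x y P) s s' → s'.reg x = i → s'.reg y = k → Inv i s' →
      ∃ s'' T, Exec P s' s'' T ∧ T ≤ B ∧ Inv (i + 1) (s''.set x (i + 1))) :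
    ∃ s' T, Exec (forLt x y P) s s' T ∧ T ≤ k * (B + 8) + 6 ∧ Inv k s' := by
  have h₁ := Exec.assign s x (.const 0)
  obtain ⟨s₂, T, h₂, h₃, h₄⟩ := forLt_aux hxy hx hy Inv hstep k 0 (by omega) (s.set x 0)
    ⟨fun {z} hz => by
        simp only [forLt, Program.wreg, Bool.or_eq_false_iff] at hz
        have : z ≠ x := by
          rintro rfl
          simp at hz
        simp [State.set, Function.update_of_ne this],
      fun {c} hc => rfl⟩
    (by simp [State.set]) (by simp [State.set, Function.update_of_ne hxy.symm, hk]) h0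
  refine ⟨s₂, _, .seq h₁ h₂, ?_, h₄⟩
  simp only [Expr.cost]
  omega

/-- One factor `m + 2` counts the rounds, and `(m + 2) ^ 4 ≥ 16` absorbs the overhead; hence the
exponent grows by 5. -/
theorem forLt {x y k : ℕ} (Inv : ℕ → State → Prop) (hk : s.reg y = k) (hkm : k ≤ m + 2)
    (h0 : Inv 0 (s.set x 0))
    (hstep : ∀ i < k, ∀ s', Frame (forLt x y P) s s' → s'.reg x = i → s'.reg y = k → Inv i s' →
      Runs K m a P s' fun s'' => Inv (i + 1) (s''.set x (i + 1)))
    (hQ : ∀ s', Frame (DPVC.forLt x y P) s s' → Inv k s' → Q s')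
    (hxy : x ≠ y := by decide) (hx : P.wreg x = false := by rfl)
    (hy : P.wreg y = false := by rfl) :
    Runs K m (a + 5) (DPVC.forLt x y P) s Q := by
  obtain ⟨s', T, h₁, h₂, h₃⟩ := forLt_exec hxy hx hy Inv hk h0 hstep
  refine ⟨s', T, h₁, h₂.trans ?_, hQ s' h₁.frame h₃⟩
  set B := (K + 1) * (m + 2) ^ a with hB
  have hB1 : 1 ≤ B := Nat.mul_pos (by omega) (Nat.pow_pos (by omega))
  have : (K + 1) * (m + 2) ^ (a + 5) = B * (m + 2) ^ 4 * (m + 2) := by rw [hB]; ring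
  rw [this]
  have h16 : 2 ^ 4 ≤ (m + 2) ^ 4 := Nat.pow_le_pow_left (by omega) 4
  calc k * (B + 8) + 6 ≤ (m + 2) * (B * 9) + (m + 2) * (B * 3) := by
        gcongr
        · omega
        · nlinarith
    _ = B * 12 * (m + 2) := by ring
    _ ≤ B * (m + 2) ^ 4 * (m + 2) := by gcongr; omega

/-- For a loop of non-polynomial length. Its rounds use up the factor `K + 1`, so the body has to
run with `K = 0`. -/
theorem forLt_many {x y k : ℕ} (Inv : ℕ → State → Prop) (hk : s.reg y = k) (hkK : k ≤ K)
    (h0 : Inv 0 (s.set x 0))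
    (hstep : ∀ i < k, ∀ s', Frame (DPVC.forLt x y P) s s' → s'.reg x = i → s'.reg y = k →
      Inv i s' → Runs 0 m a P s' fun s'' => Inv (i + 1) (s''.set x (i + 1)))
    (hQ : ∀ s', Frame (DPVC.forLt x y P) s s' → Inv k s' → Q s')
    (hxy : x ≠ y := by decide) (hx : P.wreg x = false := by rfl)
    (hy : P.wreg y = false := by rfl) :
    Runs K m (a + 5) (DPVC.forLt x y P) s Q := by
  obtain ⟨s', T, h₁, h₂, h₃⟩ := forLt_exec hxy hx hy Inv hk h0 hstep
  refine ⟨s', T, h₁, h₂.trans ?_, hQ s' h₁.frame h₃⟩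
  simp only [Nat.zero_add, one_mul]
  set B := (m + 2) ^ a with hB
  have hB1 : 1 ≤ B := Nat.pow_pos (by omega)
  have h16 : 2 ^ 5 ≤ (m + 2) ^ 5 := Nat.pow_le_pow_left (by omega) 5
  calc k * (B + 8) + 6 ≤ (K + 1) * (B * 9) + (K + 1) * (B * 6) := by
        gcongr
        · omega
        · omega
        · nlinarith
    _ = (K + 1) * (B * 15) := by ring
    _ ≤ (K + 1) * (B * (m + 2) ^ 5) := by gcongr; omega
    _ = (K + 1) * (m + 2) ^ (a + 5) := by rw [hB]; ring

end Runs

/-! ### Arithmetic and matrix access -/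

/-- Store in register `60` the product of registers `x` and `y`. -/
def mulP (x y : ℕ) : Program :=
  .assign 60 (.const 0) ;; forLt 61 y (.assign 60 (.add (.reg 60) (.reg x)))

theorem mulP_wreg {x y z : ℕ} (h₀ : z ≠ 60) (h₁ : z ≠ 61) : (mulP x y).wreg z = false := by
  simp only [mulP, forLt, Program.wreg, Bool.or_eq_false_iff, decide_eq_false_iff_not]
  omega

/-- Repeated addition. Only the second factor, the number of rounds, needs a bound; the first may be
as large as a table key. -/
theorem mulP_runs {K m a : ℕ} {s : State} {x y : ℕ} (hy : s.reg y ≤ m + 2)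
    (hx₀ : x ≠ 60 := by decide) (hx₁ : x ≠ 61 := by decide)
    (hy₀ : y ≠ 60 := by decide) (hy₁ : y ≠ 61 := by decide) :
    Runs K m (a + 10) (mulP x y) s fun s' => s'.reg 60 = s.reg x * s.reg y := by
  refine (Runs.seq (a := a + 9) (.assign ?_ ?_))
  · refine (Runs.forLt (a := a + 4) (k := s.reg y) (fun i s' => s'.reg 60 = s.reg x * i) ?_ hy
      ?_ ?_ ?_ hy₁.symm rfl ?_)
    · simp [State.set, Function.update_of_ne hy₀]
    · simp [State.set, Expr.eval]
    · intro i _ s' hF h₁ h₂ h₃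
      refine .assign ?_ ?_
      · have : s'.reg x = s.reg x := by
          rw [hF.reg]
          · simp [State.set, Function.update_of_ne hx₀]
          · simp only [forLt, Program.wreg, Bool.or_eq_false_iff, decide_eq_false_iff_not]
            omega
        simp [State.set, Expr.eval, this, h₃, Nat.mul_add]
      · simp [Expr.cost]
    · intro s' _ h
      exact h
    · simpa [Program.wreg] using hy₀.symm
  · simp [Expr.cost]

/-- Store in register `z` the entry in row `r` and column `c` of the matrix with rows of length
`l` in bank `b`, where `r`, `c` and `l` are given in registers. -/
def getP (z b r c l : ℕ) : Program :=
  mulP r l ;; .assign z (.read b (.add (.reg 60) (.reg c)))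

theorem getP_runs {K m a : ℕ} {s : State} {z b r c l : ℕ} (hl : s.reg l ≤ m + 2)
    (hr₀ : r ≠ 60 := by decide) (hr₁ : r ≠ 61 := by decide)
    (hc₀ : c ≠ 60 := by decide) (hc₁ : c ≠ 61 := by decide)
    (hl₀ : l ≠ 60 := by decide) (hl₁ : l ≠ 61 := by decide) :
    Runs K m (a + 11) (getP z b r c l) s
      fun s' => s'.reg z = s.mem b (s.reg r * s.reg l + s.reg c) := by
  refine Runs.seq ((mulP_runs (a := a) hl hr₀ hr₁ hl₀ hl₁).conseq fun s' hF h => .assign ?_ ?_)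
  · have h₁ : s'.reg c = s.reg c := hF.reg (mulP_wreg hc₀ hc₁)
    have h₂ : s'.mem b = s.mem b := hF.mem rfl
    simp [State.set, Expr.eval, h, h₁, h₂]
  · simp [Expr.cost]


/-! ### Dynamic programming over the tree decomposition -/

/-- The number with digits `d 0, …, d (v - 1)` in base `L` below the leading part `i`. -/
def encode (L i : ℕ) (d : ℕ → ℕ) : ℕ → ℕ
  | 0 => i
  | v + 1 => encode L i d v * L + d v

theorem encode_congr {L i : ℕ} {d d' : ℕ → ℕ} {n : ℕ} (h : ∀ v < n, d v = d' v) :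
    encode L i d n = encode L i d' n := by
  induction n with
  | zero => rfl
  | succ n ih =>
    simp only [encode]
    rw [ih fun v hv => h v (by omega), h n (by omega)]

/-- Digits below `L` are recovered by division with remainder. The leading part needs no bound. -/
theorem encode_inj {L i i' : ℕ} {d d' : ℕ → ℕ} {n : ℕ} (hd : ∀ v < n, d v < L)
    (hd' : ∀ v < n, d' v < L) (h : encode L i d n = encode L i' d' n) :
    i = i' ∧ ∀ v < n, d v = d' v := by
  induction n with
  | zero => exact ⟨h, fun v hv => absurd hv (Nat.not_lt_zero v)⟩
  | succ n ih =>
    simp only [encode] at h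
    have hL : 0 < L := (Nat.zero_le _).trans_lt (hd n (by omega))
    have h₁ := congrArg (· % L) h
    have h₂ := congrArg (· / L) h
    simp only [Nat.mod_eq_of_lt (hd n (by omega)),
      Nat.mod_eq_of_lt (hd' n (by omega)), Nat.mul_comm _ L, Nat.mul_add_mod,
      Nat.mul_add_div hL, Nat.div_eq_of_lt (hd n (by omega)),
      Nat.div_eq_of_lt (hd' n (by omega)), Nat.add_zero] at h₁ h₂
    obtain ⟨h₃, h₄⟩ := ih (fun v hv => hd v (by omega)) (fun v hv => hd' v (by omega)) h₂
    refine ⟨h₃, fun v hv => ?_⟩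
    rcases Nat.lt_succ_iff_lt_or_eq.mp hv with hv | rfl
    · exact h₄ v hv
    · exact h₁

/-- The data on which the dynamic programming algorithm works: the numbers of vertices, of nodes
and of candidate powers per vertex, and the memory banks that hold the weights, the bags, the
adjacency matrix of the tree and the candidate powers. -/
structure Data where
  n : ℕ
  N : ℕ
  L : ℕ
  w : ℕ → ℕ
  bag : ℕ → ℕ
  adj : ℕ → ℕ
  cand : ℕ → ℕ

namespace Data

variable (D : Data)

abbrev W (u v : ℕ) : ℕ := D.w (u * D.n + v)

/-- Vertex `v` lies in the bag of node `i`. -/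
abbrev X (i v : ℕ) : Prop := D.bag (i * D.n + v) ≠ 0

abbrev A (i j : ℕ) : Prop := D.adj (i * D.N + j) ≠ 0

/-- The `j`-th candidate power of vertex `v`. -/
abbrev c (v j : ℕ) : ℕ := D.cand (v * D.n + j)

def Feasible (P : ℕ → ℕ) : Prop :=
  ∀ u < D.n, ∀ v < D.n, D.W u v ≤ P u ∨ D.W v u ≤ P v

/-- `q` chooses a candidate for every vertex. -/
def Adm (q : ℕ → ℕ) : Prop := ∀ v < D.n, q v < D.L

/-- The address of the table entry of node `i` with parent `p` for the choice `q`, which depends on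
the restriction of `q` to the intersection of the two bags. -/
def key (i p : ℕ) (q : ℕ → ℕ) : ℕ :=
  encode D.L i (fun v => if D.X i v ∧ D.X p v then q v else 0) D.n

/-- The choice `q` covers all edges within the bag of `i`. -/
def Valid (i : ℕ) (q : ℕ → ℕ) : Prop :=
  ∀ u < D.n, ∀ v < D.n, D.X i u → D.X i v → D.W u v ≤ D.c u (q u) ∨ D.W v u ≤ D.c v (q v)

variable (par pres sol : ℕ → ℕ)

/-- The choice `q` is valid at node `i` and extends to the processed subtrees at `i`. Here `par i`
is zero as long as node `i` is unprocessed, and the successor of its parent afterwards. -/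
def Pres (i : ℕ) (q : ℕ → ℕ) : Prop :=
  D.Valid i q ∧ ∀ j < D.N, par j = i + 1 → pres (D.key j i q) ≠ 0

/-- The powers that the processed subtrees at `i` assign to the vertices outside the bag of `i`. -/
def e (i : ℕ) (q : ℕ → ℕ) (v : ℕ) : ℕ :=
  ∑ j ∈ Finset.range D.N, if par j = i + 1 then sol (D.key j i q * D.n + v) else 0

/-- The powers of the vertices of the bag of `i` that do not lie in the bag of `p`. -/
def own (i p : ℕ) (q : ℕ → ℕ) (v : ℕ) : ℕ :=
  if D.X i v ∧ ¬ D.X p v then D.c v (q v) else 0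

open Classical in
/-- The powers that result from the choice `q` on the bags of the unprocessed nodes. -/
noncomputable def total (q : ℕ → ℕ) (v : ℕ) : ℕ :=
  (∑ i ∈ Finset.range (D.N + 1), if par i = 0 then D.e par sol i q v else 0) +
    if ∃ i ≤ D.N, par i = 0 ∧ D.X i v then D.c v (q v) else 0

/-- The invariant of the tables. Node `N` is an additional node with empty bag. -/
structure Inv : Prop where
  par_last : par D.N = 0
  bag_last : ∀ v < D.n, ¬ D.X D.N v
  fresh : ∀ i ≤ D.N, par i = 0 → ∀ p q, D.Adm q → pres (D.key i p q) = 0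
  sound : ∀ q, D.Adm q → (∀ i ≤ D.N, par i = 0 → D.Pres par pres i q) →
    D.Feasible (D.total par sol q)
  complete : ∀ q, D.Adm q → D.Feasible (fun v => D.c v (q v)) →
    (∀ i ≤ D.N, par i = 0 → D.Pres par pres i q) ∧
    ∑ v ∈ Finset.range D.n, D.total par sol q v ≤ ∑ v ∈ Finset.range D.n, D.c v (q v)

variable {D par pres sol}

theorem key_congr {i p : ℕ} {q q' : ℕ → ℕ}
    (h : ∀ v < D.n, D.X i v → D.X p v → q v = q' v) : D.key i p q = D.key i p q' := by
  refine encode_congr fun v hv => ?_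
  split_ifs with hx
  · exact h v hv hx.1 hx.2
  · rfl

/-- The node is the leading part of a key, so entries of different nodes never collide. The parent
is not recovered. -/
theorem key_inj {i i' p p' : ℕ} {q q' : ℕ → ℕ} (hq : D.Adm q) (hq' : D.Adm q')
    (h : D.key i p q = D.key i' p' q') :
    i = i' ∧ ∀ v < D.n, (if D.X i v ∧ D.X p v then q v else 0) =
      if D.X i' v ∧ D.X p' v then q' v else 0 :=
  encode_inj (fun v hv => by have := hq v hv; split_ifs <;> omega)
    (fun v hv => by have := hq' v hv; split_ifs <;> omega) h

theorem eq_of_key_eq {i p : ℕ} {q q' : ℕ → ℕ} (hq : D.Adm q) (hq' : D.Adm q')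
    (h : D.key i p q = D.key i p q') {v : ℕ} (hv : v < D.n) (hi : D.X i v) (hp : D.X p v) :
    q v = q' v := by
  have := (key_inj hq hq' h).2 v hv
  rwa [if_pos ⟨hi, hp⟩, if_pos ⟨hi, hp⟩] at this

theorem Valid.congr {i : ℕ} {q q' : ℕ → ℕ} (h : ∀ v < D.n, D.X i v → q v = q' v)
    (hv : D.Valid i q) : D.Valid i q' := by
  intro u hu v hv' hxu hxv
  rw [← h u hu hxu, ← h v hv' hxv]
  exact hv u hu v hv' hxu hxv

theorem Pres.congr {i : ℕ} {q q' : ℕ → ℕ} (h : ∀ v < D.n, D.X i v → q v = q' v)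
    (hp : D.Pres par pres i q) : D.Pres par pres i q' := by
  refine ⟨hp.1.congr h, fun j hj hji => ?_⟩
  rw [← key_congr (q := q) fun v hv _ hx => h v hv hx]
  exact hp.2 j hj hji

theorem e_congr {i : ℕ} {q q' : ℕ → ℕ} (h : ∀ v < D.n, D.X i v → q v = q' v) (v : ℕ) :
    D.e par sol i q v = D.e par sol i q' v := by
  refine Finset.sum_congr rfl fun j _ => ?_
  rw [key_congr (q := q) fun v hv _ hx => h v hv hx]

/-- The tables `pres'` and `sol'` result from the tables `pres` and `sol` by processing the node `l`
with parent `p`. -/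
structure Processed (D : Data) (par pres sol pres' sol' : ℕ → ℕ) (l p : ℕ) : Prop where
  other : ∀ a, (∀ q, D.Adm q → a ≠ D.key l p q) →
    pres' a = pres a ∧ ∀ v < D.n, sol' (a * D.n + v) = sol (a * D.n + v)
  attained : ∀ q, D.Adm q → pres' (D.key l p q) ≠ 0 → ∃ q', D.Adm q' ∧
    D.key l p q' = D.key l p q ∧ D.Pres par pres l q' ∧
    ∀ v < D.n, sol' (D.key l p q * D.n + v) = D.e par sol l q' v + D.own l p q' v
  le : ∀ q, D.Adm q → D.Pres par pres l q → pres' (D.key l p q) ≠ 0 ∧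
    ∑ v ∈ Finset.range D.n, sol' (D.key l p q * D.n + v) ≤
      ∑ v ∈ Finset.range D.n, (D.e par sol l q v + D.own l p q v)

section Step

variable {pres' sol' : ℕ → ℕ} {l p : ℕ}

theorem Processed.pres_key (h : D.Processed par pres sol pres' sol' l p) {j i : ℕ} (hj : j ≠ l)
    {q : ℕ → ℕ} (hq : D.Adm q) : pres' (D.key j i q) = pres (D.key j i q) :=
  (h.other _ fun _ hq' he => hj (key_inj hq hq' he).1).1

theorem Processed.sol_key (h : D.Processed par pres sol pres' sol' l p) {j i : ℕ} (hj : j ≠ l)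
    {q : ℕ → ℕ} (hq : D.Adm q) {v : ℕ} (hv : v < D.n) :
    sol' (D.key j i q * D.n + v) = sol (D.key j i q * D.n + v) :=
  (h.other _ fun _ hq' he => hj (key_inj hq hq' he).1).2 v hv

/-- Entries of nodes other than `l` are unchanged, and `l` was nobody's child while `par l = 0`. The
only new condition is therefore the one that `p` receives from its new child `l`. -/
theorem Processed.pres_iff (h : D.Processed par pres sol pres' sol' l p) (hl : l < D.N)
    (hl0 : par l = 0) {i : ℕ} {q : ℕ → ℕ} (hq : D.Adm q) :
    D.Pres (Function.update par l (p + 1)) pres' i q ↔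
      D.Pres par pres i q ∧ (i = p → pres' (D.key l p q) ≠ 0) := by
  constructor
  · rintro ⟨h₁, h₂⟩
    refine ⟨⟨h₁, fun j hj hji => ?_⟩, ?_⟩
    · have hjl : j ≠ l := by rintro rfl; omega
      rw [← h.pres_key hjl hq]
      exact h₂ j hj (by rwa [Function.update_of_ne hjl])
    · rintro rfl
      exact h₂ l hl (by simp)
  · rintro ⟨⟨h₁, h₂⟩, h₃⟩
    refine ⟨h₁, fun j hj hji => ?_⟩
    by_cases hjl : j = l
    · subst hjl
      simp only [Function.update_self, Nat.add_right_cancel_iff] at hji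
      subst hji
      exact h₃ rfl
    · rw [h.pres_key hjl hq]
      exact h₂ j hj (by rwa [Function.update_of_ne hjl] at hji)

theorem Processed.e_eq (h : D.Processed par pres sol pres' sol' l p) (hl : l < D.N)
    (hl0 : par l = 0) {i : ℕ} {q : ℕ → ℕ} (hq : D.Adm q) {v : ℕ} (hv : v < D.n) :
    D.e (Function.update par l (p + 1)) sol' i q v =
      D.e par sol i q v + if i = p then sol' (D.key l p q * D.n + v) else 0 := by
  have h₁ : (if i = p then sol' (D.key l p q * D.n + v) else 0) =
      ∑ j ∈ Finset.range D.N, if j = l then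
        (if i = p then sol' (D.key l p q * D.n + v) else 0) else 0 := by
    rw [Finset.sum_ite_eq' (Finset.range D.N) l]
    simp [hl]
  rw [h₁, e, e, ← Finset.sum_add_distrib]
  refine Finset.sum_congr rfl fun j _ => ?_
  by_cases hjl : j = l
  · subst hjl
    by_cases hip : i = p
    · subst hip
      simp [hl0]
    · have : ¬ p = i := fun h => hip h.symm
      simp [hl0, hip, this]
  · rw [Function.update_of_ne hjl, h.sol_key hjl hq hv]
    simp [hjl]

/-- One identity serves both halves of `Inv.step`. With `q'` the choice stored for the key and `q''`
the gluing of `q'` and `q`, the terms other than the totals cancel, and the new total for `q` is the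
old total for `q''`. With all three choices equal, it shows that the total changes by the difference
between the table entry and the cost of `q` at `l`. -/
theorem Processed.total_eq (h : D.Processed par pres sol pres' sol' l p) (hl : l < D.N)
    (hl0 : par l = 0) (hp : p ≤ D.N) (hp0 : par p = 0) (hpl : p ≠ l)
    (hsep : ∀ j ≤ D.N, par j = 0 → j ≠ l → ∀ v < D.n, D.X l v → D.X j v → D.X p v)
    {q q' q'' : ℕ → ℕ} (hq : D.Adm q)
    (h₁ : ∀ v < D.n, D.X l v → q'' v = q' v)
    (h₂ : ∀ j ≤ D.N, par j = 0 → j ≠ l → ∀ v < D.n, D.X j v → q'' v = q v) {v : ℕ}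
    (hv : v < D.n) :
    D.total (Function.update par l (p + 1)) sol' q v + (D.e par sol l q' v + D.own l p q' v) =
      D.total par sol q'' v + sol' (D.key l p q * D.n + v) := by
  -- The summand of `l` disappears, and that of `p` gains the new table entry.
  have hsum : (∑ i ∈ Finset.range (D.N + 1), if Function.update par l (p + 1) i = 0 then
      D.e (Function.update par l (p + 1)) sol' i q v else 0) + D.e par sol l q' v =
      (∑ i ∈ Finset.range (D.N + 1), if par i = 0 then D.e par sol i q'' v else 0) +
        sol' (D.key l p q * D.n + v) := by
    have e₁ : D.e par sol l q' v =
        ∑ i ∈ Finset.range (D.N + 1), if i = l then D.e par sol l q' v else 0 := by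
      rw [Finset.sum_ite_eq' (Finset.range (D.N + 1)) l]
      simp [hl.le]
    have e₂ : sol' (D.key l p q * D.n + v) =
        ∑ i ∈ Finset.range (D.N + 1), if i = p then sol' (D.key l p q * D.n + v) else 0 := by
      rw [Finset.sum_ite_eq' (Finset.range (D.N + 1)) p]
      simp [hp]
    rw [e₁, e₂, ← Finset.sum_add_distrib, ← Finset.sum_add_distrib]
    refine Finset.sum_congr rfl fun i hi => ?_
    have hi : i ≤ D.N := Nat.lt_succ_iff.mp (Finset.mem_range.mp hi)
    by_cases hil : i = l
    · subst hil
      rw [Function.update_self, if_neg (by omega), if_pos rfl, if_pos hl0, if_neg hpl.symm,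
        e_congr h₁]
      omega
    · rw [Function.update_of_ne hil, if_neg hil]
      by_cases hi0 : par i = 0
      · rw [if_pos hi0, if_pos hi0, h.e_eq hl hl0 hq hv, e_congr (h₂ i hi hi0 hil)]
        omega
      · rw [if_neg hi0, if_neg hi0, if_neg]
        rintro rfl
        exact hi0 hp0
  classical
  -- A vertex of the bag of `l` either remains in some unprocessed bag, and then lies in the bag of
  -- `p` by `hsep`, or is accounted for by `own`.
  have hcov : (if ∃ i ≤ D.N, Function.update par l (p + 1) i = 0 ∧ D.X i v then
      D.c v (q v) else 0) + D.own l p q' v =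
      if ∃ i ≤ D.N, par i = 0 ∧ D.X i v then D.c v (q'' v) else 0 := by
    by_cases hK : ∃ i ≤ D.N, Function.update par l (p + 1) i = 0 ∧ D.X i v
    · obtain ⟨i, hi, hi0, hiv⟩ := hK
      have hil : i ≠ l := by
        rintro rfl
        simp at hi0
      have hi0' : par i = 0 := by rwa [Function.update_of_ne hil] at hi0
      rw [if_pos ⟨i, hi, hi0, hiv⟩, if_pos ⟨i, hi, hi0', hiv⟩, h₂ i hi hi0' hil v hv hiv, own,
        if_neg]
      · rfl
      · rintro ⟨hlv, hpv⟩
        exact hpv (hsep i hi hi0' hil v hv hlv hiv)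
    · rw [if_neg hK]
      have hK' : ∀ i ≤ D.N, par i = 0 → i ≠ l → ¬ D.X i v := fun i hi hi0 hil hiv =>
        hK ⟨i, hi, by rwa [Function.update_of_ne hil], hiv⟩
      by_cases hlv : D.X l v
      · rw [own, if_pos ⟨hlv, hK' p hp hp0 hpl⟩, if_pos ⟨l, hl.le, hl0, hlv⟩, h₁ v hv hlv,
          Nat.zero_add]
      · rw [own, if_neg fun h => hlv h.1, if_neg]
        rintro ⟨i, hi, hi0, hiv⟩
        by_cases hil : i = l
        · exact hlv (hil ▸ hiv)
        · exact hK' i hi hi0 hil hiv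
  simp only [total]
  rw [← hcov]
  linarith

theorem Feasible.congr {P P' : ℕ → ℕ} (h : ∀ v < D.n, P v = P' v) (hP : D.Feasible P) :
    D.Feasible P' := by
  intro u hu v hv
  rw [← h u hu, ← h v hv]
  exact hP u hu v hv

theorem Inv.step (hI : D.Inv par pres sol) (h : D.Processed par pres sol pres' sol' l p)
    (hl : l < D.N) (hl0 : par l = 0) (hp : p ≤ D.N) (hp0 : par p = 0) (hpl : p ≠ l)
    (hsep : ∀ j ≤ D.N, par j = 0 → j ≠ l → ∀ v < D.n, D.X l v → D.X j v → D.X p v) :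
    D.Inv (Function.update par l (p + 1)) pres' sol' where
  par_last := by rw [Function.update_of_ne hl.ne']; exact hI.par_last
  bag_last := hI.bag_last
  fresh i hi hi0 p' q hq := by
    have hil : i ≠ l := by
      rintro rfl
      simp at hi0
    rw [h.pres_key hil hq]
    exact hI.fresh i hi (by rwa [Function.update_of_ne hil] at hi0) p' q hq
  sound q hq hall := by
    have hall' : ∀ i ≤ D.N, par i = 0 → i ≠ l → D.Pres par pres i q ∧
        (i = p → pres' (D.key l p q) ≠ 0) := fun i hi hi0 hil =>
      (h.pres_iff hl hl0 hq).mp (hall i hi (by rwa [Function.update_of_ne hil]))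
    obtain ⟨q', hq', hkey, hpres, hsol⟩ := h.attained q hq ((hall' p hp hp0 hpl).2 rfl)
    classical
    -- The gluing is consistent: a vertex shared by `l` and another unprocessed bag lies in the bag
    -- of `p`, and there `q'` and `q` agree since their keys are equal.
    let q'' : ℕ → ℕ := fun v => if D.X l v then q' v else q v
    have h₁ : ∀ v < D.n, D.X l v → q'' v = q' v := fun v _ hx => if_pos hx
    have h₂ : ∀ j ≤ D.N, par j = 0 → j ≠ l → ∀ v < D.n, D.X j v → q'' v = q v := by
      intro j hj hj0 hjl v hv hx
      simp only [q'']
      split_ifs with hlv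
      · exact eq_of_key_eq hq' hq hkey hv hlv (hsep j hj hj0 hjl v hv hlv hx)
      · rfl
    have hq'' : D.Adm q'' := by
      intro v hv
      simp only [q'']
      split_ifs
      exacts [hq' v hv, hq v hv]
    refine Feasible.congr (fun v hv => ?_) (hI.sound q'' hq'' fun i hi hi0 => ?_)
    · have := h.total_eq hl hl0 hp hp0 hpl hsep hq h₁ h₂ hv
      rw [hsol v hv] at this
      omega
    · by_cases hil : i = l
      · subst hil
        exact hpres.congr fun v hv hx => (h₁ v hv hx).symm
      · exact (hall' i hi hi0 hil).1.congr fun v hv hx => (h₂ i hi hi0 hil v hv hx).symm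
  complete q hq hf := by
    obtain ⟨h₁, h₂⟩ := hI.complete q hq hf
    obtain ⟨h₃, h₄⟩ := h.le q hq (h₁ l hl.le hl0)
    refine ⟨fun i hi hi0 => ?_, ?_⟩
    · have hil : i ≠ l := by
        rintro rfl
        simp at hi0
      rw [Function.update_of_ne hil] at hi0
      exact (h.pres_iff hl hl0 hq).mpr ⟨h₁ i hi hi0, fun _ => h₃⟩
    · have : ∑ v ∈ Finset.range D.n, (D.total (Function.update par l (p + 1)) sol' q v +
          (D.e par sol l q v + D.own l p q v)) =
          ∑ v ∈ Finset.range D.n, (D.total par sol q v + sol' (D.key l p q * D.n + v)) :=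
        Finset.sum_congr rfl fun v hv =>
          h.total_eq hl hl0 hp hp0 hpl hsep hq (fun _ _ _ => rfl) (fun _ _ _ _ _ _ _ => rfl)
            (Finset.mem_range.mp hv)
      simp only [Finset.sum_add_distrib] at this h₄
      omega

end Step

theorem e_of_par_eq_zero (h : ∀ i, par i = 0) (i : ℕ) (q : ℕ → ℕ) (v : ℕ) :
    D.e par sol i q v = 0 := by
  simp [e, h]

/-- Initially each vertex lies in an unprocessed bag and no subtree contributes, so the total is the
choice itself. Pairs of weight zero are covered trivially, all others lie in a common bag. -/
theorem Inv.init (hpar : ∀ i, par i = 0) (hpres : ∀ a, pres a = 0)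
    (hN : ∀ v < D.n, ¬ D.X D.N v) (hvert : ∀ v < D.n, ∃ i < D.N, D.X i v)
    (hedge : ∀ u < D.n, ∀ v < D.n, D.W u v ≠ 0 → ∃ i < D.N, D.X i u ∧ D.X i v) :
    D.Inv par pres sol := by
  have htot : ∀ q, ∀ v < D.n, D.total par sol q v = D.c v (q v) := by
    intro q v hv
    obtain ⟨i, hi, hx⟩ := hvert v hv
    rw [total, if_pos ⟨i, hi.le, hpar i, hx⟩]
    simp [e_of_par_eq_zero hpar]
  refine ⟨hpar _, hN, fun _ _ _ _ _ _ => hpres _, fun q hq hall => ?_, fun q hq hf => ⟨?_, ?_⟩⟩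
  · intro u hu v hv
    rw [htot q u hu, htot q v hv]
    by_cases hw : D.W u v = 0
    · left
      omega
    · obtain ⟨i, hi, hxu, hxv⟩ := hedge u hu v hv hw
      exact (hall i hi.le (hpar i)).1 u hu v hv hxu hxv
  · exact fun i _ _ => ⟨fun u hu v hv _ _ => hf u hu v hv, fun j _ hj => by simp [hpar] at hj⟩
  · exact (Finset.sum_congr rfl fun v hv => htot q v (Finset.mem_range.mp hv)).le

theorem e_last (hN : ∀ v < D.n, ¬ D.X D.N v) (q q' : ℕ → ℕ) (v : ℕ) :
    D.e par sol D.N q v = D.e par sol D.N q' v :=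
  e_congr (fun v hv hx => absurd hx (hN v hv)) v

/-- When all nodes are processed, the powers found are optimal among the choices of candidates. -/
theorem Inv.optimal (hI : D.Inv par pres sol) (hpar : ∀ i < D.N, par i ≠ 0) {q : ℕ → ℕ}
    (hq : D.Adm q) (hf : D.Feasible fun v => D.c v (q v)) (q₀ : ℕ → ℕ) :
    D.Feasible (D.e par sol D.N q₀) ∧
      ∑ v ∈ Finset.range D.n, D.e par sol D.N q₀ v ≤ ∑ v ∈ Finset.range D.n, D.c v (q v) := by
  -- Only the additional node is left. Its bag is empty, so the total does not depend on the choice,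
  -- and `q₀` may be arbitrary.
  have htot : ∀ v < D.n, D.total par sol q v = D.e par sol D.N q₀ v := by
    intro v hv
    rw [total, if_neg, Finset.sum_range_succ, if_pos hI.par_last, Finset.sum_eq_zero,
      e_last hI.bag_last q q₀, Nat.zero_add, Nat.add_zero]
    · exact fun i hi => if_neg (hpar i (Finset.mem_range.mp hi))
    · rintro ⟨i, hi, hi0, hx⟩
      rcases hi.lt_or_eq with hi | rfl
      · exact hpar i hi hi0
      · exact hI.bag_last v hv hx
  obtain ⟨h₁, h₂⟩ := hI.complete q hq hf
  refine ⟨(hI.sound q hq h₁).congr htot, ?_⟩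
  rwa [Finset.sum_congr rfl fun v hv => htot v (Finset.mem_range.mp hv)] at h₂

end Data


/-! ### Programs that evaluate a single choice at a node -/

@[simp] theorem State.set_reg (s : State) (x v y : ℕ) :
    (s.set x v).reg y = if y = x then v else s.reg y := by
  simp [State.set, Function.update_apply]

@[simp] theorem State.set_mem (s : State) (x v : ℕ) : (s.set x v).mem = s.mem := rfl

@[simp] theorem State.put_reg (s : State) (a i v : ℕ) : (s.put a i v).reg = s.reg := rfl

@[simp] theorem State.put_mem (s : State) (a i v b : ℕ) :
    (s.put a i v).mem b = if b = a then Function.update (s.mem a) i v else s.mem b := by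
  simp [State.put, Function.update_apply]

/-- The state `s` holds the data `D`, all of whose dimensions are at most `m + 2`. -/
structure Ctx (D : Data) (m : ℕ) (s : State) : Prop where
  n_le : D.n ≤ m + 2
  N_le : D.N ≤ m + 2
  L_le : D.L ≤ m + 2
  n : s.reg 0 = D.n
  N : s.reg 1 = D.N
  L : s.reg 8 = D.L
  w : s.mem 0 = D.w
  bag : s.mem 1 = D.bag
  adj : s.mem 2 = D.adj
  cand : s.mem 4 = D.cand

namespace Ctx

variable {D : Data} {m : ℕ} {s s' : State} {P : Program}

theorem frame (h : Ctx D m s) (F : Frame P s s')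
    (h₀ : P.wreg 0 = false := by rfl) (h₁ : P.wreg 1 = false := by rfl)
    (h₈ : P.wreg 8 = false := by rfl)
    (m₀ : P.wmem 0 = false := by rfl) (m₁ : P.wmem 1 = false := by rfl)
    (m₂ : P.wmem 2 = false := by rfl) (m₄ : P.wmem 4 = false := by rfl) : Ctx D m s' :=
  ⟨h.n_le, h.N_le, h.L_le, (F.reg h₀).trans h.n, (F.reg h₁).trans h.N, (F.reg h₈).trans h.L,
    (F.mem m₀).trans h.w, (F.mem m₁).trans h.bag, (F.mem m₂).trans h.adj, (F.mem m₄).trans h.cand⟩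

theorem set (h : Ctx D m s) {x v : ℕ} (h₀ : 0 ≠ x := by decide) (h₁ : 1 ≠ x := by decide)
    (h₈ : 8 ≠ x := by decide) : Ctx D m (s.set x v) :=
  ⟨h.n_le, h.N_le, h.L_le, by simp [h₀, h.n], by simp [h₁, h.N], by simp [h₈, h.L],
    h.w, h.bag, h.adj, h.cand⟩

end Ctx

/-- Store in register `35` the key of the nodes in registers `36` and `37` for the choice in
bank `5`. -/
def keyP : Program :=
  .assign 35 (.reg 36) ;;
  forLt 20 0 (
    mulP 35 8 ;; .assign 35 (.reg 60) ;; getP 24 1 36 20 0 ;;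
    .branch (.reg 24)
      (getP 24 1 37 20 0 ;;
        .branch (.reg 24) (.assign 35 (.add (.reg 35) (.read 5 (.reg 20)))) .skip)
      .skip)

variable {D : Data} {m : ℕ} {s : State}

/-- Horner's scheme for `encode`, where the digit is added only if the vertex lies in both bags. -/
theorem keyP_runs (h : Ctx D m s) :
    Runs 0 m 40 keyP s fun s' => s'.reg 35 = D.key (s.reg 36) (s.reg 37) (s.mem 5) := by
  refine .seq (.assign ?_)
  set d : ℕ → ℕ := fun v =>
    if D.X (s.reg 36) v ∧ D.X (s.reg 37) v then s.mem 5 v else 0 with hd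
  refine .forLt (fun v s' => s'.reg 35 = encode D.L (s.reg 36) d v) (k := D.n) (by simp [h.n])
    h.n_le (by simp [Expr.eval, encode]) ?_ (fun s' _ hs => hs)
  intro v hv s₁ F₁ hx hy hI
  have c₁ : Ctx D m s₁ := h.set.frame F₁
  have r36 : s₁.reg 36 = s.reg 36 := F₁.reg rfl
  have r37 : s₁.reg 37 = s.reg 37 := F₁.reg rfl
  have m5 : s₁.mem 5 = s.mem 5 := F₁.mem rfl
  refine .seq ((mulP_runs (by rw [c₁.L]; exact c₁.L_le)).conseq fun s₂ F₂ h₂ => .seq (.assign ?_))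
  have c₂ : Ctx D m s₂ := c₁.frame F₂
  rw [c₁.L, hI] at h₂
  have c₃ : Ctx D m (s₂.set 35 (Expr.eval s₂ (.reg 60))) := c₂.set
  refine .seq ((getP_runs (by rw [c₃.n]; exact c₃.n_le)).conseq fun s₄ F₄ h₄ => ?_)
  have c₄ : Ctx D m s₄ := c₃.frame F₄
  have a35 : s₄.reg 35 = encode D.L (s.reg 36) d v * D.L := by
    rw [F₄.reg rfl]; simp [Expr.eval, h₂]
  have a36 : s₄.reg 36 = s.reg 36 := by
    rw [F₄.reg rfl]; simp [F₂.reg (x := 36) rfl, r36]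
  have a37 : s₄.reg 37 = s.reg 37 := by
    rw [F₄.reg rfl]; simp [F₂.reg (x := 37) rfl, r37]
  have a20 : s₄.reg 20 = v := by
    rw [F₄.reg rfl]; simp [F₂.reg (x := 20) rfl, hx]
  have a5 : s₄.mem 5 = s.mem 5 := by
    rw [F₄.mem rfl]; simp [F₂.mem (a := 5) rfl, m5]
  have b24 : s₄.reg 24 = D.bag (s.reg 36 * D.n + v) := by
    rw [h₄, c₃.bag]; simp [F₂.reg (x := 36) rfl, F₂.reg (x := 20) rfl, r36, hx, c₂.n]
  refine .branch (fun h₅ => ?_) (fun h₅ => .skip ?_)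
  · have hX : D.X (s.reg 36) v := by simpa [Expr.eval, b24] using h₅
    refine .seq ((getP_runs (by rw [c₄.n]; exact c₄.n_le)).conseq fun s₅ F₅ h₆ => ?_)
    rw [c₄.bag, a37, a20, c₄.n] at h₆
    have a35' : s₅.reg 35 = encode D.L (s.reg 36) d v * D.L := by rw [F₅.reg rfl, a35]
    refine .branch (fun h₇ => .assign ?_) (fun h₇ => .skip ?_)
    · have hX' : D.X (s.reg 37) v := by simpa [Expr.eval, h₆] using h₇
      simp [Expr.eval, a35', encode, hd, hX, hX', F₅.reg (x := 20) rfl, F₅.mem (a := 5) rfl, a20,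
        a5]
    · have hX' : ¬ D.X (s.reg 37) v := by simpa [Expr.eval, h₆] using h₇
      simp [a35', encode, hd, hX']
  · have hX : ¬ D.X (s.reg 36) v := by simpa [Expr.eval, b24] using h₅
    simp [a35, encode, hd, hX]

namespace Ctx

variable {K a z r c : ℕ}

theorem get_bag (h : Ctx D m s)
    (hr₀ : r ≠ 60 := by decide) (hr₁ : r ≠ 61 := by decide)
    (hc₀ : c ≠ 60 := by decide) (hc₁ : c ≠ 61 := by decide) :
    Runs K m (a + 11) (getP z 1 r c 0) s
      fun s' => s'.reg z = D.bag (s.reg r * D.n + s.reg c) := by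
  have := getP_runs (K := K) (a := a) (z := z) (b := 1) (l := 0)
    (by rw [h.n]; exact h.n_le) hr₀ hr₁ hc₀ hc₁
  rwa [h.n, h.bag] at this

theorem get_w (h : Ctx D m s)
    (hr₀ : r ≠ 60 := by decide) (hr₁ : r ≠ 61 := by decide)
    (hc₀ : c ≠ 60 := by decide) (hc₁ : c ≠ 61 := by decide) :
    Runs K m (a + 11) (getP z 0 r c 0) s
      fun s' => s'.reg z = D.w (s.reg r * D.n + s.reg c) := by
  have := getP_runs (K := K) (a := a) (z := z) (b := 0) (l := 0)
    (by rw [h.n]; exact h.n_le) hr₀ hr₁ hc₀ hc₁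
  rwa [h.n, h.w] at this

theorem get_cand (h : Ctx D m s)
    (hr₀ : r ≠ 60 := by decide) (hr₁ : r ≠ 61 := by decide)
    (hc₀ : c ≠ 60 := by decide) (hc₁ : c ≠ 61 := by decide) :
    Runs K m (a + 11) (getP z 4 r c 0) s
      fun s' => s'.reg z = D.cand (s.reg r * D.n + s.reg c) := by
  have := getP_runs (K := K) (a := a) (z := z) (b := 4) (l := 0)
    (by rw [h.n]; exact h.n_le) hr₀ hr₁ hc₀ hc₁
  rwa [h.n, h.cand] at this

theorem get_adj (h : Ctx D m s)
    (hr₀ : r ≠ 60 := by decide) (hr₁ : r ≠ 61 := by decide)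
    (hc₀ : c ≠ 60 := by decide) (hc₁ : c ≠ 61 := by decide) :
    Runs K m (a + 11) (getP z 2 r c 1) s
      fun s' => s'.reg z = D.adj (s.reg r * D.N + s.reg c) := by
  have := getP_runs (K := K) (a := a) (z := z) (b := 2) (l := 1)
    (by rw [h.N]; exact h.N_le) hr₀ hr₁ hc₀ hc₁
  rwa [h.N, h.adj] at this

end Ctx

/-- Store in bank `3` the powers of the vertices of the bag of node `30` outside that of node
`31`. -/
def ownP : Program :=
  forLt 20 0 (
    getP 24 1 30 20 0 ;;
    .branch (.reg 24)
      (getP 24 1 31 20 0 ;;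
        .branch (.reg 24) (.write 3 (.reg 20) (.const 0))
          (.assign 26 (.read 5 (.reg 20)) ;; getP 28 4 20 26 0 ;; .write 3 (.reg 20) (.reg 28)))
      (.write 3 (.reg 20) (.const 0)))

theorem update_spec {f g : ℕ → ℕ} {v x : ℕ} (h : ∀ u < v, f u = g u) (hx : x = g v) :
    ∀ u < v + 1, Function.update f v x u = g u := by
  intro u hu
  by_cases huv : u = v
  · subst huv
    simp [hx]
  · rw [Function.update_of_ne huv]
    exact h u (by omega)

theorem ownP_runs (h : Ctx D m s) :
    Runs 0 m 40 ownP s fun s' => ∀ v < D.n, s'.mem 3 v =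
      D.own (s.reg 30) (s.reg 31) (s.mem 5) v := by
  refine .forLt (fun k s' => ∀ v < k, s'.mem 3 v = D.own (s.reg 30) (s.reg 31) (s.mem 5) v)
    h.n h.n_le (by simp) ?_ (fun s' _ hs => hs)
  intro v hv s₁ F₁ hx hy hI
  have c₁ : Ctx D m s₁ := h.frame F₁
  refine .seq (c₁.get_bag.conseq fun s₂ F₂ h₂ => ?_)
  have c₂ : Ctx D m s₂ := c₁.frame F₂
  have a20 : s₂.reg 20 = v := by rw [F₂.reg rfl, hx]
  have a31 : s₂.reg 31 = s.reg 31 := by rw [F₂.reg rfl, F₁.reg rfl]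
  have a5 : s₂.mem 5 = s.mem 5 := by rw [F₂.mem rfl, F₁.mem rfl]
  have a3 : s₂.mem 3 = s₁.mem 3 := F₂.mem rfl
  rw [F₁.reg (x := 30) rfl, hx] at h₂
  refine .branch (fun h₃ => ?_) (fun h₃ => .write ?_)
  · have hX : D.X (s.reg 30) v := by simpa [Expr.eval, h₂] using h₃
    refine .seq (c₂.get_bag.conseq fun s₄ F₄ h₄ => ?_)
    have c₄ : Ctx D m s₄ := c₂.frame F₄
    have b20 : s₄.reg 20 = v := by rw [F₄.reg rfl, a20]
    have b5 : s₄.mem 5 = s.mem 5 := by rw [F₄.mem rfl, a5]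
    have b3 : s₄.mem 3 = s₁.mem 3 := by rw [F₄.mem rfl, a3]
    rw [a31, a20] at h₄
    refine .branch (fun h₅ => .write ?_) (fun h₅ => .seq (.assign ?_))
    · have hX' : D.X (s.reg 31) v := by simpa [Expr.eval, h₄] using h₅
      simp only [Expr.eval, State.set_mem, State.put_mem, if_true, b20, b3]
      exact update_spec hI (by simp [Data.own, hX'])
    · have hX' : ¬ D.X (s.reg 31) v := by simpa [Expr.eval, h₄] using h₅
      refine .seq ((c₄.set.get_cand).conseq fun s₆ F₆ h₆ => .write ?_)
      have d3 : s₆.mem 3 = s₁.mem 3 := by rw [F₆.mem rfl]; exact b3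
      have d20 : s₆.reg 20 = v := by rw [F₆.reg rfl]; simp [b20]
      simp only [Expr.eval, State.set_mem, State.put_mem, if_true, d20, d3]
      refine update_spec hI ?_
      rw [h₆]
      simp [Data.own, hX, hX', Expr.eval, b20, b5]
  · have hX : ¬ D.X (s.reg 30) v := by simpa [Expr.eval, h₂] using h₃
    simp only [Expr.eval, State.set_mem, State.put_mem, if_true, a20, a3]
    exact update_spec hI (by simp [Data.own, hX])

/-- Clear register `34` unless the choice in bank `5` covers the edge between the vertices in
registers `21` and `20`. -/
def checkP : Program :=
  .assign 27 (.read 5 (.reg 21)) ;; getP 29 4 21 27 0 ;;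
  .assign 26 (.read 5 (.reg 20)) ;; getP 28 4 20 26 0 ;;
  getP 32 0 21 20 0 ;; getP 33 0 20 21 0 ;;
  .branch (.sub (.reg 32) (.reg 29))
    (.branch (.sub (.reg 33) (.reg 28)) (.assign 34 (.const 0)) .skip)
    .skip

theorem checkP_runs (h : Ctx D m s) :
    Runs 0 m 22 checkP s fun s' => s'.reg 34 ≠ 0 ↔ s.reg 34 ≠ 0 ∧
      (D.W (s.reg 21) (s.reg 20) ≤ D.c (s.reg 21) (s.mem 5 (s.reg 21)) ∨
        D.W (s.reg 20) (s.reg 21) ≤ D.c (s.reg 20) (s.mem 5 (s.reg 20))) := by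
  refine .seq (.assign ?_)
  refine .seq ((h.set.get_cand).conseq fun s₁ F₁ h₁ => .seq (.assign ?_))
  have c₁ : Ctx D m s₁ := h.set.frame F₁
  refine .seq ((c₁.set.get_cand).conseq fun s₂ F₂ h₂ => ?_)
  have c₂ : Ctx D m s₂ := c₁.set.frame F₂
  refine .seq (c₂.get_w.conseq fun s₃ F₃ h₃ => ?_)
  have c₃ : Ctx D m s₃ := c₂.frame F₃
  refine .seq (c₃.get_w.conseq fun s₄ F₄ h₄ => ?_)
  have e32 : s₄.reg 32 = D.W (s.reg 21) (s.reg 20) := by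
    rw [F₄.reg rfl, h₃, F₂.reg rfl, F₂.reg rfl]
    simp [F₁.reg (x := 21) rfl, F₁.reg (x := 20) rfl]
  have e33 : s₄.reg 33 = D.W (s.reg 20) (s.reg 21) := by
    rw [h₄, F₃.reg rfl, F₃.reg rfl, F₂.reg rfl, F₂.reg rfl]
    simp [F₁.reg (x := 21) rfl, F₁.reg (x := 20) rfl]
  have e29 : s₄.reg 29 = D.c (s.reg 21) (s.mem 5 (s.reg 21)) := by
    rw [F₄.reg rfl, F₃.reg rfl, F₂.reg rfl]
    simp [h₁, Expr.eval]
  have e28 : s₄.reg 28 = D.c (s.reg 20) (s.mem 5 (s.reg 20)) := by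
    rw [F₄.reg rfl, F₃.reg rfl, h₂]
    simp [Expr.eval, F₁.reg (x := 20) rfl, F₁.mem (a := 5) rfl]
  have e34 : s₄.reg 34 = s.reg 34 := by
    rw [F₄.reg rfl, F₃.reg rfl, F₂.reg rfl]
    simp [F₁.reg (x := 34) rfl]
  refine .branch (fun h₅ => .branch (fun h₆ => .assign ?_) fun h₆ => .skip ?_) fun h₅ => .skip ?_
  all_goals simp only [Expr.eval, e32, e29, e33, e28] at *
  · simp only [State.set_reg, if_true]
    omega
  · rw [e34]; omega
  · rw [e34]; omega

/-- Store in register `34` whether the choice in bank `5` covers all edges within the bag of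
node `30`. -/
def validP : Program :=
  .assign 34 (.const 1) ;;
  forLt 21 0 (
    getP 24 1 30 21 0 ;;
    .branch (.reg 24)
      (forLt 20 0 (getP 24 1 30 20 0 ;; .branch (.reg 24) checkP .skip))
      .skip)

theorem validP_runs (h : Ctx D m s) :
    Runs 0 m 40 validP s fun s' => s'.reg 34 ≠ 0 ↔ D.Valid (s.reg 30) (s.mem 5) := by
  refine .seq (.assign ?_)
  set R : ℕ → ℕ → Prop := fun u v => D.X (s.reg 30) u → D.X (s.reg 30) v →
    D.W u v ≤ D.c u (s.mem 5 u) ∨ D.W v u ≤ D.c v (s.mem 5 v) with hR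
  refine .forLt (fun k s' => s'.reg 34 ≠ 0 ↔ ∀ u < k, ∀ v < D.n, R u v) (k := D.n)
    (by simp [h.n]) h.n_le (by simp [Expr.eval]) ?_ (fun s' _ hs => hs)
  intro u hu s₁ F₁ hx hy hI
  have c₁ : Ctx D m s₁ := h.set.frame F₁
  have b5 : s₁.mem 5 = s.mem 5 := F₁.mem rfl
  have b30 : s₁.reg 30 = s.reg 30 := F₁.reg rfl
  refine .seq (c₁.get_bag.conseq fun s₂ F₂ h₂ => ?_)
  have c₂ : Ctx D m s₂ := c₁.frame F₂
  rw [b30, hx] at h₂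
  have hsucc : (∀ u' < u + 1, ∀ v < D.n, R u' v) ↔
      (∀ u' < u, ∀ v < D.n, R u' v) ∧ ∀ v < D.n, R u v := by
    constructor
    · exact fun h => ⟨fun u' hu' => h u' (by omega), h u (by omega)⟩
    · rintro ⟨h₁, h₂⟩ u' hu'
      rcases Nat.lt_succ_iff_lt_or_eq.mp hu' with hu' | rfl
      exacts [h₁ u' hu', h₂]
  refine .branch (fun h₃ => ?_) (fun h₃ => .skip ?_)
  · have hX : D.X (s.reg 30) u := by simpa [Expr.eval, h₂] using h₃
    refine .forLt (fun k s' => s'.reg 34 ≠ 0 ↔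
      (∀ u' < u, ∀ v < D.n, R u' v) ∧ ∀ v < k, R u v) c₂.n c₂.n_le ?_ ?_ ?_
    · simpa [F₂.reg (x := 34) rfl] using hI
    · intro v hv s₄ F₄ hx₄ hy₄ hI₄
      have c₄ : Ctx D m s₄ := c₂.frame F₄
      have d5 : s₄.mem 5 = s.mem 5 := by rw [F₄.mem rfl, F₂.mem rfl, b5]
      have d30 : s₄.reg 30 = s.reg 30 := by rw [F₄.reg rfl, F₂.reg rfl, b30]
      have d21 : s₄.reg 21 = u := by rw [F₄.reg rfl, F₂.reg rfl, hx]
      have hs : (∀ v' < v + 1, R u v') ↔ (∀ v' < v, R u v') ∧ R u v := by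
        constructor
        · exact fun h => ⟨fun u' hu' => h u' (by omega), h v (by omega)⟩
        · rintro ⟨h₁, h₂⟩ u' hu'
          rcases Nat.lt_succ_iff_lt_or_eq.mp hu' with hu' | rfl
          exacts [h₁ u' hu', h₂]
      refine .seq (c₄.get_bag.conseq fun s₅ F₅ h₅ => ?_)
      have c₅ : Ctx D m s₅ := c₄.frame F₅
      rw [d30, hx₄] at h₅
      refine .branch (fun h₆ => ?_) (fun h₆ => .skip ?_)
      · have hX' : D.X (s.reg 30) v := by simpa [Expr.eval, h₅] using h₆
        refine (checkP_runs c₅).call fun s₆ F₆ h₇ => ?_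
        rw [F₅.reg (x := 34) rfl, F₅.reg (x := 21) rfl, F₅.reg (x := 20) rfl, F₅.mem (a := 5) rfl,
          d5, d21, hx₄, hI₄] at h₇
        simp only [State.set_reg]
        rw [if_neg (by decide), h₇, hs]
        rw [and_assoc, show R u v ↔ _ from ⟨fun h => h hX hX', fun h _ _ => h⟩]
      · have hX' : ¬ D.X (s.reg 30) v := by simpa [Expr.eval, h₅] using h₆
        simp only [State.set_reg]
        rw [if_neg (by decide), F₅.reg rfl, hI₄, hs]
        simp [hR, hX']
    · intro s₄ F₄ h₄
      simp only [State.set_reg]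
      rw [if_neg (by decide), h₄, hsucc]
  · have hX : ¬ D.X (s.reg 30) u := by simpa [Expr.eval, h₂] using h₃
    simp only [State.set_reg]
    rw [if_neg (by decide), F₂.reg rfl, hI, hsucc]
    simp [hR, hX]

/-- If node `22` is a processed child of node `30`, add its table entry to the powers in bank `3`,
and clear register `34` if there is none. -/
def childP : Program :=
  .branch (.add (.sub (.read 6 (.reg 22)) (.add (.reg 30) (.const 1)))
      (.sub (.add (.reg 30) (.const 1)) (.read 6 (.reg 22))))
    .skip
    (.assign 36 (.reg 22) ;; .assign 37 (.reg 30) ;; keyP ;;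
      .branch (.read 7 (.reg 35)) .skip (.assign 34 (.const 0)) ;;
      mulP 35 0 ;; .assign 38 (.reg 60) ;;
      forLt 20 0
        (.write 3 (.reg 20) (.add (.read 3 (.reg 20)) (.read 8 (.add (.reg 38) (.reg 20))))))

/-- With truncated subtraction, `(a - b) + (b - a)` vanishes exactly if `a = b`. The `skip` branch
is thus the case where node `22` is not a child. -/
theorem childP_runs (h : Ctx D m s) :
    Runs 0 m 50 childP s fun s' =>
      (s'.reg 34 ≠ 0 ↔ s.reg 34 ≠ 0 ∧ (s.mem 6 (s.reg 22) = s.reg 30 + 1 →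
        s.mem 7 (D.key (s.reg 22) (s.reg 30) (s.mem 5)) ≠ 0)) ∧
      ∀ v < D.n, s'.mem 3 v = s.mem 3 v + if s.mem 6 (s.reg 22) = s.reg 30 + 1 then
        s.mem 8 (D.key (s.reg 22) (s.reg 30) (s.mem 5) * D.n + v) else 0 := by
  refine .branch (fun h₁ => .skip ?_) (fun h₁ => .seq (.assign (.seq (.assign ?_))))
  · have : s.mem 6 (s.reg 22) ≠ s.reg 30 + 1 := by
      simp only [Expr.eval] at h₁
      omega
    simp [this]
  have hch : s.mem 6 (s.reg 22) = s.reg 30 + 1 := by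
    simp only [Expr.eval] at h₁
    omega
  refine .seq ((keyP_runs (h.set.set)).call fun s₂ F₂ h₂ => ?_)
  have c₂ : Ctx D m s₂ := h.set.set.frame F₂
  simp only [Expr.eval, State.set_reg, State.set_mem, if_true] at h₂
  simp only [Nat.reduceEqDiff, if_false] at h₂
  set key := D.key (s.reg 22) (s.reg 30) (s.mem 5) with hkey
  have r34 : s₂.reg 34 = s.reg 34 := by rw [F₂.reg rfl]; simp
  have m7 : s₂.mem 7 = s.mem 7 := by rw [F₂.mem rfl]; simp
  have m8 : s₂.mem 8 = s.mem 8 := by rw [F₂.mem rfl]; simp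
  have m3 : s₂.mem 3 = s.mem 3 := by rw [F₂.mem rfl]; simp
  refine .seq (Runs.conseq (Q := fun s' => s'.reg 34 ≠ 0 ↔ s.reg 34 ≠ 0 ∧ s.mem 7 key ≠ 0)
    ?_ fun s₃ F₃ h₃ => ?_)
  · refine .branch (fun h₄ => .skip ?_) (fun h₄ => .assign ?_)
    · simp only [Expr.eval, h₂, m7] at h₄
      simp [r34, h₄]
    · simp only [Expr.eval, h₂, m7] at h₄
      simp [h₄, Expr.eval]
  · have c₃ : Ctx D m s₃ := c₂.frame F₃
    refine .seq ((mulP_runs (by rw [c₃.n]; exact c₃.n_le)).conseq fun s₄ F₄ h₄ => .seq (.assign ?_))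
    have c₄ : Ctx D m s₄ := c₃.frame F₄
    rw [F₃.reg (x := 35) rfl, h₂, c₃.n] at h₄
    have n34 : s₄.reg 34 = s₃.reg 34 := F₄.reg rfl
    have n3 : s₄.mem 3 = s.mem 3 := by rw [F₄.mem rfl, F₃.mem rfl, m3]
    have n8 : s₄.mem 8 = s.mem 8 := by rw [F₄.mem rfl, F₃.mem rfl, m8]
    refine .forLt (fun k s' => (∀ v < k, s'.mem 3 v = s.mem 3 v + s.mem 8 (key * D.n + v)) ∧
      ∀ v, k ≤ v → s'.mem 3 v = s.mem 3 v) (k := D.n) (by simp [c₄.n]) c₄.n_le (by simp [n3]) ?_ ?_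
    · intro v hv s₅ F₅ hx hy hI
      have p8 : s₅.mem 8 = s.mem 8 := by rw [F₅.mem rfl]; exact n8
      have p38 : s₅.reg 38 = key * D.n := by rw [F₅.reg rfl]; simp [Expr.eval, h₄]
      refine .write ?_
      simp only [Expr.eval, State.set_mem, State.put_mem, if_true, hx, p8, p38]
      refine ⟨update_spec hI.1 (by rw [hI.2 v le_rfl]), fun u hu => ?_⟩
      rw [Function.update_of_ne (by omega), hI.2 u (by omega)]
    · intro s₅ F₅ h₅
      refine ⟨?_, fun v hv => ?_⟩
      · rw [F₅.reg (x := 34) rfl]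
        simpa [n34, hch] using h₃
      · rw [if_pos hch]
        exact h₅.1 v hv

/-- Evaluate the choice in bank `5` at node `30` with parent `31`: store in register `34` whether it
is valid and extends to the processed subtrees, and in bank `3` the resulting powers of the vertices
outside the bag of the parent. -/
def evalP : Program := ownP ;; validP ;; forLt 22 1 childP

theorem evalP_runs (h : Ctx D m s) :
    Runs 0 m 60 evalP s fun s' =>
      (s'.reg 34 ≠ 0 ↔ D.Pres (s.mem 6) (s.mem 7) (s.reg 30) (s.mem 5)) ∧
      ∀ v < D.n, s'.mem 3 v = D.e (s.mem 6) (s.mem 8) (s.reg 30) (s.mem 5) v +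
        D.own (s.reg 30) (s.reg 31) (s.mem 5) v := by
  refine .seq ((ownP_runs h).call fun s₁ F₁ h₁ => .seq ?_)
  have c₁ : Ctx D m s₁ := h.frame F₁
  refine (validP_runs c₁).call fun s₂ F₂ h₂ => ?_
  have c₂ : Ctx D m s₂ := c₁.frame F₂
  rw [F₁.reg (x := 30) rfl, F₁.mem (a := 5) rfl] at h₂
  refine .forLt (fun k s' => (s'.reg 34 ≠ 0 ↔ D.Valid (s.reg 30) (s.mem 5) ∧
      ∀ j < k, s.mem 6 j = s.reg 30 + 1 → s.mem 7 (D.key j (s.reg 30) (s.mem 5)) ≠ 0) ∧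
    ∀ v < D.n, s'.mem 3 v = (∑ j ∈ Finset.range k, if s.mem 6 j = s.reg 30 + 1 then
      s.mem 8 (D.key j (s.reg 30) (s.mem 5) * D.n + v) else 0) +
        D.own (s.reg 30) (s.reg 31) (s.mem 5) v) c₂.N c₂.N_le ?_ ?_ (fun s' _ h => h)
  · refine ⟨by simpa using h₂, fun v hv => ?_⟩
    simp [F₂.mem (a := 3) rfl, h₁ v hv]
  · intro j hj s₃ F₃ hx hy hI
    have c₃ : Ctx D m s₃ := c₂.frame F₃
    refine (childP_runs c₃).call fun s₄ F₄ h₄ => ?_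
    rw [hx, F₃.reg (x := 30) rfl, F₂.reg (x := 30) rfl, F₁.reg (x := 30) rfl,
      F₃.mem (a := 5) rfl, F₂.mem (a := 5) rfl, F₁.mem (a := 5) rfl,
      F₃.mem (a := 6) rfl, F₂.mem (a := 6) rfl, F₁.mem (a := 6) rfl,
      F₃.mem (a := 7) rfl, F₂.mem (a := 7) rfl, F₁.mem (a := 7) rfl,
      F₃.mem (a := 8) rfl, F₂.mem (a := 8) rfl, F₁.mem (a := 8) rfl] at h₄
    refine ⟨?_, fun v hv => ?_⟩
    · simp only [State.set_reg]
      rw [if_neg (by decide), h₄.1, hI.1, and_assoc]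
      refine and_congr_right fun _ => ⟨?_, fun h' => ⟨fun i hi => h' i (by omega), h' j (by omega)⟩⟩
      rintro ⟨h₅, h₆⟩ i hi
      rcases Nat.lt_succ_iff_lt_or_eq.mp hi with hi | rfl
      exacts [h₅ i hi, h₆]
    · rw [State.set_mem, h₄.2 v hv, hI.2 v hv, Finset.sum_range_succ]
      omega


/-! ### Enumeration of the choices at a node -/

/-- The value of position `v` in the mixed radix system with bases `r`. -/
def place (r : ℕ → ℕ) (v : ℕ) : ℕ := ∏ u ∈ Finset.range v, r u

/-- The digit of `k` at position `v` in the mixed radix system with bases `r`. -/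
def digit (r : ℕ → ℕ) (k v : ℕ) : ℕ := k / place r v % r v

theorem place_succ (r : ℕ → ℕ) (v : ℕ) : place r (v + 1) = place r v * r v :=
  Finset.prod_range_succ r v

section Digit

variable {r : ℕ → ℕ} {k v : ℕ}

theorem place_pos (hr : ∀ v, 0 < r v) (v : ℕ) : 0 < place r v :=
  Finset.prod_pos fun u _ => hr u

theorem digit_lt (hr : ∀ v, 0 < r v) (k v : ℕ) : digit r k v < r v := Nat.mod_lt _ (hr v)

/-- The increment of `k` carries into position `v` exactly if `place r v` divides `k + 1`. Here no
carry arrives, hence none is passed on. -/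
theorem digit_succ_of_not_dvd (h : ¬ place r v ∣ k + 1) :
    digit r (k + 1) v = digit r k v ∧ ¬ place r (v + 1) ∣ k + 1 := by
  refine ⟨?_, fun h' => h ((Dvd.intro _ (place_succ r v).symm).trans h')⟩
  rw [digit, Nat.succ_div, if_neg h, Nat.add_zero, digit]

/-- A carry arrives at `v`. It is passed on exactly if the digit was maximal and wraps around to
zero; base 1 always passes it on. -/
theorem digit_succ_of_dvd (hr : ∀ v, 0 < r v) (h : place r v ∣ k + 1) :
    digit r (k + 1) v = (if digit r k v + 1 < r v then digit r k v + 1 else 0) ∧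
      (place r (v + 1) ∣ k + 1 ↔ ¬ digit r k v + 1 < r v) := by
  have h₁ : (k + 1) / place r v = k / place r v + 1 := by rw [Nat.succ_div, if_pos h]
  have h₂ : place r (v + 1) ∣ k + 1 ↔ r v ∣ k / place r v + 1 := by
    rw [place_succ, ← h₁, Nat.dvd_div_iff_mul_dvd h]
  have h₃ : digit r (k + 1) v = if digit r k v + 1 < r v then digit r k v + 1 else 0 := by
    rw [digit, h₁, digit, Nat.add_mod]
    have := Nat.mod_lt (k / place r v) (hr v)
    split_ifs with h₄
    · rw [Nat.mod_eq_of_lt (a := 1) (by omega), Nat.mod_eq_of_lt h₄]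
    · rcases Nat.lt_or_ge 1 (r v) with h₅ | h₅
      · rw [Nat.mod_eq_of_lt h₅, show k / place r v % r v + 1 = r v by omega, Nat.mod_self]
      · have : r v = 1 := by have := hr v; omega
        rw [this]
        omega
  refine ⟨h₃, ?_⟩
  rw [h₂, Nat.dvd_iff_mod_eq_zero, ← h₁]
  change digit r (k + 1) v = 0 ↔ _
  rw [h₃]
  split_ifs with h₄ <;> simp [h₄]

theorem digit_surj (hr : ∀ v, 0 < r v) (q : ℕ → ℕ) (n : ℕ) (hq : ∀ v < n, q v < r v) :
    ∃ k < place r n, ∀ v < n, digit r k v = q v := by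
  induction n with
  | zero => exact ⟨0, place_pos hr 0, fun v hv => absurd hv (Nat.not_lt_zero v)⟩
  | succ n ih =>
    obtain ⟨k, hk, hd⟩ := ih fun v hv => hq v (by omega)
    refine ⟨k + place r n * q n, ?_, fun v hv => ?_⟩
    · rw [place_succ]
      have := hq n (by omega)
      calc k + place r n * q n < place r n * (q n + 1) := by rw [Nat.mul_succ]; omega
        _ ≤ place r n * r n := Nat.mul_le_mul_left _ this
    · rcases Nat.lt_succ_iff_lt_or_eq.mp hv with hv | rfl
      · rw [← hd v hv, digit, digit]
        obtain ⟨t, ht⟩ : place r (v + 1) ∣ place r n :=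
          Finset.prod_dvd_prod_of_subset _ _ _ (by
            intro x hx
            rw [Finset.mem_range] at *
            omega)
        rw [ht, place_succ, mul_assoc, mul_assoc, Nat.add_mul_div_left _ _ (place_pos hr v),
          Nat.add_mul_mod_self_left]
      · rw [digit, Nat.add_mul_div_left _ _ (place_pos hr v), Nat.div_eq_of_lt hk, Nat.zero_add,
          Nat.mod_eq_of_lt (hq v (by omega))]

end Digit

namespace Data

/-- The number of possible choices at vertex `v` while node `l` is processed. -/
def radix (D : Data) (l v : ℕ) : ℕ := if D.X l v then D.L else 1

variable {D : Data} {par pres₀ sol₀ pres sol pres' sol' : ℕ → ℕ} {l p k : ℕ} {q : ℕ → ℕ}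

theorem radix_pos (hL : 0 < D.L) (l v : ℕ) : 0 < D.radix l v := by
  unfold radix
  split_ifs <;> omega

theorem digit_radix_lt (hL : 0 < D.L) (l k v : ℕ) : digit (D.radix l) k v < D.L := by
  have := digit_lt (r := D.radix l) (radix_pos hL l) k v
  unfold radix at this ⊢
  split_ifs at this <;> omega

/-- The tables `pres` and `sol` result from `pres₀` and `sol₀` by processing the first `k` choices
at the node `l` with parent `p`. -/
structure Partly (D : Data) (par pres₀ sol₀ pres sol : ℕ → ℕ) (l p k : ℕ) : Prop where
  other : ∀ a, (∀ q, D.Adm q → a ≠ D.key l p q) →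
    pres a = pres₀ a ∧ ∀ v < D.n, sol (a * D.n + v) = sol₀ (a * D.n + v)
  attained : ∀ q, D.Adm q → pres (D.key l p q) ≠ 0 →
    pres (D.key l p q) = ∑ v ∈ Finset.range D.n, sol (D.key l p q * D.n + v) + 1 ∧
    ∃ q', D.Adm q' ∧ D.key l p q' = D.key l p q ∧ D.Pres par pres₀ l q' ∧
      ∀ v < D.n, sol (D.key l p q * D.n + v) = D.e par sol₀ l q' v + D.own l p q' v
  le : ∀ j < k, ∀ q, D.Adm q → (∀ v < D.n, q v = digit (D.radix l) j v) →
    D.Pres par pres₀ l q → pres (D.key l p q) ≠ 0 ∧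
      ∑ v ∈ Finset.range D.n, sol (D.key l p q * D.n + v) ≤
        ∑ v ∈ Finset.range D.n, (D.e par sol₀ l q v + D.own l p q v)

theorem Partly.zero (h : ∀ q, D.Adm q → pres₀ (D.key l p q) = 0) :
    D.Partly par pres₀ sol₀ pres₀ sol₀ l p 0 :=
  ⟨fun _ _ => ⟨rfl, fun _ _ => rfl⟩, fun q hq hn => absurd (h q hq) hn,
    fun _ hj => absurd hj (Nat.not_lt_zero _)⟩

theorem own_congr {q' : ℕ → ℕ} (h : ∀ v < D.n, D.X l v → q v = q' v) {v : ℕ} (hv : v < D.n) :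
    D.own l p q v = D.own l p q' v := by
  unfold own
  split_ifs with hx
  · rw [h v hv hx.1]
  · rfl

/-- Validity, key and cost at `l` depend only on the choice on the bag of `l`. Outside the bag the
choice may be set to 0, and then it occurs in the enumeration, where such positions have base 1. -/
theorem Partly.processed (hL : 0 < D.L)
    (h : D.Partly par pres₀ sol₀ pres sol l p (place (D.radix l) D.n)) :
    D.Processed par pres₀ sol₀ pres sol l p where
  other := h.other
  attained q hq hn := (h.attained q hq hn).2
  le q hq hp := by
    obtain ⟨j, hj, hd⟩ := digit_surj (radix_pos hL l) (fun v => if D.X l v then q v else 0) D.n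
      (fun v hv => by have := hq v hv; unfold radix; split_ifs <;> omega)
    set q' := digit (D.radix l) j
    have hq' : ∀ v < D.n, D.X l v → q v = q' v := fun v hv hx => by rw [hd v hv, if_pos hx]
    have := h.le j hj q' (fun v _ => digit_radix_lt hL l j v) (fun v _ => rfl) (hp.congr hq')
    rw [key_congr (q := q) fun v hv hx _ => hq' v hv hx]
    refine ⟨this.1, this.2.trans_eq (Finset.sum_congr rfl fun v hv => ?_)⟩
    rw [e_congr hq', own_congr hq' (Finset.mem_range.mp hv)]

/-- While `l` is processed only entries with leading part `l` change, and `l` is not its own child.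
Choices can therefore be evaluated with the tables as they are at that moment. -/
theorem Partly.pres_iff (h : D.Partly par pres₀ sol₀ pres sol l p k) (hl : par l = 0)
    (hq : D.Adm q) : D.Pres par pres l q ↔ D.Pres par pres₀ l q := by
  refine and_congr_right fun _ => forall_congr' fun j => forall_congr' fun _ =>
    forall_congr' fun hj => ?_
  rw [(h.other _ fun q' hq' he => ?_).1]
  have := (key_inj hq hq' he).1
  subst this
  omega

theorem Partly.e_eq (h : D.Partly par pres₀ sol₀ pres sol l p k) (hl : par l = 0)
    (hq : D.Adm q) {v : ℕ} (hv : v < D.n) : D.e par sol l q v = D.e par sol₀ l q v := by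
  refine Finset.sum_congr rfl fun j _ => ?_
  split_ifs with hj
  · refine (h.other _ fun q' hq' he => ?_).2 v hv
    have := (key_inj hq hq' he).1
    subst this
    omega
  · rfl

/-- The tables after processing one more choice: if the powers `acc` are better than the present
table entry at address `key`, they replace it. -/
structure Updated (D : Data) (pres sol pres' sol' acc : ℕ → ℕ) (ok : Prop) (key : ℕ) : Prop where
  yes : ok ∧ (pres key = 0 ∨ ∑ v ∈ Finset.range D.n, acc v + 1 < pres key) →
    pres' = Function.update pres key (∑ v ∈ Finset.range D.n, acc v + 1) ∧
    (∀ v < D.n, sol' (key * D.n + v) = acc v) ∧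
    ∀ x, (∀ v < D.n, x ≠ key * D.n + v) → sol' x = sol x
  no : ¬ (ok ∧ (pres key = 0 ∨ ∑ v ∈ Finset.range D.n, acc v + 1 < pres key)) →
    pres' = pres ∧ sol' = sol

/-- Nonzero entries of `pres` at keys of `l` are the cost of the stored powers plus one, zero
meaning that there is no entry. Comparing with `pres` is thus comparing costs, and entries only
improve. -/
theorem Partly.succ (h : D.Partly par pres₀ sol₀ pres sol l p k) (hl : par l = 0)
    (hq : D.Adm q) (hd : ∀ v < D.n, q v = digit (D.radix l) k v) {acc : ℕ → ℕ} {ok : Prop}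
    (hok : ok ↔ D.Pres par pres l q)
    (hacc : ∀ v < D.n, acc v = D.e par sol l q v + D.own l p q v)
    (hu : D.Updated pres sol pres' sol' acc ok (D.key l p q)) :
    D.Partly par pres₀ sol₀ pres' sol' l p (k + 1) := by
  rw [h.pres_iff hl hq] at hok
  have hacc' : ∀ v < D.n, acc v = D.e par sol₀ l q v + D.own l p q v := fun v hv => by
    rw [hacc v hv, h.e_eq hl hq hv]
  have hsum : ∑ v ∈ Finset.range D.n, acc v =
      ∑ v ∈ Finset.range D.n, (D.e par sol₀ l q v + D.own l p q v) :=
    Finset.sum_congr rfl fun v hv => hacc' v (Finset.mem_range.mp hv)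
  -- Only the digits below `n` matter, so any choice with the digits of `k` may be replaced by `q`.
  have hcong : ∀ q', (∀ v < D.n, q' v = digit (D.radix l) k v) → D.Pres par pres₀ l q' →
      D.Pres par pres₀ l q ∧ D.key l p q' = D.key l p q ∧
      ∑ v ∈ Finset.range D.n, (D.e par sol₀ l q' v + D.own l p q' v) =
        ∑ v ∈ Finset.range D.n, acc v := by
    intro q' hd' hp
    have hqq : ∀ v < D.n, D.X l v → q' v = q v := fun v hv _ => by rw [hd v hv, hd' v hv]
    refine ⟨hp.congr hqq, key_congr fun v hv hx _ => hqq v hv hx, ?_⟩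
    rw [hsum]
    refine Finset.sum_congr rfl fun v hv => ?_
    rw [e_congr hqq, own_congr hqq (Finset.mem_range.mp hv)]
  by_cases hb : ok ∧ (pres (D.key l p q) = 0 ∨
      ∑ v ∈ Finset.range D.n, acc v + 1 < pres (D.key l p q))
  · obtain ⟨h₁, h₂, h₃⟩ := hu.yes hb
    have hne : ∀ a, a ≠ D.key l p q → pres' a = pres a ∧
        ∀ v < D.n, sol' (a * D.n + v) = sol (a * D.n + v) := by
      intro a ha
      refine ⟨by rw [h₁, Function.update_of_ne ha], fun v hv => h₃ _ fun v' hv' he => ha ?_⟩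
      have := congrArg (· / D.n) he
      simpa [Nat.mul_comm _ D.n, Nat.mul_add_div (Nat.zero_lt_of_lt hv), Nat.div_eq_of_lt hv,
        Nat.div_eq_of_lt hv'] using this
    have heq : pres' (D.key l p q) = ∑ v ∈ Finset.range D.n, acc v + 1 := by rw [h₁]; simp
    have hsum' : ∑ v ∈ Finset.range D.n, sol' (D.key l p q * D.n + v) =
        ∑ v ∈ Finset.range D.n, acc v :=
      Finset.sum_congr rfl fun v hv => h₂ v (Finset.mem_range.mp hv)
    refine ⟨fun a ha => ?_, fun q₁ hq₁ hn => ?_, fun j hj q₁ hq₁ hd₁ hp => ?_⟩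
    · rw [(hne a (ha q hq)).1, (h.other a ha).1]
      exact ⟨rfl, fun v hv => by rw [(hne a (ha q hq)).2 v hv, (h.other a ha).2 v hv]⟩
    · by_cases hk : D.key l p q₁ = D.key l p q
      · rw [hk, heq, hsum']
        exact ⟨rfl, q, hq, rfl, hok.mp hb.1, fun v hv => by rw [h₂ v hv, hacc' v hv]⟩
      · rw [(hne _ hk).1] at hn ⊢
        obtain ⟨h₄, q', h₅, h₆, h₇, h₈⟩ := h.attained q₁ hq₁ hn
        refine ⟨?_, q', h₅, h₆, h₇, fun v hv => by rw [(hne _ hk).2 v hv, h₈ v hv]⟩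
        rw [h₄]
        congr 1
        exact Finset.sum_congr rfl fun v hv => ((hne _ hk).2 v (Finset.mem_range.mp hv)).symm
    · rcases Nat.lt_succ_iff_lt_or_eq.mp hj with hj | rfl
      · obtain ⟨h₄, h₅⟩ := h.le j hj q₁ hq₁ hd₁ hp
        -- An earlier choice with the same key keeps its bound, since the entry was replaced by a
        -- cheaper one.
        by_cases hk : D.key l p q₁ = D.key l p q
        · rw [hk] at h₄ h₅ ⊢
          rw [heq, hsum']
          have := (h.attained q hq h₄).1
          refine ⟨by omega, le_trans ?_ h₅⟩
          rcases hb.2 with hb | hb <;> omega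
        · rw [(hne _ hk).1, Finset.sum_congr rfl fun v hv =>
            (hne _ hk).2 v (Finset.mem_range.mp hv)]
          exact ⟨h₄, h₅⟩
      · obtain ⟨_, hk, hs⟩ := hcong q₁ hd₁ hp
        rw [hk, heq, hsum', hs]
        exact ⟨by omega, le_rfl⟩
  · obtain ⟨rfl, rfl⟩ := hu.no hb
    refine ⟨h.other, h.attained, fun j hj q₁ hq₁ hd₁ hp => ?_⟩
    rcases Nat.lt_succ_iff_lt_or_eq.mp hj with hj | rfl
    · exact h.le j hj q₁ hq₁ hd₁ hp
    · obtain ⟨hp', hk, hs⟩ := hcong q₁ hd₁ hp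
      rw [hk, hs]
      have h₄ : ¬ (pres' (D.key l p q) = 0 ∨
          ∑ v ∈ Finset.range D.n, acc v + 1 < pres' (D.key l p q)) := fun h => hb ⟨hok.mpr hp', h⟩
      push Not at h₄
      have := (h.attained q hq h₄.1).1
      exact ⟨h₄.1, by omega⟩

end Data

/-! ### Programs that run through the choices at a node -/

variable {D : Data} {m : ℕ} {s : State}

/-- Enter the powers in bank `3` into the table of node `30` with parent `31`, at the key of the
choice in bank `5`, if register `34` is nonzero and they are better than the present entry. -/
def updateP : Program :=
  .assign 39 (.const 0) ;;
  forLt 20 0 (.assign 39 (.add (.reg 39) (.read 3 (.reg 20)))) ;;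
  .assign 36 (.reg 30) ;; .assign 37 (.reg 31) ;; keyP ;;
  mulP 35 0 ;; .assign 38 (.reg 60) ;;
  .branch (.reg 34)
    (.branch (.add (.sub (.const 1) (.read 7 (.reg 35)))
        (.sub (.read 7 (.reg 35)) (.add (.reg 39) (.const 1))))
      (.write 7 (.reg 35) (.add (.reg 39) (.const 1)) ;;
        forLt 20 0 (.write 8 (.add (.reg 38) (.reg 20)) (.read 3 (.reg 20))))
      .skip)
    .skip

/-- With `x` the present entry and `S` the new sum, `(1 - x) + (x - (S + 1))` is nonzero exactly if
`x = 0` or `S + 1 < x`, which is the condition in `Data.Updated`. -/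
theorem updateP_runs (h : Ctx D m s) :
    Runs 0 m 60 updateP s fun s' => D.Updated (s.mem 7) (s.mem 8) (s'.mem 7) (s'.mem 8)
      (s.mem 3) (s.reg 34 ≠ 0) (D.key (s.reg 30) (s.reg 31) (s.mem 5)) := by
  refine .seq (.assign (.seq ?_))
  refine .forLt (fun k s' => s'.reg 39 = ∑ v ∈ Finset.range k, s.mem 3 v) (k := D.n)
    (by simp [h.n]) h.n_le (by simp [Expr.eval]) ?_ ?_
  · intro v hv s₁ F₁ hx hy hI
    refine .assign ?_
    simp [Expr.eval, hI, hx, Finset.sum_range_succ, F₁.mem (a := 3) rfl]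
  intro s₁ F₁ h₁
  have c₁ : Ctx D m s₁ := h.set.frame F₁
  refine .seq (.assign (.seq (.assign ?_)))
  refine .seq ((keyP_runs (c₁.set.set)).call fun s₂ F₂ h₂ => ?_)
  have c₂ : Ctx D m s₂ := c₁.set.set.frame F₂
  simp only [Expr.eval, State.set_reg, State.set_mem, if_true] at h₂
  simp only [Nat.reduceEqDiff, if_false] at h₂
  rw [F₁.reg (x := 30) rfl, F₁.reg (x := 31) rfl, F₁.mem (a := 5) rfl] at h₂
  simp only [State.set_reg, State.set_mem, Nat.reduceEqDiff, if_false] at h₂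
  set key := D.key (s.reg 30) (s.reg 31) (s.mem 5) with hkey
  refine .seq ((mulP_runs (by rw [c₂.n]; exact c₂.n_le)).conseq fun s₃ F₃ h₃ => .seq (.assign ?_))
  have c₃ : Ctx D m s₃ := c₂.frame F₃
  rw [h₂, c₂.n] at h₃
  have r39 : s₃.reg 39 = ∑ v ∈ Finset.range D.n, s.mem 3 v := by
    rw [F₃.reg rfl, F₂.reg rfl]; simp [h₁]
  have r34 : s₃.reg 34 = s.reg 34 := by
    rw [F₃.reg rfl, F₂.reg rfl]; simp [F₁.reg (x := 34) rfl]
  have r35 : s₃.reg 35 = key := by rw [F₃.reg rfl, h₂]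
  have m3 : s₃.mem 3 = s.mem 3 := by
    rw [F₃.mem rfl, F₂.mem rfl]; simp [F₁.mem (a := 3) rfl]
  have m7 : s₃.mem 7 = s.mem 7 := by
    rw [F₃.mem rfl, F₂.mem rfl]; simp [F₁.mem (a := 7) rfl]
  have m8 : s₃.mem 8 = s.mem 8 := by
    rw [F₃.mem rfl, F₂.mem rfl]; simp [F₁.mem (a := 8) rfl]
  refine .branch (fun h₄ => .branch (fun h₅ => .seq (.write ?_)) fun h₅ => .skip ?_)
    fun h₄ => .skip ?_
  all_goals simp only [Expr.eval, State.set_reg, State.set_mem, Nat.reduceEqDiff, if_false,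
    r39, r34, r35, m7, m8] at h₄ ⊢
  · simp only [Expr.eval, State.set_reg, State.set_mem, Nat.reduceEqDiff, if_false, r39, r35, m7]
      at h₅
    refine .forLt (fun k s' => (∀ v < k, s'.mem 8 (key * D.n + v) = s.mem 3 v) ∧
      ∀ x, (∀ v < k, x ≠ key * D.n + v) → s'.mem 8 x = s.mem 8 x) (k := D.n) (by simp [c₃.n])
      c₃.n_le ?_ ?_ ?_
    · simp [m8]
    · intro v hv s₅ F₅ hx hy hI
      refine .write ?_
      have n38 : s₅.reg 38 = key * D.n := by rw [F₅.reg rfl]; simp [h₃]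
      have n3 : s₅.mem 3 = s.mem 3 := by rw [F₅.mem rfl]; simp [m3]
      simp only [Expr.eval, State.set_mem, State.put_mem, if_true, n38, n3, hx]
      refine ⟨fun u hu => ?_, fun x hx' => ?_⟩
      · by_cases huv : u = v
        · subst huv
          simp
        · rw [Function.update_of_ne (by omega), hI.1 u (by omega)]
      · rw [Function.update_of_ne (hx' v (by omega)), hI.2 x fun u hu => hx' u (by omega)]
    · intro s₅ F₅ h₆
      have n7 : s₅.mem 7 = Function.update (s.mem 7) key
          (∑ v ∈ Finset.range D.n, s.mem 3 v + 1) := by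
        rw [F₅.mem rfl]; simp [m7]
      exact ⟨fun _ => ⟨n7, h₆⟩, fun hn => absurd ⟨h₄, by omega⟩ hn⟩
  · simp only [Expr.eval, State.set_reg, State.set_mem, Nat.reduceEqDiff, if_false, r39, r35, m7]
      at h₅
    exact ⟨fun hy => by omega, fun _ => ⟨rfl, rfl⟩⟩
  · exact ⟨fun hy => absurd h₄ hy.1, fun _ => ⟨rfl, rfl⟩⟩

/-- Replace the choice in bank `5` by its successor in the enumeration of the choices at
node `30`. -/
def incrP : Program :=
  .assign 40 (.const 1) ;;
  forLt 20 0 (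
    .branch (.reg 40)
      (getP 24 1 30 20 0 ;;
        .assign 41 (.const 1) ;; .branch (.reg 24) (.assign 41 (.reg 8)) .skip ;;
        .assign 42 (.add (.read 5 (.reg 20)) (.const 1)) ;;
        .branch (.sub (.reg 41) (.reg 42))
          (.write 5 (.reg 20) (.reg 42) ;; .assign 40 (.const 0))
          (.write 5 (.reg 20) (.const 0)))
      .skip)

/-- Register `40` is the carry. The invariant ties it to the divisibility of `k + 1` by the place
value reached. -/
theorem incrP_runs (h : Ctx D m s) (hL : 0 < D.L) {k : ℕ}
    (hd : ∀ v < D.n, s.mem 5 v = digit (D.radix (s.reg 30)) k v) :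
    Runs 0 m 40 incrP s fun s' =>
      ∀ v < D.n, s'.mem 5 v = digit (D.radix (s.reg 30)) (k + 1) v := by
  refine .seq (.assign ?_)
  set r := D.radix (s.reg 30) with hr
  have hr0 : ∀ v, 0 < r v := D.radix_pos hL _
  refine .forLt (fun v s' => (∀ u < v, s'.mem 5 u = digit r (k + 1) u) ∧
    (∀ u < D.n, v ≤ u → s'.mem 5 u = digit r k u) ∧ (s'.reg 40 ≠ 0 ↔ place r v ∣ k + 1))
    (k := D.n) (by simp [h.n]) h.n_le ?_ ?_ (fun s' _ hs => hs.1)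
  · exact ⟨fun u hu => absurd hu (Nat.not_lt_zero u), fun u hu _ => hd u hu,
      by simp [Expr.eval, place]⟩
  · rintro v hv s₁ F₁ hx hy ⟨hI₁, hI₂, hI₃⟩
    have c₁ : Ctx D m s₁ := h.set.frame F₁
    refine .branch (fun h₁ => ?_) (fun h₁ => .skip ?_)
    · have hdvd := hI₃.mp h₁
      obtain ⟨hs₁, hs₂⟩ := digit_succ_of_dvd hr0 hdvd
      refine .seq (c₁.get_bag.conseq fun s₂ F₂ h₂ => .seq (.assign ?_))
      have c₂ : Ctx D m s₂ := c₁.frame F₂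
      have a30 : s₁.reg 30 = s.reg 30 := by rw [F₁.reg rfl]; simp
      rw [a30, hx] at h₂
      refine .seq (Runs.conseq (Q := fun s' => s'.reg 41 = r v) ?_ fun s₃ F₃ h₃ => ?_)
      · refine .branch (fun h₃ => .assign ?_) (fun h₃ => .skip ?_)
        · have hX : D.X (s.reg 30) v := by simpa [Expr.eval, h₂] using h₃
          simp [Expr.eval, hr, Data.radix, hX, c₂.L]
        · have hX : ¬ D.X (s.reg 30) v := by simpa [Expr.eval, h₂] using h₃
          simp [Expr.eval, hr, Data.radix, hX]
      · have b20 : s₃.reg 20 = v := by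
          rw [F₃.reg rfl]; simp [F₂.reg (x := 20) rfl, hx]
        have b5 : s₃.mem 5 = s₁.mem 5 := by
          rw [F₃.mem rfl]; simp [F₂.mem (a := 5) rfl]
        have b5v : s₃.mem 5 v = digit r k v := by rw [b5, hI₂ v hv le_rfl]
        refine .seq (.assign (.branch (fun h₄ => .seq (.write (.assign ?_))) fun h₄ => .write ?_))
        all_goals simp only [Expr.eval, State.set_reg, State.set_mem, State.put_mem, State.put_reg,
          Nat.reduceEqDiff, if_false, if_true, h₃, b20, b5v] at *
        · rw [if_pos (by omega)] at hs₁
          refine ⟨update_spec (by rw [b5]; exact hI₁) hs₁.symm, fun u hu hvu => ?_, ?_⟩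
          · rw [Function.update_of_ne (by omega), b5, hI₂ u hu (by omega)]
          · rw [hs₂]
            simp
            omega
        · rw [if_neg (by omega)] at hs₁
          refine ⟨update_spec (by rw [b5]; exact hI₁) hs₁.symm, fun u hu hvu => ?_, ?_⟩
          · rw [Function.update_of_ne (by omega), b5, hI₂ u hu (by omega)]
          · have b40 : s₃.reg 40 = s₁.reg 40 := by
              rw [F₃.reg rfl]; simp [F₂.reg (x := 40) rfl]
            rw [hs₂, b40]
            simp [h₁]
            omega
    · have hdvd : ¬ place r v ∣ k + 1 := fun hd => (hI₃.mpr hd) h₁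
      obtain ⟨hs₁, hs₂⟩ := digit_succ_of_not_dvd hdvd
      refine ⟨fun u hu => ?_, fun u hu hvu => hI₂ u hu (by omega), ?_⟩
      · rcases Nat.lt_succ_iff_lt_or_eq.mp hu with hu | rfl
        · exact hI₁ u hu
        · rw [hs₁]
          exact hI₂ u hv le_rfl
      · simpa [hs₂, Expr.eval] using h₁

/-- Store in register `43` the number of choices at node `30`. -/
def countP : Program :=
  .assign 43 (.const 1) ;;
  forLt 20 0 (getP 24 1 30 20 0 ;;
    .branch (.reg 24) (mulP 43 8 ;; .assign 43 (.reg 60)) .skip)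

theorem countP_runs (h : Ctx D m s) :
    Runs 0 m 40 countP s fun s' => s'.reg 43 = place (D.radix (s.reg 30)) D.n := by
  refine .seq (.assign ?_)
  refine .forLt (fun v s' => s'.reg 43 = place (D.radix (s.reg 30)) v)
    (k := D.n) (by simp [h.n]) h.n_le (by simp [Expr.eval, place]) ?_ (fun s' _ hs => hs)
  intro v hv s₁ F₁ hx hy hI
  have c₁ : Ctx D m s₁ := h.set.frame F₁
  refine .seq (c₁.get_bag.conseq fun s₂ F₂ h₂ => ?_)
  have c₂ : Ctx D m s₂ := c₁.frame F₂
  have a30 : s₁.reg 30 = s.reg 30 := by rw [F₁.reg rfl]; simp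
  rw [a30, hx] at h₂
  refine .branch (fun h₃ => ?_) (fun h₃ => .skip ?_)
  · have hX : D.X (s.reg 30) v := by simpa [Expr.eval, h₂] using h₃
    refine .seq ((mulP_runs (by rw [c₂.L]; exact c₂.L_le)).conseq fun s₃ F₃ h₄ => .assign ?_)
    simp [Expr.eval, h₄, F₂.reg (x := 43) rfl, hI, c₂.L, place_succ, Data.radix, hX]
  · have hX : ¬ D.X (s.reg 30) v := by simpa [Expr.eval, h₂] using h₃
    simp [F₂.reg (x := 43) rfl, hI, place_succ, Data.radix, hX]

/-- Process node `30` with parent `31`. -/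
def processP : Program :=
  countP ;; forLt 20 0 (.write 5 (.reg 20) (.const 0)) ;;
  forLt 23 43 (evalP ;; updateP ;; incrP) ;;
  .write 6 (.reg 30) (.add (.reg 31) (.const 1))

theorem processP_runs {K : ℕ} (h : Ctx D m s) (hL : 0 < D.L) (hl : s.mem 6 (s.reg 30) = 0)
    (hfresh : ∀ q, D.Adm q → s.mem 7 (D.key (s.reg 30) (s.reg 31) q) = 0)
    (hK : place (D.radix (s.reg 30)) D.n ≤ K) :
    Runs K m 80 processP s fun s' =>
      s'.mem 6 = Function.update (s.mem 6) (s.reg 30) (s.reg 31 + 1) ∧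
      D.Processed (s.mem 6) (s.mem 7) (s.mem 8) (s'.mem 7) (s'.mem 8) (s.reg 30) (s.reg 31) := by
  refine .seq ((countP_runs h).call fun s₁ F₁ h₁ => .seq ?_)
  have c₁ : Ctx D m s₁ := h.frame F₁
  refine (Runs.forLt (a := 10) (K := 0) (fun k s' => ∀ v < k, s'.mem 5 v = 0) (k := D.n)
    c₁.n c₁.n_le (by simp) ?_ (fun s' _ hs => hs)).call fun s₂ F₂ h₂ => .seq ?_
  · intro v hv s₂ F₂ hx hy hI
    refine .write ?_
    simp only [Expr.eval, State.set_mem, State.put_mem, if_true, hx]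
    exact update_spec hI rfl
  have c₂ : Ctx D m s₂ := c₁.frame F₂
  set l := s.reg 30 with hl'
  set p := s.reg 31 with hp'
  have m6 : s₂.mem 6 = s.mem 6 := by rw [F₂.mem rfl, F₁.mem rfl]
  have m7 : s₂.mem 7 = s.mem 7 := by rw [F₂.mem rfl, F₁.mem rfl]
  have m8 : s₂.mem 8 = s.mem 8 := by rw [F₂.mem rfl, F₁.mem rfl]
  have r30 : s₂.reg 30 = l := by rw [F₂.reg rfl, F₁.reg rfl]
  have r31 : s₂.reg 31 = p := by rw [F₂.reg rfl, F₁.reg rfl]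
  -- The loop over the choices, the only one whose length is not polynomially bounded; it consumes
  -- the factor `K + 1`.
  refine .forLt_many (fun k s' => (∀ v < D.n, s'.mem 5 v = digit (D.radix l) k v) ∧
    D.Partly (s.mem 6) (s.mem 7) (s.mem 8) (s'.mem 7) (s'.mem 8) l p k)
    (k := place (D.radix l) D.n) (by rw [F₂.reg rfl, h₁]) hK ?_ ?_ ?_
  · refine ⟨fun v hv => ?_, ?_⟩
    · simp [h₂ v hv, digit]
    · simp only [State.set_mem, m7, m8]
      exact .zero hfresh
  · rintro k hk s₃ F₃ hx hy ⟨hI₁, hI₂⟩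
    have c₃ : Ctx D m s₃ := c₂.frame F₃
    have n6 : s₃.mem 6 = s.mem 6 := by rw [F₃.mem rfl, m6]
    have n30 : s₃.reg 30 = l := by rw [F₃.reg rfl, r30]
    have n31 : s₃.reg 31 = p := by rw [F₃.reg rfl, r31]
    have hadm : D.Adm (s₃.mem 5) := fun v hv => by
      rw [hI₁ v hv]
      exact D.digit_radix_lt hL l k v
    refine .seq ((evalP_runs c₃).call fun s₄ F₄ h₄ => ?_)
    have c₄ : Ctx D m s₄ := c₃.frame F₄
    rw [n6, n30, n31] at h₄
    refine .seq ((updateP_runs c₄).call fun s₅ F₅ h₅ => ?_)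
    have c₅ : Ctx D m s₅ := c₄.frame F₅
    rw [F₄.mem (a := 7) rfl, F₄.mem (a := 8) rfl, F₄.mem (a := 5) rfl, F₄.reg (x := 30) rfl,
      F₄.reg (x := 31) rfl, n30, n31] at h₅
    have p30 : s₅.reg 30 = l := by rw [F₅.reg rfl, F₄.reg rfl, n30]
    refine (incrP_runs c₅ hL (k := k) ?_).call fun s₆ F₆ h₆ => ?_
    · rw [F₅.mem (a := 5) rfl, F₄.mem (a := 5) rfl, p30]
      exact hI₁
    · rw [p30] at h₆
      refine ⟨h₆, ?_⟩
      rw [State.set_mem, F₆.mem (a := 7) rfl, F₆.mem (a := 8) rfl]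
      exact hI₂.succ hl hadm hI₁ h₄.1 h₄.2 h₅
  · rintro s₃ F₃ ⟨_, h₃⟩
    refine .write ?_
    simp only [Expr.eval, State.put_mem, if_true]
    rw [F₃.mem (a := 6) rfl, m6, F₃.reg (x := 30) rfl, F₃.reg (x := 31) rfl, r30, r31]
    exact ⟨rfl, h₃.processed hL⟩


/-! ### Elimination of leaves -/

namespace Data

/-- The properties of a tree decomposition that the algorithm uses. -/
structure IsDecomposition (D : Data) : Prop where
  symm : ∀ i < D.N, ∀ j < D.N, D.A i j → D.A j i
  irrefl : ∀ i < D.N, ¬ D.A i i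
  bag_last : ∀ v < D.n, ¬ D.X D.N v
  vertex : ∀ v < D.n, ∃ i < D.N, D.X i v
  edge : ∀ u < D.n, ∀ v < D.n, D.W u v ≠ 0 → ∃ i < D.N, D.X i u ∧ D.X i v
  leaf : ∀ S : ℕ → Prop, (∃ i < D.N, S i) → ∃ i < D.N, S i ∧
    ∀ j < D.N, ∀ k < D.N, S j → S k → D.A i j → D.A i k → j = k
  cut : ∀ v < D.n, ∀ T : ℕ → Prop, (∃ i < D.N, D.X i v ∧ T i) → (∃ j < D.N, D.X j v ∧ ¬ T j) →
    ∃ i < D.N, ∃ j < D.N, D.X i v ∧ D.X j v ∧ T i ∧ ¬ T j ∧ D.A i j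

/-- For every vertex, the unprocessed nodes whose bags contain it are connected. -/
def Cut (D : Data) (par : ℕ → ℕ) : Prop :=
  ∀ v < D.n, ∀ T : ℕ → Prop, (∃ i < D.N, par i = 0 ∧ D.X i v ∧ T i) →
    (∃ j < D.N, par j = 0 ∧ D.X j v ∧ ¬ T j) →
    ∃ i < D.N, ∃ j < D.N, par i = 0 ∧ par j = 0 ∧ D.X i v ∧ D.X j v ∧ T i ∧ ¬ T j ∧ D.A i j

/-- Among the unprocessed nodes, `l` is a leaf with neighbor `p`, or isolated, and then `p` is the
additional node. -/
structure IsLeaf (D : Data) (par : ℕ → ℕ) (l p : ℕ) : Prop where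
  lt : l < D.N
  par_eq : par l = 0
  parent : p = D.N ∨ p < D.N ∧ par p = 0 ∧ D.A l p
  eq : ∀ j < D.N, par j = 0 → D.A l j → j = p

variable {D : Data} {par : ℕ → ℕ} {l p : ℕ}

theorem IsLeaf.ne (h : D.IsLeaf par l p) (hD : D.IsDecomposition) : p ≠ l := by
  have h₁ := h.lt
  rcases h.parent with h₂ | h₂
  · omega
  · rintro rfl
    exact hD.irrefl p h₁ h₂.2.2

/-- Given a bipartition `T` of the nodes other than `l`, put `l` on the side of `p`. The crossing
edge then obtained is not incident to `l`, because the only possible neighbor `p` lies on the same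
side. -/
theorem Cut.update (h : D.Cut par) (hD : D.IsDecomposition) (hl : D.IsLeaf par l p) :
    D.Cut (Function.update par l (p + 1)) := by
  rintro v hv T ⟨i, hi, hi0, hiv, hT⟩ ⟨j, hj, hj0, hjv, hT'⟩
  have hne : ∀ k, Function.update par l (p + 1) k = 0 → k ≠ l := by
    rintro k hk rfl
    simp at hk
  have hpl := hl.ne hD
  have hil₀ := hne i hi0
  have hjl₀ := hne j hj0
  rw [Function.update_of_ne hil₀] at hi0
  rw [Function.update_of_ne hjl₀] at hj0
  obtain ⟨i', hi', j', hj', hi0', hj0', hiv', hjv', hT₁, hT₂, hA⟩ :=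
    h v hv (fun x => if x = l then T p else T x)
      ⟨i, hi, hi0, hiv, by simpa [hil₀] using hT⟩
      ⟨j, hj, hj0, hjv, by simpa [hjl₀] using hT'⟩
  by_cases hil : i' = l
  · subst hil
    have := hl.eq j' hj' hj0' hA
    subst this
    simp [hpl] at hT₁ hT₂
    exact absurd hT₁ hT₂
  by_cases hjl : j' = l
  · subst hjl
    have := hl.eq i' hi' hi0' (hD.symm _ hi' _ hj' hA)
    subst this
    simp [hpl] at hT₁ hT₂
    exact absurd hT₁ hT₂
  rw [if_neg hil] at hT₁
  rw [if_neg hjl] at hT₂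
  exact ⟨i', hi', j', hj', by rwa [Function.update_of_ne hil], by rwa [Function.update_of_ne hjl],
    hiv', hjv', hT₁, hT₂, hA⟩

/-- Apply connectedness to the bipartition into `l` and the rest: the crossing edge leads from `l`
to `p`, so the vertex lies in the bag of `p`. -/
theorem Cut.separates (h : D.Cut par) (hD : D.IsDecomposition) (hl : D.IsLeaf par l p) :
    ∀ j ≤ D.N, par j = 0 → j ≠ l → ∀ v < D.n, D.X l v → D.X j v → D.X p v := by
  intro j hj hj0 hjl v hv hlv hjv
  rcases hj.lt_or_eq with hj | rfl
  · obtain ⟨i', _, j', hj', _, hj0', _, hjv', rfl, _, hA⟩ := h v hv (· = l)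
      ⟨l, hl.lt, hl.par_eq, hlv, rfl⟩ ⟨j, hj, hj0, hjv, hjl⟩
    exact hl.eq j' hj' hj0' hA ▸ hjv'
  · exact absurd hjv (hD.bag_last v hv)

/-- The number of unprocessed nodes. -/
def alive (D : Data) (par : ℕ → ℕ) : ℕ := ((Finset.range D.N).filter fun i => par i = 0).card

theorem IsLeaf.alive_update (h : D.IsLeaf par l p) :
    D.alive (Function.update par l (p + 1)) + 1 = D.alive par := by
  have hmem : l ∈ (Finset.range D.N).filter fun i => par i = 0 := by
    simp [h.lt, h.par_eq]
  unfold alive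
  rw [← Finset.card_erase_add_one hmem]
  congr 2
  ext i
  by_cases hil : i = l
  · simp [hil]
  · simp [hil]

end Data

/-! ### Programs for the leaf search and the elimination of all nodes -/

variable {D : Data} {m : ℕ} {s : State}

/-- Find an unprocessed node with at most one unprocessed neighbor, and store it in register `30`,
and the neighbor, or the number of nodes if there is none, in register `31`. -/
def findP : Program :=
  forLt 20 1 (
    .branch (.read 6 (.reg 20)) .skip
      (.assign 24 (.const 0) ;; .assign 25 (.reg 1) ;;
        forLt 21 1 (
          .branch (.read 6 (.reg 21)) .skip
            (getP 26 2 20 21 1 ;;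
              .branch (.reg 26)
                (.assign 24 (.add (.reg 24) (.const 1)) ;; .assign 25 (.reg 21))
                .skip)) ;;
        .branch (.sub (.reg 24) (.const 1)) .skip
          (.assign 30 (.reg 20) ;; .assign 31 (.reg 25))))

/-- The search does not stop at the first leaf; each later one overwrites it, and any leaf will do.
One exists by `IsDecomposition.leaf`. -/
theorem findP_runs (h : Ctx D m s) (hD : D.IsDecomposition) (hex : ∃ i < D.N, s.mem 6 i = 0) :
    Runs 0 m 40 findP s fun s' => D.IsLeaf (s.mem 6) (s'.reg 30) (s'.reg 31) := by
  set par := s.mem 6 with hpar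
  set nb : ℕ → ℕ → Prop := fun i j => par j = 0 ∧ D.A i j with hnb
  refine .forLt (fun k s' => (∃ i < k, par i = 0 ∧
      ∀ j < D.N, ∀ j' < D.N, nb i j → nb i j' → j = j') → D.IsLeaf par (s'.reg 30) (s'.reg 31))
    h.N h.N_le (by simp) ?_ ?_
  · intro i hi s₁ F₁ hx hy hI
    have c₁ : Ctx D m s₁ := h.frame F₁
    have m6 : s₁.mem 6 = par := F₁.mem rfl
    refine .branch (fun h₁ => .skip ?_) (fun h₁ => .seq (.assign (.seq (.assign (.seq ?_)))))
    · rintro ⟨i', hi', h₂, h₃⟩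
      rcases Nat.lt_succ_iff_lt_or_eq.mp hi' with hi' | rfl
      · simpa using hI ⟨i', hi', h₂, h₃⟩
      · simp [Expr.eval, m6, hx, h₂] at h₁
    have hi0 : par i = 0 := by simpa [Expr.eval, m6, hx] using h₁
    -- Register `24` counts the unprocessed neighbors met so far, and only the cases 0, 1 and at
    -- least 2 matter. The default `D.N` in register `25` becomes the parent of an isolated node.
    refine .forLt (fun k s' =>
        (s'.reg 24 = 0 ∧ s'.reg 25 = D.N ∧ ∀ j < k, ¬ nb i j) ∨
        (s'.reg 24 = 1 ∧ s'.reg 25 < k ∧ nb i (s'.reg 25) ∧ ∀ j < k, nb i j → j = s'.reg 25) ∨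
        (2 ≤ s'.reg 24 ∧ ∃ a < D.N, ∃ b < D.N, a ≠ b ∧ nb i a ∧ nb i b))
      (k := D.N) (by simp [c₁.N]) c₁.N_le ?_ ?_ ?_
    · simp [Expr.eval, c₁.N]
    · intro j hj s₂ F₂ hx₂ hy₂ hI₂
      have c₂ : Ctx D m s₂ := c₁.set.set.frame F₂
      have n6 : s₂.mem 6 = par := by rw [F₂.mem rfl]; exact m6
      have n20 : s₂.reg 20 = i := by rw [F₂.reg rfl]; simpa using hx
      have keep : ¬ nb i j → ∀ s' : State, s'.reg 24 = s₂.reg 24 → s'.reg 25 = s₂.reg 25 →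
          (s'.reg 24 = 0 ∧ s'.reg 25 = D.N ∧ ∀ j' < j + 1, ¬ nb i j') ∨
          (s'.reg 24 = 1 ∧ s'.reg 25 < j + 1 ∧ nb i (s'.reg 25) ∧
            ∀ j' < j + 1, nb i j' → j' = s'.reg 25) ∨
          (2 ≤ s'.reg 24 ∧ ∃ a < D.N, ∃ b < D.N, a ≠ b ∧ nb i a ∧ nb i b) := by
        intro hn s' h₂₄ h₂₅
        rw [h₂₄, h₂₅]
        rcases hI₂ with ⟨e₁, e₂, e₃⟩ | ⟨e₁, e₂, e₃, e₄⟩ | e₁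
        · refine .inl ⟨e₁, e₂, fun j' hj' => ?_⟩
          rcases Nat.lt_succ_iff_lt_or_eq.mp hj' with hj' | rfl
          exacts [e₃ j' hj', hn]
        · refine .inr (.inl ⟨e₁, e₂.trans j.lt_succ_self, e₃, fun j' hj' hn' => ?_⟩)
          rcases Nat.lt_succ_iff_lt_or_eq.mp hj' with hj' | rfl
          exacts [e₄ j' hj' hn', absurd hn' hn]
        · exact .inr (.inr e₁)
      refine .branch (fun h₂ => .skip (keep ?_ _ (by simp) (by simp)))
        (fun h₂ => .seq (c₂.get_adj.conseq fun s₃ F₃ h₃ => ?_))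
      · rintro ⟨h₃, _⟩
        simp [Expr.eval, n6, hx₂, h₃] at h₂
      have hj0 : par j = 0 := by simpa [Expr.eval, n6, hx₂] using h₂
      rw [n20, hx₂] at h₃
      have p24 : s₃.reg 24 = s₂.reg 24 := F₃.reg rfl
      have p25 : s₃.reg 25 = s₂.reg 25 := F₃.reg rfl
      have p21 : s₃.reg 21 = j := by rw [F₃.reg rfl, hx₂]
      refine .branch (fun h₄ => .seq (.assign (.assign ?_)))
        (fun h₄ => .skip (keep ?_ _ (by simp [p24]) (by simp [p25])))
      · have hn : nb i j := ⟨hj0, by simpa [Expr.eval, h₃] using h₄⟩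
        simp only [Expr.eval, State.set_reg, Nat.reduceEqDiff, if_false, if_true, p24, p21]
        rcases hI₂ with ⟨e₁, e₂, e₃⟩ | ⟨e₁, e₂, e₃, e₄⟩ | ⟨e₁, e₂⟩
        · refine .inr (.inl ⟨by omega, j.lt_succ_self, hn, fun j' hj' hn' => ?_⟩)
          rcases Nat.lt_succ_iff_lt_or_eq.mp hj' with hj' | rfl
          exacts [absurd hn' (e₃ j' hj'), rfl]
        · exact .inr (.inr ⟨by omega, j, hj, _, e₂.trans hj, e₂.ne', hn, e₃⟩)
        · exact .inr (.inr ⟨by omega, e₂⟩)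
      · rintro ⟨_, h₅⟩
        simp [Expr.eval, h₃] at h₄
        exact h₅ h₄
    · intro s₂ F₂ hI₂
      have q20 : s₂.reg 20 = i := by rw [F₂.reg rfl]; simpa using hx
      have q30 : s₂.reg 30 = s₁.reg 30 := by rw [F₂.reg rfl]; simp
      have q31 : s₂.reg 31 = s₁.reg 31 := by rw [F₂.reg rfl]; simp
      refine .branch (fun h₂ => .skip ?_) (fun h₂ => .seq (.assign (.assign fun _ => ?_)))
      · rintro ⟨i', hi', h₃, h₄⟩
        simp only [State.set_reg, Nat.reduceEqDiff, if_false, q30, q31]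
        rcases Nat.lt_succ_iff_lt_or_eq.mp hi' with hi' | rfl
        · exact hI ⟨i', hi', h₃, h₄⟩
        · simp only [Expr.eval] at h₂
          rcases hI₂ with hI₂ | hI₂ | ⟨_, a, ha, b, hb, hab, hna, hnb⟩
          · omega
          · omega
          · exact absurd (h₄ a ha b hb hna hnb) hab
      · simp only [Expr.eval] at h₂
        simp only [Expr.eval, State.set_reg, Nat.reduceEqDiff, if_false, if_true, q20]
        rcases hI₂ with ⟨_, e₂, e₃⟩ | ⟨_, e₂, e₃, e₄⟩ | e₁
        · exact ⟨hi, hi0, .inl e₂, fun j hj hj0 hA => absurd ⟨hj0, hA⟩ (e₃ j hj)⟩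
        · exact ⟨hi, hi0, .inr ⟨e₂, e₃⟩, fun j hj hj0 hA => e₄ j hj ⟨hj0, hA⟩⟩
        · omega
  · intro s' _ hs
    obtain ⟨i, hi, hi0, hu⟩ := hD.leaf (fun i => par i = 0) hex
    exact hs ⟨i, hi, hi0, fun j hj j' hj' hn hn' => hu j hj j' hj' hn.1 hn'.1 hn.2 hn'.2⟩

/-- Process all nodes, and store an optimal choice of candidate powers in bank `3`. -/
def mainP : Program :=
  forLt 44 1 (findP ;; processP) ;; .assign 30 (.reg 1) ;; .assign 31 (.reg 1) ;; evalP

theorem mainP_runs {K : ℕ} (h : Ctx D m s) (hL : 0 < D.L) (hD : D.IsDecomposition)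
    (h6 : ∀ i, s.mem 6 i = 0) (h7 : ∀ i, s.mem 7 i = 0)
    (hK : ∀ i < D.N, place (D.radix i) D.n ≤ K) :
    Runs K m 100 mainP s fun s' => ∀ q, D.Adm q → D.Feasible (fun v => D.c v (q v)) →
      D.Feasible (s'.mem 3) ∧
      ∑ v ∈ Finset.range D.n, s'.mem 3 v ≤ ∑ v ∈ Finset.range D.n, D.c v (q v) := by
  refine .seq ?_
  refine .forLt (fun k s' => D.Inv (s'.mem 6) (s'.mem 7) (s'.mem 8) ∧ D.Cut (s'.mem 6) ∧
    D.alive (s'.mem 6) + k = D.N) h.N h.N_le ?_ ?_ ?_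
  · refine ⟨.init h6 h7 hD.bag_last hD.vertex hD.edge, ?_, ?_⟩
    · rintro v hv T ⟨i, hi, _, hi'⟩ ⟨j, hj, _, hj'⟩
      obtain ⟨i, hi, j, hj, h'⟩ := hD.cut v hv T ⟨i, hi, hi'⟩ ⟨j, hj, hj'⟩
      exact ⟨i, hi, j, hj, h6 i, h6 j, h'⟩
    · simp [Data.alive, h6]
  · rintro k hk s₁ F₁ hx hy ⟨hI, hc, ha⟩
    have c₁ : Ctx D m s₁ := h.frame F₁
    have hex : ∃ i < D.N, s₁.mem 6 i = 0 := by
      have : 0 < D.alive (s₁.mem 6) := by omega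
      obtain ⟨i, hi⟩ := Finset.card_pos.mp this
      exact ⟨i, by simpa using hi⟩
    refine .seq ((findP_runs c₁ hD hex).call fun s₂ F₂ hl => ?_)
    have c₂ : Ctx D m s₂ := c₁.frame F₂
    rw [← F₂.mem (a := 6) rfl, ← F₂.mem (a := 7) rfl, ← F₂.mem (a := 8) rfl] at hI
    rw [← F₂.mem (a := 6) rfl] at hc ha hl
    have hp : s₂.reg 31 ≤ D.N := by rcases hl.parent with h' | h' <;> omega
    have hp0 : s₂.mem 6 (s₂.reg 31) = 0 := by
      rcases hl.parent with h' | h'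
      · rw [h']
        exact hI.par_last
      · exact h'.2.1
    refine ((processP_runs c₂ hL hl.par_eq (fun q hq =>
      hI.fresh _ hl.lt.le hl.par_eq _ q hq) (hK _ hl.lt)).mono le_rfl (by omega)).conseq ?_
    rintro s₃ F₃ ⟨h₁, h₂⟩
    simp only [State.set_mem]
    rw [h₁]
    refine ⟨hI.step h₂ hl.lt hl.par_eq hp hp0 (hl.ne hD) (hc.separates hD hl), hc.update hD hl, ?_⟩
    have := hl.alive_update
    omega
  · rintro s₁ F₁ ⟨hI, -, ha⟩
    have c₁ : Ctx D m s₁ := h.frame F₁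
    -- Final evaluation at the additional node `D.N`, taken as its own parent. Its bag is empty, so
    -- `own` vanishes, and whatever choice bank `5` holds is irrelevant.
    refine .seq (.assign (.seq (.assign ((evalP_runs c₁.set.set).call ?_))))
    rintro s₂ F₂ ⟨-, h₂⟩ q hq hf
    simp only [State.set_reg, State.set_mem, Expr.eval, Nat.reduceEqDiff, if_false, if_true,
      c₁.N] at h₂
    have hpar : ∀ i < D.N, s₁.mem 6 i ≠ 0 := by
      intro i hi hi0
      have : 0 < D.alive (s₁.mem 6) := Finset.card_pos.mpr ⟨i, by simp [hi, hi0]⟩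
      omega
    have h₃ : ∀ v < D.n, D.e (s₁.mem 6) (s₁.mem 8) D.N (s₁.mem 5) v = s₂.mem 3 v := by
      intro v hv
      rw [h₂ v hv, Data.own, if_neg fun hx => hD.bag_last v hv hx.1, Nat.add_zero]
    obtain ⟨h₄, h₅⟩ := hI.optimal hpar hq hf (s₁.mem 5)
    refine ⟨h₄.congr h₃, ?_⟩
    rwa [Finset.sum_congr rfl fun v hv => h₃ v (Finset.mem_range.mp hv)] at h₅


/-! ### Candidate powers -/

/-- The largest of the numbers `r 0, …, r (n - 1)` whose multiple by `a` is less than `b`. -/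
def best (r : ℕ → ℕ) (n a b : ℕ) : ℕ :=
  (Finset.range n).sup fun u => if a * r u < b then r u else 0

theorem le_best {r : ℕ → ℕ} {n a b u : ℕ} (hu : u < n) (h : a * r u < b) : r u ≤ best r n a b := by
  have := Finset.le_sup (f := fun u => if a * r u < b then r u else 0) (Finset.mem_range.mpr hu)
  simp only [if_pos h] at this
  exact this

theorem best_lt {r : ℕ → ℕ} {n a b : ℕ} (hb : 0 < b) : a * best r n a b < b := by
  refine Finset.sup_induction (p := fun x => a * x < b) (by simpa using hb) ?_ ?_
  · intro x hx y hy
    rcases max_choice x y with h | h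
    · rwa [h]
    · rwa [h]
  · intro u _
    split_ifs with h
    exacts [h, by simpa using hb]

theorem best_succ (r : ℕ → ℕ) (n a b : ℕ) :
    best r (n + 1) a b = max (best r n a b) (if a * r n < b then r n else 0) := by
  rw [best, Finset.range_add_one, Finset.sup_insert, best]
  exact max_comm _ _

/-- Bounds for the candidates: the `j`-th candidate is the largest number in the row `r` whose
multiple by `k + 1` is less than `level r n k B j`. -/
def level (r : ℕ → ℕ) (n k B : ℕ) : ℕ → ℕ
  | 0 => B
  | j + 1 => k * best r n (k + 1) (level r n k B j)

/-- The `j`-th candidate: the numbers in the row are rounded up to it from less than a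
`k / (k + 1)` fraction of the previous candidate. -/
def candidate (r : ℕ → ℕ) (n k B j : ℕ) : ℕ := best r n (k + 1) (level r n k B j)

section Candidate

variable {r : ℕ → ℕ} {n k b : ℕ}

/-- Each step shrinks the candidate by the factor `k / (k + 1)`. The start value `(k + 1) * b + 1`
is such that the first candidate is the largest entry that is at most `b`. -/
theorem candidate_pow_le (j : ℕ) :
    (k + 1) ^ j * candidate r n k ((k + 1) * b + 1) j ≤ k ^ j * b := by
  induction j with
  | zero =>
    have : (k + 1) * candidate r n k ((k + 1) * b + 1) 0 < (k + 1) * b + 1 :=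
      best_lt (Nat.succ_pos _)
    simpa using Nat.le_of_mul_le_mul_left (Nat.lt_succ_iff.mp this) k.succ_pos
  | succ j ih =>
    have h : (k + 1) * candidate r n k ((k + 1) * b + 1) (j + 1) ≤
        k * candidate r n k ((k + 1) * b + 1) j := by
      -- At level 0 no entry qualifies and `best` takes its default value 0.
      rcases Nat.eq_zero_or_pos (k * candidate r n k ((k + 1) * b + 1) j) with h | h
      · have h₀ : candidate r n k ((k + 1) * b + 1) (j + 1) = 0 := by
          rw [candidate, level]
          change best r n (k + 1) (k * candidate r n k ((k + 1) * b + 1) j) = 0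
          rw [h]
          simp [best]
        simp [h₀]
      · exact (best_lt h).le
    calc (k + 1) ^ (j + 1) * candidate r n k ((k + 1) * b + 1) (j + 1)
        = (k + 1) ^ j * ((k + 1) * candidate r n k ((k + 1) * b + 1) (j + 1)) := by ring
      _ ≤ (k + 1) ^ j * (k * candidate r n k ((k + 1) * b + 1) j) := Nat.mul_le_mul_left _ h
      _ = k * ((k + 1) ^ j * candidate r n k ((k + 1) * b + 1) j) := by ring
      _ ≤ k * (k ^ j * b) := Nat.mul_le_mul_left _ ih
      _ = k ^ (j + 1) * b := by ring

/-- Bernoulli's inequality `1 + j / k ≤ (1 + 1 / k) ^ j`, cleared of denominators. -/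
theorem pow_mul_add_le (k j : ℕ) : k ^ j * (k + j) ≤ (k + 1) ^ j * k := by
  induction j with
  | zero => simp
  | succ j ih =>
    calc k ^ (j + 1) * (k + (j + 1)) ≤ k ^ j * (k + j) * (k + 1) := by
          rw [pow_succ, mul_assoc, mul_assoc]
          exact Nat.mul_le_mul_left _ (by nlinarith)
      _ ≤ (k + 1) ^ j * k * (k + 1) := Nat.mul_le_mul_right _ ih
      _ = (k + 1) ^ (j + 1) * k := by ring

theorem two_mul_pow_le {k : ℕ} (hk : 0 < k) : 2 * k ^ k ≤ (k + 1) ^ k :=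
  Nat.le_of_mul_le_mul_right ((pow_mul_add_le k k).trans' (by ring_nf; rfl)) hk

/-- Every `k` steps halve the candidate, so `3 * (k * l)` steps divide the start value `n * M` by `2
^ (3 * l) ≥ n ^ 3`. As `k ≤ n`, at most `M / (k * n)` is left. -/
theorem candidate_last {l M : ℕ} (hk : 0 < k) (hkn : k ≤ n) (hn : n ≤ 2 ^ l) :
    candidate r n k ((k + 1) * (n * M) + 1) (3 * (k * l)) * (k * n) ≤ M := by
  set y := candidate r n k ((k + 1) * (n * M) + 1) (3 * (k * l)) with hy
  have h₁ : (k + 1) ^ (3 * (k * l)) * y ≤ k ^ (3 * (k * l)) * (n * M) := candidate_pow_le _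
  have h₂ : 2 ^ (3 * l) * k ^ (3 * (k * l)) ≤ (k + 1) ^ (3 * (k * l)) := by
    have := Nat.pow_le_pow_left (two_mul_pow_le hk) (3 * l)
    rw [mul_pow, ← pow_mul, ← pow_mul] at this
    convert this using 2 <;> ring
  have h₃ : 0 < k ^ (3 * (k * l)) := Nat.pow_pos hk
  have h₄ : 2 ^ (3 * l) * y ≤ n * M := by
    refine Nat.le_of_mul_le_mul_left ?_ h₃
    calc k ^ (3 * (k * l)) * (2 ^ (3 * l) * y) = 2 ^ (3 * l) * k ^ (3 * (k * l)) * y := by ring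
      _ ≤ (k + 1) ^ (3 * (k * l)) * y := Nat.mul_le_mul_right _ h₂
      _ ≤ _ := h₁
  have h₅ : n * (k * n) ≤ 2 ^ (3 * l) := by
    calc n * (k * n) ≤ 2 ^ l * (2 ^ l * 2 ^ l) := by gcongr; omega
      _ = 2 ^ (3 * l) := by ring
  have hn0 : 0 < n := by omega
  refine Nat.le_of_mul_le_mul_left ?_ hn0
  calc n * (y * (k * n)) = n * (k * n) * y := by ring
    _ ≤ 2 ^ (3 * l) * y := Nat.mul_le_mul_right _ h₅
    _ ≤ n * M := h₄

/-- Descend through the levels: as long as no candidate has been close enough, the entry is still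
below the current level, hence at most the next candidate. If this persists, the last candidate
serves. -/
theorem exists_candidate {B u : ℕ} (hu : u < n) (h : (k + 1) * r u < B) (L : ℕ) :
    ∃ j < L + 1, r u ≤ candidate r n k B j ∧ (k * candidate r n k B j ≤ (k + 1) * r u ∨ j = L) := by
  suffices h : ∀ j, (∃ i < j, r u ≤ candidate r n k B i ∧
      k * candidate r n k B i ≤ (k + 1) * r u) ∨ (k + 1) * r u < level r n k B j by
    rcases h L with ⟨i, hi, h₁, h₂⟩ | h₁
    · exact ⟨i, by omega, h₁, .inl h₂⟩
    · exact ⟨L, by omega, le_best hu h₁, .inr rfl⟩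
  intro j
  induction j with
  | zero => exact .inr h
  | succ j ih =>
    rcases ih with ⟨i, hi, h₁⟩ | h₁
    · exact .inl ⟨i, by omega, h₁⟩
    · by_cases h₂ : k * candidate r n k B j ≤ (k + 1) * r u
      · exact .inl ⟨j, by omega, le_best hu h₁, h₂⟩
      · exact .inr (by simpa [level, candidate] using h₂)

end Candidate

/-- Every weight up to `n * M` is at most some candidate of its vertex, which exceeds it only
slightly. -/
def Rounds (n L k M num den : ℕ) (w c : ℕ → ℕ) : Prop :=
  ∀ v < n, ∀ u < n, w (v * n + u) ≤ n * M → ∃ j < L, w (v * n + u) ≤ c (v * n + j) ∧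
    (c (v * n + j) = w (v * n + u) ∨ 2 * den ≤ k * num ∧
      (k * c (v * n + j) ≤ (k + 1) * w (v * n + u) ∨ c (v * n + j) * (k * n) ≤ M))

/-! ### Programs that compute the candidates -/

variable {m n : ℕ} {s : State}

/-- Compute the precision: store in register `4` the least `k ≥ 1` with `2 * den ≤ k * num`, but at
most `n + 1`. -/
def rateP : Program :=
  .assign 4 (.const 1) ;; .assign 5 (.reg 2) ;;
  forLt 20 0 (
    .branch (.sub (.add (.reg 3) (.reg 3)) (.reg 5))
      (.assign 4 (.add (.reg 4) (.const 1)) ;; .assign 5 (.add (.reg 5) (.reg 2)))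
      .skip)

/-- Since `1 / ε` may be huge compared to `n`, the search is cut off after `n` rounds. The cut-off
value `n + 1` makes `prepareP` use whole rows, so that no precision is needed. -/
theorem rateP_runs (hn : s.reg 0 = n) (hm : n ≤ m + 2) :
    Runs 0 m 30 rateP s fun s' => 0 < s'.reg 4 ∧ s'.reg 4 ≤ n + 1 ∧
      (s'.reg 4 = 1 ∨ (s'.reg 4 - 1) * s.reg 2 < 2 * s.reg 3) ∧
      (2 * s.reg 3 ≤ s'.reg 4 * s.reg 2 ∨ s'.reg 4 = n + 1) := by
  refine .seq (.assign (.seq (.assign ?_)))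
  refine .forLt (fun i s' => s'.reg 5 = s'.reg 4 * s.reg 2 ∧ 0 < s'.reg 4 ∧ s'.reg 4 ≤ i + 1 ∧
      (s'.reg 4 = 1 ∨ (s'.reg 4 - 1) * s.reg 2 < 2 * s.reg 3) ∧
      (2 * s.reg 3 ≤ s'.reg 4 * s.reg 2 ∨ s'.reg 4 = i + 1)) (k := n)
    (by simp [hn]) hm (by simp [Expr.eval]) ?_ (fun s' _ h => h.2)
  rintro i hi s₁ F₁ hx hy ⟨h₁, h₂, h₃, h₄, h₅⟩
  have r2 : s₁.reg 2 = s.reg 2 := by rw [F₁.reg rfl]; simp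
  have r3 : s₁.reg 3 = s.reg 3 := by rw [F₁.reg rfl]; simp
  refine .branch (fun h => .seq (.assign (.assign ?_))) (fun h => .skip ?_)
  all_goals
    simp only [Expr.eval, r3, h₁] at h
    simp only [Expr.eval, State.set_reg, Nat.reduceEqDiff, if_false, if_true, r2, h₁]
  · refine ⟨by ring, by omega, by omega, .inr ?_, ?_⟩
    · rw [Nat.add_sub_cancel]
      omega
    · right
      omega
  · exact ⟨trivial, h₂, by omega, h₄, .inl (by omega)⟩

/-- Store in register `6` the least `l` with `n ≤ 2 ^ l`. -/
def logP : Program :=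
  .assign 6 (.const 0) ;; .assign 7 (.const 1) ;;
  forLt 20 0 (
    .branch (.sub (.reg 0) (.reg 7))
      (.assign 7 (.add (.reg 7) (.reg 7)) ;; .assign 6 (.add (.reg 6) (.const 1)))
      .skip)

theorem logP_runs (hn : s.reg 0 = n) (hm : n ≤ m + 2) :
    Runs 0 m 30 logP s fun s' => n ≤ 2 ^ s'.reg 6 ∧ s'.reg 6 ≤ n ∧
      (s'.reg 6 = 0 ∨ 2 ^ (s'.reg 6 - 1) < n) := by
  refine .seq (.assign (.seq (.assign ?_)))
  refine .forLt (fun i s' => s'.reg 7 = 2 ^ s'.reg 6 ∧ s'.reg 6 ≤ i ∧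
      (s'.reg 6 = 0 ∨ 2 ^ (s'.reg 6 - 1) < n) ∧ (n ≤ 2 ^ s'.reg 6 ∨ s'.reg 6 = i)) (k := n)
    (by simp [hn]) hm (by simp [Expr.eval]) ?_ ?_
  · rintro i hi s₁ F₁ hx hy ⟨h₁, h₂, h₃, h₄⟩
    refine .branch (fun h => .seq (.assign (.assign ?_))) (fun h => .skip ?_)
    all_goals
      simp only [Expr.eval, hy, h₁] at h
      simp only [Expr.eval, State.set_reg, Nat.reduceEqDiff, if_false, if_true, h₁]
    · refine ⟨by ring, by omega, .inr ?_, ?_⟩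
      · rw [Nat.add_sub_cancel]
        omega
      · right
        omega
    · exact ⟨trivial, by omega, h₃, .inl (by omega)⟩
  · rintro s' _ ⟨_, h₂, h₃, h₄⟩
    refine ⟨?_, h₂, h₃⟩
    rcases h₄ with h₄ | h₄
    · exact h₄
    · rw [h₄]
      exact n.lt_two_pow_self.le

/-- Store in register `9` the largest power that an edge needs, given the choice between its
endpoints. -/
def maxP : Program :=
  .assign 9 (.const 0) ;;
  forLt 20 0 (forLt 21 0 (
    getP 24 0 20 21 0 ;; getP 25 0 21 20 0 ;;
    .assign 26 (.sub (.reg 24) (.sub (.reg 24) (.reg 25))) ;;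
    .assign 9 (.add (.reg 9) (.sub (.reg 26) (.reg 9)))))

/-- `M` is the largest power that an edge needs, given the choice between its endpoints. -/
def IsBottleneck (n M : ℕ) (w : ℕ → ℕ) : Prop :=
  (∀ u < n, ∀ v < n, min (w (u * n + v)) (w (v * n + u)) ≤ M) ∧
    (M = 0 ∨ ∃ u < n, ∃ v < n, M = min (w (u * n + v)) (w (v * n + u)))

/-- With truncated subtraction, `x - (x - y)` is the minimum and `x + (y - x)` the maximum. -/
theorem maxP_runs (hn : s.reg 0 = n) (hm : n ≤ m + 2) :
    Runs 0 m 40 maxP s fun s' => IsBottleneck n (s'.reg 9) (s.mem 0) := by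
  refine .seq (.assign ?_)
  set w := s.mem 0 with hw
  set E : ℕ → ℕ → ℕ := fun u v => min (w (u * n + v)) (w (v * n + u)) with hE
  refine .forLt (fun i s' => (∀ u < i, ∀ v < n, E u v ≤ s'.reg 9) ∧
    (s'.reg 9 = 0 ∨ ∃ u < n, ∃ v < n, s'.reg 9 = E u v)) (k := n)
    (by simp [hn]) hm (by simp [Expr.eval]) ?_ (fun s' _ h => h)
  rintro u hu s₁ F₁ hx₁ hy₁ hI₁
  refine .forLt (fun i s' => ((∀ u' < u, ∀ v < n, E u' v ≤ s'.reg 9) ∧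
    ∀ v < i, E u v ≤ s'.reg 9) ∧
    (s'.reg 9 = 0 ∨ ∃ u < n, ∃ v < n, s'.reg 9 = E u v)) (k := n) hy₁ hm ?_ ?_ ?_
  · simpa using hI₁
  · rintro v hv s₂ F₂ hx₂ hy₂ ⟨hI₂, hI₃⟩
    refine .seq ((getP_runs (by rwa [hy₂])).conseq fun s₃ F₃ h₃ => ?_)
    have n0 : s₃.reg 0 = n := by rw [F₃.reg rfl, hy₂]
    refine .seq ((getP_runs (by rwa [n0])).conseq fun s₄ F₄ h₄ => .seq (.assign (.assign ?_)))
    have e20 : s₂.reg 20 = u := by rw [F₂.reg rfl]; simpa using hx₁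
    have e0 : s₂.mem 0 = w := by rw [F₂.mem rfl]; simp [F₁.mem (a := 0) rfl, hw]
    rw [e20, hx₂, hy₂, e0] at h₃
    rw [F₃.reg (x := 21) rfl, F₃.reg (x := 20) rfl, n0, F₃.mem (a := 0) rfl, e20, hx₂, e0] at h₄
    have e24 : s₄.reg 24 = w (u * n + v) := by rw [F₄.reg rfl, h₃]
    have e9 : s₄.reg 9 = s₂.reg 9 := by rw [F₄.reg rfl, F₃.reg rfl]
    simp only [Expr.eval, State.set_reg, Nat.reduceEqDiff, if_false, if_true, e24, e9, h₄]
    have hmax : s₂.reg 9 + (w (u * n + v) - (w (u * n + v) - w (v * n + u)) - s₂.reg 9) =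
        max (s₂.reg 9) (E u v) := by
      simp only [hE]
      omega
    rw [hmax]
    refine ⟨⟨fun u' hu' v' hv' => le_max_of_le_left (hI₂.1 u' hu' v' hv'), fun v' hv' => ?_⟩, ?_⟩
    · rcases Nat.lt_succ_iff_lt_or_eq.mp hv' with hv' | rfl
      exacts [le_max_of_le_left (hI₂.2 v' hv'), le_max_right _ _]
    · rcases max_cases (s₂.reg 9) (E u v) with ⟨h, _⟩ | ⟨h, _⟩
      · rwa [h]
      · exact .inr ⟨u, hu, v, hv, h⟩
  · rintro s₂ F₂ ⟨h₁, h₂⟩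
    simp only [State.set_reg, Nat.reduceEqDiff, if_false]
    refine ⟨fun u' hu' => ?_, h₂⟩
    rcases Nat.lt_succ_iff_lt_or_eq.mp hu' with hu' | rfl
    exacts [h₁.1 u' hu', h₁.2]

/-- Take all weights as candidates. -/
def exactP : Program :=
  forLt 20 0 (forLt 21 0 (
    mulP 20 0 ;; .write 4 (.add (.reg 60) (.reg 21)) (.read 0 (.add (.reg 60) (.reg 21)))))

theorem row_ne {u u' v v' : ℕ} (hv : v < n) (hv' : v' < n) (h : u ≠ u') :
    u * n + v ≠ u' * n + v' := by
  intro he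
  have := congrArg (· / n) he
  simp only [Nat.mul_comm _ n, Nat.mul_add_div (Nat.zero_lt_of_lt hv), Nat.div_eq_of_lt hv,
    Nat.div_eq_of_lt hv'] at this
  omega

theorem exactP_runs (hn : s.reg 0 = n) (hm : n ≤ m + 2) :
    Runs 0 m 40 exactP s fun s' => ∀ u < n, ∀ v < n,
      s'.mem 4 (u * n + v) = s.mem 0 (u * n + v) := by
  refine .forLt (fun i s' => ∀ u < i, ∀ v < n, s'.mem 4 (u * n + v) = s.mem 0 (u * n + v))
    hn hm (by simp) ?_ (fun s' _ h => h)
  intro u hu s₁ F₁ hx₁ hy₁ hI₁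
  refine .forLt (fun i s' => (∀ u' < u, ∀ v < n, s'.mem 4 (u' * n + v) = s.mem 0 (u' * n + v)) ∧
    ∀ v < i, s'.mem 4 (u * n + v) = s.mem 0 (u * n + v)) (k := n) hy₁ hm ?_ ?_ ?_
  · simpa using hI₁
  · intro v hv s₂ F₂ hx₂ hy₂ hI₂
    refine .seq ((mulP_runs (by rwa [hy₂])).conseq fun s₃ F₃ h₃ => .write ?_)
    have e20 : s₂.reg 20 = u := by rw [F₂.reg rfl, hx₁]
    rw [e20, hy₂] at h₃
    have e21 : s₃.reg 21 = v := by rw [F₃.reg rfl, hx₂]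
    have e0 : s₃.mem 0 = s.mem 0 := by rw [F₃.mem rfl, F₂.mem rfl, F₁.mem rfl]
    have e4 : s₃.mem 4 = s₂.mem 4 := F₃.mem rfl
    simp only [Expr.eval, State.set_mem, State.put_mem, if_true, h₃, e21, e0, e4]
    refine ⟨fun u' hu' v' hv' => ?_, fun v' hv' => ?_⟩
    · rw [Function.update_of_ne (row_ne hv' hv hu'.ne), hI₂.1 u' hu' v' hv']
    · rcases Nat.lt_succ_iff_lt_or_eq.mp hv' with hv' | rfl
      · rw [Function.update_of_ne (by omega), hI₂.2 v' hv']
      · rw [Function.update_self]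
  · rintro s₂ F₂ h₁ u' hu'
    rcases Nat.lt_succ_iff_lt_or_eq.mp hu' with hu' | rfl
    exacts [h₁.1 u' hu', h₁.2]

/-- Take as candidates weights in geometric progression, starting below the bound in register
`10`. -/
def approxP : Program :=
  .assign 12 (.add (.reg 4) (.const 1)) ;;
  forLt 20 0 (
    mulP 10 12 ;; .assign 13 (.add (.reg 60) (.const 1)) ;;
    forLt 22 8 (
      .assign 14 (.const 0) ;;
      forLt 21 0 (
        getP 24 0 20 21 0 ;; mulP 24 12 ;;
        .branch (.sub (.reg 13) (.reg 60))
          (.assign 14 (.add (.reg 14) (.sub (.reg 24) (.reg 14)))) .skip) ;;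
      mulP 20 0 ;; .write 4 (.add (.reg 60) (.reg 22)) (.reg 14) ;;
      mulP 14 4 ;; .assign 13 (.reg 60)))

theorem approxP_runs {k L b : ℕ} (hn : s.reg 0 = n) (hm : n ≤ m + 2) (hk : s.reg 4 = k)
    (hkm : k + 1 ≤ m + 2) (hL : s.reg 8 = L) (hLn : L ≤ n) (hb : s.reg 10 = b) :
    Runs 0 m 50 approxP s fun s' => ∀ v < n, ∀ j < L, s'.mem 4 (v * n + j) =
      candidate (fun u => s.mem 0 (v * n + u)) n k ((k + 1) * b + 1) j := by
  refine .seq (.assign ?_)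
  set y : ℕ → ℕ → ℕ := fun v =>
    candidate (fun u => s.mem 0 (v * n + u)) n k ((k + 1) * b + 1) with hy
  set lv : ℕ → ℕ → ℕ := fun v =>
    level (fun u => s.mem 0 (v * n + u)) n k ((k + 1) * b + 1) with hlv
  refine .forLt (fun i s' => ∀ v < i, ∀ j < L, s'.mem 4 (v * n + j) = y v j) (k := n)
    (by simp [hn]) hm (by simp) ?_ (fun s' _ h => h)
  intro v hv s₁ F₁ hx₁ hy₁ hI₁
  have e12 : s₁.reg 12 = k + 1 := by rw [F₁.reg rfl]; simp [Expr.eval, hk]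
  have e10 : s₁.reg 10 = b := by rw [F₁.reg rfl]; simp [hb]
  refine .seq ((mulP_runs (by rwa [e12])).conseq fun s₂ F₂ h₂ => .seq (.assign ?_))
  rw [e12, e10] at h₂
  refine .forLt (fun i s' => s'.reg 13 = lv v i ∧
    (∀ v' < v, ∀ j < L, s'.mem 4 (v' * n + j) = y v' j) ∧
    ∀ j < i, s'.mem 4 (v * n + j) = y v j) (k := L) ?_ (hLn.trans hm) ?_ ?_ ?_
  · simp [F₂.reg (x := 8) rfl, F₁.reg (x := 8) rfl, hL]
  · refine ⟨?_, ?_, fun j hj => absurd hj (Nat.not_lt_zero j)⟩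
    · simp [Expr.eval, h₂, hlv, level, Nat.mul_comm]
    · simpa [F₂.mem (a := 4) rfl] using hI₁
  · rintro j hj s₃ F₃ hx₃ hy₃ ⟨hI₃, hI₄, hI₅⟩
    have r20 : s₃.reg 20 = v := by rw [F₃.reg rfl]; simp [F₂.reg (x := 20) rfl, hx₁]
    have r12 : s₃.reg 12 = k + 1 := by rw [F₃.reg rfl]; simp [F₂.reg (x := 12) rfl, e12]
    have r0 : s₃.reg 0 = n := by rw [F₃.reg rfl]; simp [F₂.reg (x := 0) rfl, hy₁]
    have r4 : s₃.reg 4 = k := by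
      rw [F₃.reg rfl]; simp [F₂.reg (x := 4) rfl, F₁.reg (x := 4) rfl, hk]
    have b0 : s₃.mem 0 = s.mem 0 := by
      rw [F₃.mem rfl]; simp [F₂.mem (a := 0) rfl, F₁.mem (a := 0) rfl]
    refine .seq (.assign (.seq ?_))
    refine .forLt (fun i s' =>
      s'.reg 14 = best (fun u => s.mem 0 (v * n + u)) i (k + 1) (lv v j)) (k := n)
      (by simp [r0]) hm (by simp [Expr.eval, best]) ?_ ?_
    · intro u hu s₄ F₄ hx₄ hy₄ hI
      have p20 : s₄.reg 20 = v := by rw [F₄.reg rfl]; simp [r20]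
      have p0 : s₄.mem 0 = s.mem 0 := by rw [F₄.mem rfl]; simp [b0]
      have p13 : s₄.reg 13 = lv v j := by rw [F₄.reg rfl]; simp [hI₃]
      have p12 : s₄.reg 12 = k + 1 := by rw [F₄.reg rfl]; simp [r12]
      refine .seq ((getP_runs (by rwa [hy₄])).conseq fun s₅ F₅ h₅ => ?_)
      rw [p20, p0, hx₄, hy₄] at h₅
      have q12 : s₅.reg 12 = k + 1 := by rw [F₅.reg rfl, p12]
      refine .seq ((mulP_runs (by rwa [q12])).conseq fun s₆ F₆ h₆ => ?_)
      rw [h₅, q12] at h₆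
      have t13 : s₆.reg 13 = lv v j := by rw [F₆.reg rfl, F₅.reg rfl, p13]
      have t14 : s₆.reg 14 = s₄.reg 14 := by rw [F₆.reg rfl, F₅.reg rfl]
      have t24 : s₆.reg 24 = s.mem 0 (v * n + u) := by rw [F₆.reg rfl, h₅]
      refine .branch (fun h => .assign ?_) (fun h => .skip ?_)
      all_goals
        simp only [Expr.eval, t13, h₆] at h
        simp only [Expr.eval, State.set_reg, Nat.reduceEqDiff, if_false, if_true, t14, t24, hI,
          best_succ]
      · rw [if_pos (by rw [Nat.mul_comm]; omega)]
        omega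
      · rw [if_neg (by rw [Nat.mul_comm]; omega)]
        omega
    · intro s₄ F₄ h₄
      have p0 : s₄.reg 0 = n := by rw [F₄.reg rfl]; simp [r0]
      have p20 : s₄.reg 20 = v := by rw [F₄.reg rfl]; simp [r20]
      refine .seq ((mulP_runs (by rwa [p0])).conseq fun s₅ F₅ h₅ => .seq (.write ?_))
      rw [p0, p20] at h₅
      have q4 : s₅.reg 4 = k := by rw [F₅.reg rfl, F₄.reg rfl]; simp [r4]
      refine .seq ((mulP_runs (by rw [State.put_reg, q4]; omega)).conseq fun s₆ F₆ h₆ =>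
        .assign ?_)
      have q14 : s₅.reg 14 = y v j := by rw [F₅.reg rfl, h₄]; rfl
      have q22 : s₅.reg 22 = j := by rw [F₅.reg rfl, F₄.reg rfl]; simp [hx₃]
      have q44 : s₅.mem 4 = s₃.mem 4 := by rw [F₅.mem rfl, F₄.mem rfl]; simp
      rw [State.put_reg, q14, q4] at h₆
      simp only [Expr.eval, State.set_reg, State.set_mem, Nat.reduceEqDiff, if_false, if_true, h₆]
      rw [F₆.mem (a := 4) rfl]
      simp only [Expr.eval, State.put_mem, if_true, h₅, q22, q14, q44]
      refine ⟨Nat.mul_comm _ _, fun v' hv' j' hj' => ?_, fun j' hj' => ?_⟩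
      · rw [Function.update_of_ne (row_ne (by omega) (by omega) hv'.ne), hI₄ v' hv' j' hj']
      · rcases Nat.lt_succ_iff_lt_or_eq.mp hj' with hj' | rfl
        · rw [Function.update_of_ne (by omega), hI₅ j' hj']
        · rw [Function.update_self]
  · rintro s₃ F₃ ⟨_, h₃, h₄⟩ v' hv'
    rcases Nat.lt_succ_iff_lt_or_eq.mp hv' with hv' | rfl
    exacts [h₃ v' hv', h₄]

/-- Compute the candidates, with their number per vertex in register `8`. -/
def prepareP : Program :=
  rateP ;; logP ;; maxP ;;
  mulP 9 0 ;; .assign 10 (.reg 60) ;;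
  mulP 4 6 ;; .assign 11 (.add (.add (.reg 60) (.add (.reg 60) (.reg 60))) (.const 1)) ;;
  .branch (.sub (.reg 0) (.reg 11))
    (.assign 8 (.reg 11) ;; approxP)
    (.assign 8 (.reg 0) ;; exactP)

/-- The properties of the precision `k`, the logarithm `l`, the bottleneck `M` and the candidates
`c`, of which there are `L` per vertex. -/
structure Prepared (n num den : ℕ) (w : ℕ → ℕ) (k l M L : ℕ) (c : ℕ → ℕ) : Prop where
  k_pos : 0 < k
  k_le : k = 1 ∨ (k - 1) * num < 2 * den
  l_le : l = 0 ∨ 2 ^ (l - 1) < n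
  L_pos : 0 < L
  L_le_n : L ≤ n
  L_le : L ≤ 3 * (k * l) + 1
  bottleneck : IsBottleneck n M w
  rounds : Rounds n L k M num den w c

/-- The number of candidates is the minimum of `n` and `3 * (k * l) + 1`: whole rows are taken
unless the geometric selection is shorter. -/
theorem prepareP_runs (hn : s.reg 0 = n) (hn0 : 0 < n) (hm : n ≤ m) :
    Runs 0 m 70 prepareP s fun s' => ∃ k l M,
      Prepared n (s.reg 2) (s.reg 3) (s.mem 0) k l M (s'.reg 8) (s'.mem 4) := by
  have hm' : n ≤ m + 2 := by omega
  refine .seq ((rateP_runs hn hm').call fun s₁ F₁ h₁ => ?_)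
  have n₁ : s₁.reg 0 = n := by rw [F₁.reg rfl, hn]
  refine .seq ((logP_runs n₁ hm').call fun s₂ F₂ h₂ => ?_)
  have n₂ : s₂.reg 0 = n := by rw [F₂.reg rfl, n₁]
  refine .seq ((maxP_runs n₂ hm').call fun s₃ F₃ h₃ => ?_)
  have n₃ : s₃.reg 0 = n := by rw [F₃.reg rfl, n₂]
  rw [F₂.mem (a := 0) rfl, F₁.mem (a := 0) rfl] at h₃
  refine .seq ((mulP_runs (by rwa [n₃])).conseq fun s₄ F₄ h₄ => .seq (.assign ?_))
  rw [n₃] at h₄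
  set k := s₁.reg 4 with hk
  set l := s₂.reg 6 with hl
  set M := s₃.reg 9 with hM
  have e6 : s₄.reg 6 = l := by rw [F₄.reg rfl, F₃.reg rfl]
  have e4 : s₄.reg 4 = k := by rw [F₄.reg rfl, F₃.reg rfl, F₂.reg rfl]
  refine .seq ((mulP_runs (by simp only [State.set_reg, Nat.reduceEqDiff, if_false, e6]; omega)
    ).conseq fun s₅ F₅ h₅ => .seq (.assign ?_))
  simp only [State.set_reg, Nat.reduceEqDiff, if_false, e6, e4] at h₅
  have n₅ : s₅.reg 0 = n := by rw [F₅.reg rfl]; simp [F₄.reg (x := 0) rfl, n₃]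
  have f4 : s₅.reg 4 = k := by rw [F₅.reg rfl]; simp [e4]
  have f10 : s₅.reg 10 = n * M := by rw [F₅.reg rfl]; simp [Expr.eval, h₄, Nat.mul_comm]
  have f0 : s₅.mem 0 = s.mem 0 := by
    rw [F₅.mem rfl]; simp [F₄.mem (a := 0) rfl, F₃.mem (a := 0) rfl, F₂.mem (a := 0) rfl,
      F₁.mem (a := 0) rfl]
  have hL : 3 * (k * l) + 1 = k * l + (k * l + k * l) + 1 := by ring
  refine .branch (fun h => .seq (.assign ?_)) (fun h => .seq (.assign ?_))
  all_goals
    simp only [Expr.eval, State.set_reg, Nat.reduceEqDiff, if_false, if_true, n₅, h₅] at h ⊢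
    rw [← hL] at *
  · refine (approxP_runs (n := n) (k := k) (L := 3 * (k * l) + 1) (b := n * M) (by simp [n₅]) hm'
      (by simp [f4]) (by omega) (by simp) (by omega) (by simp [f10])).call fun s₆ F₆ h₆ => ?_
    have e8 : s₆.reg 8 = 3 * (k * l) + 1 := by rw [F₆.reg rfl]; simp
    have hl0 : 0 < l := by
      rcases Nat.eq_zero_or_pos l with h0 | h0
      · rw [h0] at h₂ h
        simp at h₂ h
        omega
      · exact h0
    -- In this branch `3 * (k * l) + 1 < n`. This excludes the cut-off value `n + 1` and yields the
    -- condition `k ≤ n` of `candidate_last`.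
    have hkn : k < n := by
      have := Nat.le_mul_of_pos_right k hl0
      omega
    refine ⟨k, l, M, h₁.1, h₁.2.2.1, h₂.2.2, by omega, by omega, by omega, h₃, ?_⟩
    intro v hv u hu hle
    rw [e8]
    obtain ⟨j, hj, h₇, h₈⟩ := exists_candidate (r := fun u => s.mem 0 (v * n + u)) (k := k)
      (B := (k + 1) * (n * M) + 1) hu (Nat.lt_succ_iff.mpr (Nat.mul_le_mul_left _ hle))
      (3 * (k * l))
    have h₉ := h₆ v hv j hj
    simp only [State.set_mem, f0] at h₉
    refine ⟨j, hj, by rw [h₉]; exact h₇, .inr ⟨?_, ?_⟩⟩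
    · rcases h₁.2.2.2 with h | h <;> omega
    · rw [h₉]
      rcases h₈ with h₈ | rfl
      · exact .inl h₈
      · exact .inr (candidate_last h₁.1 hkn.le h₂.1)
  · refine (exactP_runs (n := n) (by simp [n₅]) hm').call fun s₆ F₆ h₆ => ?_
    have e8 : s₆.reg 8 = n := by rw [F₆.reg rfl]; simp
    simp only [State.set_mem, f0] at h₆
    refine ⟨k, l, M, h₁.1, h₁.2.2.1, h₂.2.2, by omega, by omega, by omega, h₃, ?_⟩
    intro v hv u hu hle
    rw [e8]
    exact ⟨u, hu, (h₆ v hv u hu).ge, .inl (h₆ v hv u hu)⟩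


/-! ### The tree decomposition in memory -/

theorem layout_apply {m n : ℕ} (A : Fin m → Fin n → ℕ) {i j : ℕ} (hi : i < m) (hj : j < n) :
    layout A (i * n + j) = A ⟨i, hi⟩ ⟨j, hj⟩ := by
  have h : i * n + j < m * n := by
    calc i * n + j < (i + 1) * n := by rw [Nat.succ_mul]; omega
      _ ≤ m * n := Nat.mul_le_mul_right _ hi
  rw [layout, dif_pos h]
  congr 1
  · ext
    simp [Fin.divNat, Nat.mul_comm _ n, Nat.mul_add_div (Nat.zero_lt_of_lt hj),
      Nat.div_eq_of_lt hj]
  · ext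
    simp [Fin.modNat, Nat.mod_eq_of_lt hj]

theorem layout_eq_zero {m n : ℕ} (A : Fin m → Fin n → ℕ) {k : ℕ} (h : m * n ≤ k) :
    layout A k = 0 := dif_neg (by omega)

/-- Take a node `i` of `S` at maximal distance from a root `r`. A neighbor in `S` is not farther
from `r`, hence it precedes `i` on the path from `r`, and there is only one such node. -/
theorem exists_leaf {V : Type*} [Finite V] {G : SimpleGraph V} (hG : G.IsTree) (S : Set V)
    (hS : S.Nonempty) :
    ∃ i ∈ S, ∀ j ∈ S, ∀ k ∈ S, G.Adj i j → G.Adj i k → j = k := by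
  classical
  obtain ⟨r, _⟩ := hS
  obtain ⟨i, hi, hmax⟩ := Set.exists_max_image S (G.dist r) S.toFinite ⟨r, ‹_›⟩
  obtain ⟨p, hp, -⟩ := hG.connected.exists_path_of_dist r i
  suffices h : ∀ j ∈ S, G.Adj i j → j = p.penultimate from
    ⟨i, hi, fun j hj k hk hij hik => (h j hj hij).trans (h k hk hik).symm⟩
  intro j hj hij
  obtain ⟨q, hq, hlen⟩ := hG.connected.exists_path_of_dist r j
  refine hG.isAcyclic.eq_penultimate_of_adj_end hp hij
    (hG.isAcyclic.mem_support_of_ne_mem_support_of_adj_of_isPath hp hq hij fun hmem => ?_)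
  have h₁ := hmax j hj
  have h₂ := hG.dist_ne_of_adj r hij
  have h₃ := SimpleGraph.dist_le (q.takeUntil i hmem)
  have h₄ := q.length_takeUntil_le_length hmem
  omega

/-- A walk inside `S` from `T` to its complement crosses over somewhere. -/
theorem exists_adj_of_connected {V : Type*} {G : SimpleGraph V} {S : Set V}
    (h : (G.induce S).Connected) (T : V → Prop) {i j : V} (hi : i ∈ S) (hT : T i) (hj : j ∈ S)
    (hT' : ¬ T j) : ∃ i ∈ S, ∃ j ∈ S, T i ∧ ¬ T j ∧ G.Adj i j := by
  obtain ⟨p⟩ := h.preconnected ⟨i, hi⟩ ⟨j, hj⟩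
  obtain ⟨d, -, h₁, h₂⟩ := p.exists_boundary_dart {x | T x} hT hT'
  exact ⟨d.fst, d.fst.2, d.snd, d.snd.2, h₁, h₂, d.adj⟩

open Classical in
/-- The data for an instance and a tree decomposition. -/
noncomputable def Instance.data {n N : ℕ} (I : Instance (Fin n))
    (T : TreeDecomposition I.graph (Fin N)) (L : ℕ) (cand : ℕ → ℕ) : Data where
  n := n
  N := N
  L := L
  w := layout fun u v : Fin n => if I.graph.Adj u v then I.w u v else 0
  bag := layout fun (i : Fin N) (v : Fin n) => if v ∈ T.bag i then 1 else 0
  adj := layout fun i j : Fin N => if T.tree.Adj i j then 1 else 0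
  cand := cand

section Instance

variable {n N : ℕ} {I : Instance (Fin n)} {T : TreeDecomposition I.graph (Fin N)} {L : ℕ}
  {cand : ℕ → ℕ}

open Classical in
theorem data_W {u v : ℕ} (hu : u < n) (hv : v < n) : (I.data T L cand).W u v =
    if I.graph.Adj ⟨u, hu⟩ ⟨v, hv⟩ then I.w ⟨u, hu⟩ ⟨v, hv⟩ else 0 := by
  change (I.data T L cand).w (u * n + v) = _
  simp only [Instance.data]
  rw [layout_apply _ hu hv]

theorem data_X {i v : ℕ} (hi : i < N) (hv : v < n) :
    (I.data T L cand).X i v ↔ (⟨v, hv⟩ : Fin n) ∈ T.bag ⟨i, hi⟩ := by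
  change (I.data T L cand).bag (i * n + v) ≠ 0 ↔ _
  simp only [Instance.data]
  rw [layout_apply _ hi hv]
  simp

theorem data_A {i j : ℕ} (hi : i < N) (hj : j < N) :
    (I.data T L cand).A i j ↔ T.tree.Adj ⟨i, hi⟩ ⟨j, hj⟩ := by
  change (I.data T L cand).adj (i * N + j) ≠ 0 ↔ _
  simp only [Instance.data]
  rw [layout_apply _ hi hj]
  simp

theorem data_isDecomposition : (I.data T L cand).IsDecomposition where
  symm i hi j hj h := (data_A hj hi).mpr ((data_A hi hj).mp h).symm
  irrefl i hi h := ((data_A hi hi).mp h).ne rfl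
  bag_last v hv h := by
    refine h ?_
    change (I.data T L cand).bag (N * n + v) = 0
    simp only [Instance.data]
    exact layout_eq_zero _ (Nat.le_add_right _ _)
  vertex v hv := by
    obtain ⟨i, hi⟩ := T.vertex_mem ⟨v, hv⟩
    exact ⟨i, i.2, (data_X i.2 hv).mpr hi⟩
  edge u hu v hv h := by
    rw [data_W (n := n) hu hv] at h
    obtain ⟨i, hi, hj⟩ := T.edge_mem ⟨u, hu⟩ ⟨v, hv⟩ (by
      by_contra hn
      exact h (if_neg hn))
    exact ⟨i, i.2, (data_X i.2 hu).mpr hi, (data_X i.2 hv).mpr hj⟩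
  leaf S hS := by
    obtain ⟨i, hi, hSi⟩ := hS
    obtain ⟨i, hi, h⟩ := exists_leaf T.isTree {i | S i} ⟨⟨i, hi⟩, hSi⟩
    refine ⟨i, i.2, hi, fun j hj k hk hSj hSk hij hik => ?_⟩
    exact congrArg Fin.val (h ⟨j, hj⟩ hSj ⟨k, hk⟩ hSk ((data_A i.2 hj).mp hij)
      ((data_A i.2 hk).mp hik))
  cut v hv S := by
    rintro ⟨i, hi, hiv, hS⟩ ⟨j, hj, hjv, hS'⟩
    obtain ⟨i', h₁, j', h₂, h₃, h₄, h₅⟩ := exists_adj_of_connected (T.connected ⟨v, hv⟩)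
      (fun i => S i) (i := ⟨i, hi⟩) (j := ⟨j, hj⟩) ((data_X hi hv).mp hiv) hS
      ((data_X hj hv).mp hjv) hS'
    exact ⟨i', i'.2, j', j'.2, (data_X i'.2 hv).mpr h₁, (data_X j'.2 hv).mpr h₂, h₃, h₄,
      (data_A i'.2 j'.2).mpr h₅⟩

/-- The bases are `L` on the bag and 1 elsewhere, so their product is `L` to the size of the bag. -/
theorem place_radix_le (hL : 0 < L) {i : ℕ} (hi : i < N) :
    place ((I.data T L cand).radix i) n ≤ L ^ (T.width + 1) := by
  classical
  have h₁ : place ((I.data T L cand).radix i) n = L ^ (T.bag ⟨i, hi⟩).card := by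
    rw [place, ← Fin.prod_univ_eq_prod_range, ← Finset.prod_const,
      ← Finset.prod_filter_mul_prod_filter_not Finset.univ (· ∈ T.bag ⟨i, hi⟩)]
    rw [Finset.filter_univ_mem, Finset.prod_eq_one (s := Finset.filter _ _), mul_one]
    · exact Finset.prod_congr rfl fun v hv => if_pos ((data_X hi v.2).mpr hv)
    · exact fun v hv => if_neg fun h => (Finset.mem_filter.mp hv).2 ((data_X hi v.2).mp h)
  rw [h₁]
  refine Nat.pow_le_pow_right hL ?_
  have := Finset.le_sup (f := fun i => (T.bag i).card) (Finset.mem_univ (⟨i, hi⟩ : Fin N))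
  unfold TreeDecomposition.width
  omega

end Instance

/-! ### Rounding -/

theorem exists_largest (r : ℕ → ℕ) {n v : ℕ} (hv : v < n) (h0 : r v = 0) {a : ℝ} (ha : 0 ≤ a) :
    ∃ u < n, (r u : ℝ) ≤ a ∧ ∀ u' < n, (r u' : ℝ) ≤ a → r u' ≤ r u := by
  classical
  obtain ⟨u, hu, h⟩ := Finset.exists_max_image ((Finset.range n).filter fun u => (r u : ℝ) ≤ a) r
    ⟨v, by simp [hv, h0, ha]⟩
  simp only [Finset.mem_filter, Finset.mem_range] at hu h
  exact ⟨u, hu.1, hu.2, fun u' h₁ h₂ => h u' ⟨h₁, h₂⟩⟩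

/-- A feasible solution may be assumed to consist of weights that are not too large. -/
theorem exists_weights {n M : ℕ} {w : ℕ → ℕ} (h0 : ∀ v < n, w (v * n + v) = 0)
    (hM : IsBottleneck n M w) {p : ℕ → ℝ} (hp0 : ∀ v, 0 ≤ p v)
    (hp : ∀ u < n, ∀ v < n, (w (u * n + v) : ℝ) ≤ p u ∨ (w (v * n + u) : ℝ) ≤ p v) :
    ∃ x : ℕ → ℕ, (∀ v < n, x v < n ∧ w (v * n + x v) ≤ n * M) ∧
      (∀ u < n, ∀ v < n, w (u * n + v) ≤ w (u * n + x u) ∨ w (v * n + u) ≤ w (v * n + x v)) ∧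
      ∑ v ∈ Finset.range n, (w (v * n + x v) : ℝ) ≤ ∑ v ∈ Finset.range n, p v := by
  obtain ⟨a, ha0, ha, hsum, hle⟩ : ∃ a : ℕ → ℝ, (∀ v, 0 ≤ a v) ∧
      (∀ u < n, ∀ v < n, (w (u * n + v) : ℝ) ≤ a u ∨ (w (v * n + u) : ℝ) ≤ a v) ∧
      ∑ v ∈ Finset.range n, a v ≤ ∑ v ∈ Finset.range n, p v ∧ ∀ v < n, a v ≤ n * M := by
    -- A solution that costs at least `n * M` is replaced by the constant `M`; otherwise each single
    -- power is at most the total.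
    rcases le_total ((n : ℝ) * M) (∑ v ∈ Finset.range n, p v) with h | h
    · refine ⟨fun _ => M, fun _ => Nat.cast_nonneg M, fun u hu v hv => ?_, by simpa using h,
        fun v hv => ?_⟩
      · simp only [Nat.cast_le]
        exact min_le_iff.mp (hM.1 u hu v hv)
      · have : (1 : ℝ) ≤ n := by exact_mod_cast Nat.one_le_of_lt hv
        exact le_mul_of_one_le_left (Nat.cast_nonneg M) this
    · exact ⟨p, hp0, hp, le_rfl, fun v hv => (Finset.single_le_sum (fun u _ => hp0 u)
        (Finset.mem_range.mpr hv)).trans h⟩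
  have hex : ∀ v, ∃ u, v < n → u < n ∧ (w (v * n + u) : ℝ) ≤ a v ∧
      ∀ u' < n, (w (v * n + u') : ℝ) ≤ a v → w (v * n + u') ≤ w (v * n + u) := by
    intro v
    by_cases hv : v < n
    -- Round down to a weight of the row. The zero on the diagonal ensures that there is one to
    -- round down to.
    · obtain ⟨u, h⟩ := exists_largest (fun u => w (v * n + u)) hv (h0 v hv) (ha0 v)
      exact ⟨u, fun _ => h⟩
    · exact ⟨0, fun h => absurd h hv⟩
  choose x hx using hex
  refine ⟨x, fun v hv => ⟨(hx v hv).1, ?_⟩, fun u hu v hv => ?_, ?_⟩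
  · exact_mod_cast (hx v hv).2.1.trans (hle v hv)
  · exact (ha u hu v hv).imp ((hx u hu).2.2 v hv) ((hx v hv).2.2 u hu)
  · exact (Finset.sum_le_sum fun v hv => (hx v (Finset.mem_range.mp hv)).2.1).trans hsum

/-- The pair that attains `M` forces power at least `M` on one of its endpoints. -/
theorem bottleneck_le {n M : ℕ} {w : ℕ → ℕ} (hM : IsBottleneck n M w) {p : ℕ → ℝ}
    (hp0 : ∀ v, 0 ≤ p v)
    (hp : ∀ u < n, ∀ v < n, (w (u * n + v) : ℝ) ≤ p u ∨ (w (v * n + u) : ℝ) ≤ p v) :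
    (M : ℝ) ≤ ∑ v ∈ Finset.range n, p v := by
  have hsingle : ∀ v < n, p v ≤ ∑ v ∈ Finset.range n, p v := fun v hv =>
    Finset.single_le_sum (fun u _ => hp0 u) (Finset.mem_range.mpr hv)
  rcases hM.2 with rfl | ⟨u, hu, v, hv, rfl⟩
  · simpa using Finset.sum_nonneg fun v _ => hp0 v
  · rcases hp u hu v hv with h | h
    · exact le_trans (by exact_mod_cast min_le_left _ _) (h.trans (hsingle u hu))
    · exact le_trans (by exact_mod_cast min_le_right _ _) (h.trans (hsingle v hv))

/-- The candidates admit a feasible solution that is nearly as good as a given one. -/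
theorem Prepared.exists_choice {n num den k l M L : ℕ} {w c : ℕ → ℕ}
    (h : Prepared n num den w k l M L c) (h0 : ∀ v < n, w (v * n + v) = 0) (hden : 0 < den)
    {p : ℕ → ℝ} (hp0 : ∀ v, 0 ≤ p v)
    (hp : ∀ u < n, ∀ v < n, (w (u * n + v) : ℝ) ≤ p u ∨ (w (v * n + u) : ℝ) ≤ p v) :
    ∃ q : ℕ → ℕ, (∀ v < n, q v < L) ∧
      (∀ u < n, ∀ v < n, w (u * n + v) ≤ c (u * n + q u) ∨ w (v * n + u) ≤ c (v * n + q v)) ∧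
      ∑ v ∈ Finset.range n, (c (v * n + q v) : ℝ) ≤
        (1 + (num : ℝ) / den) * ∑ v ∈ Finset.range n, p v := by
  obtain ⟨x, hx, hfeas, hsum⟩ := exists_weights h0 h.bottleneck hp0 hp
  have hM := bottleneck_le h.bottleneck hp0 hp
  set ε : ℝ := (num : ℝ) / den with hε
  have hden' : (0 : ℝ) < den := by exact_mod_cast hden
  have hε0 : 0 ≤ ε := by positivity
  have hk : (0 : ℝ) < k := by exact_mod_cast h.k_pos
  -- The error budget: half of `ε` for the relative error, half for the additive errors, which sum
  -- to `ε / 2 * M` and hence to at most `ε / 2` times the given cost.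
  have hex : ∀ v, ∃ j, v < n → j < L ∧ w (v * n + x v) ≤ c (v * n + j) ∧
      (c (v * n + j) : ℝ) ≤ w (v * n + x v) + ε / 2 * w (v * n + x v) + ε / 2 * (M / n) := by
    intro v
    by_cases hv : v < n
    · have hn : (0 : ℝ) < n := by exact_mod_cast Nat.zero_lt_of_lt hv
      obtain ⟨j, h₁, h₂, h₃⟩ := h.rounds v hv (x v) (hx v hv).1 (hx v hv).2
      refine ⟨j, fun _ => ⟨h₁, h₂, ?_⟩⟩
      have hw0 : (0 : ℝ) ≤ w (v * n + x v) := Nat.cast_nonneg _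
      have hMn : (0 : ℝ) ≤ M / n := by positivity
      rcases h₃ with h₃ | ⟨h₃, h₄⟩
      · rw [h₃]
        have := mul_nonneg (half_pos (zero_lt_one (α := ℝ))).le hε0
        nlinarith [mul_nonneg hε0 hw0, mul_nonneg hε0 hMn]
      · have hkε : 1 / (k : ℝ) ≤ ε / 2 := by
          rw [hε, div_le_iff₀ hk]
          have : (2 : ℝ) * den ≤ k * num := by exact_mod_cast h₃
          field_simp
          linarith
        have e₁ := mul_le_mul_of_nonneg_right hkε hw0
        have e₂ := mul_le_mul_of_nonneg_right hkε hMn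
        rcases h₄ with h₄ | h₄
        · have h₅ : (k : ℝ) * c (v * n + j) ≤ (k + 1) * w (v * n + x v) := by exact_mod_cast h₄
          have h₆ : (c (v * n + j) : ℝ) ≤ w (v * n + x v) + 1 / k * w (v * n + x v) := by
            refine le_of_mul_le_mul_left ?_ hk
            calc (k : ℝ) * c (v * n + j) ≤ (k + 1) * w (v * n + x v) := h₅
              _ = k * (w (v * n + x v) + 1 / k * w (v * n + x v)) := by field_simp
          have := mul_nonneg hε0 hMn
          linarith
        · have h₅ : (c (v * n + j) : ℝ) * (k * n) ≤ M := by exact_mod_cast h₄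
          have h₆ : (c (v * n + j) : ℝ) ≤ 1 / k * (M / n) := by
            rw [show 1 / (k : ℝ) * (M / n) = M / (k * n) by field_simp, le_div_iff₀ (by positivity)]
            exact h₅
          have := mul_nonneg hε0 hw0
          linarith
    · exact ⟨0, fun h => absurd h hv⟩
  choose q hq using hex
  refine ⟨q, fun v hv => (hq v hv).1, fun u hu v hv => ?_, ?_⟩
  · exact (hfeas u hu v hv).imp (fun h => h.trans (hq u hu).2.1) fun h => h.trans (hq v hv).2.1
  · calc ∑ v ∈ Finset.range n, (c (v * n + q v) : ℝ)
        ≤ ∑ v ∈ Finset.range n,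
          ((w (v * n + x v) : ℝ) + ε / 2 * w (v * n + x v) + ε / 2 * (M / n)) :=
        Finset.sum_le_sum fun v hv => (hq v (Finset.mem_range.mp hv)).2.2
      _ = (1 + ε / 2) * ∑ v ∈ Finset.range n, (w (v * n + x v) : ℝ) +
          ε / 2 * (n * (M / n)) := by
        rw [Finset.sum_add_distrib, Finset.sum_add_distrib, ← Finset.mul_sum, Finset.sum_const,
          Finset.card_range, nsmul_eq_mul]
        ring
      _ ≤ (1 + ε / 2) * ∑ v ∈ Finset.range n, p v + ε / 2 * ∑ v ∈ Finset.range n, p v := by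
        have hnM : (n : ℝ) * (M / n) ≤ M := by
          rcases Nat.eq_zero_or_pos n with h | h
          · simp [h]
          · have : (0 : ℝ) < n := by exact_mod_cast h
            exact (mul_div_cancel₀ _ this.ne').le
        have := hnM.trans hM
        gcongr
      _ = (1 + ε) * ∑ v ∈ Finset.range n, p v := by ring


/-! ### The algorithm -/

/-- The approximation scheme for Directed Power Vertex Cover. -/
def approximationScheme : Program := prepareP ;; mainP

theorem ratCast_eq_toNat_div {ε : ℚ} (hε : 0 < ε) : (ε : ℝ) = (ε.num.toNat : ℝ) / (ε.den : ℝ) := by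
  have h : ((ε.num.toNat : ℤ) : ℝ) = (ε.num : ℝ) := by
    rw [Int.toNat_of_nonneg (Rat.num_pos.mpr hε).le]
  rw [Rat.cast_def, ← h, Int.cast_natCast]

section Correct

variable {n N : ℕ} {I : Instance (Fin n)} {T : TreeDecomposition I.graph (Fin N)} {ε : ℚ}

open Classical in
/-- An optimal choice of candidates is a nearly optimal solution. -/
theorem isApproxSolution {k l M L : ℕ} {cand : ℕ → ℕ} (hε : 0 < ε)
    (h : Prepared n ε.num.toNat ε.den (I.data T L cand).w k l M L cand) {P : ℕ → ℕ}
    (hP : ∀ q, (I.data T L cand).Adm q →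
      (I.data T L cand).Feasible (fun v => (I.data T L cand).c v (q v)) →
      (I.data T L cand).Feasible P ∧ ∑ v ∈ Finset.range n, P v ≤
        ∑ v ∈ Finset.range n, (I.data T L cand).c v (q v)) :
    I.IsApproxSolution (1 + (ε : ℝ)) fun v => (P v : ℝ≥0) := by
  have hW : ∀ {u v : ℕ} (hu : u < n) (hv : v < n), (I.data T L cand).w (u * n + v) =
      if I.graph.Adj ⟨u, hu⟩ ⟨v, hv⟩ then I.w ⟨u, hu⟩ ⟨v, hv⟩ else 0 := fun hu hv =>
    data_W hu hv
  have key : ∀ p : Fin n → ℝ≥0, I.Feasible p → I.Feasible (fun v => (P v : ℝ≥0)) ∧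
      (∑ v : Fin n, (P v : ℝ)) ≤ (1 + (ε : ℝ)) * ∑ v, (p v : ℝ) := by
    intro p hp
    set p' : ℕ → ℝ := fun v => if hv : v < n then (p ⟨v, hv⟩ : ℝ) else 0 with hp'
    have hp'v : ∀ v (hv : v < n), p' v = p ⟨v, hv⟩ := fun v hv => dif_pos hv
    have hp0 : ∀ v, 0 ≤ p' v := fun v => by
      simp only [hp']
      split_ifs
      exacts [NNReal.coe_nonneg _, le_rfl]
    obtain ⟨q, hq, hf, hle⟩ := h.exists_choice (fun v hv => by simp [hW hv hv]) ε.den_pos hp0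
      (fun u hu v hv => by
        rw [hp'v u hu, hp'v v hv, hW hu hv, hW hv hu, I.graph.adj_comm ⟨v, hv⟩]
        split_ifs with hA
        · exact (hp _ _ hA).imp (fun h => by exact_mod_cast NNReal.coe_le_coe.mpr h)
            fun h => by exact_mod_cast NNReal.coe_le_coe.mpr h
        · simp)
    obtain ⟨h₁, h₂⟩ := hP q hq hf
    refine ⟨fun u v hA => ?_, ?_⟩
    · have := h₁ u u.2 v v.2
      rw [show (I.data T L cand).W u v = _ from hW u.2 v.2,
        show (I.data T L cand).W v u = _ from hW v.2 u.2, if_pos hA, if_pos hA.symm] at this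
      exact this.imp (Nat.cast_le (α := ℝ≥0)).mpr (Nat.cast_le (α := ℝ≥0)).mpr
    · rw [← ratCast_eq_toNat_div hε] at hle
      have h₃ : ∑ v ∈ Finset.range n, p' v = ∑ v, (p v : ℝ) := by
        rw [Finset.sum_range]
        exact Finset.sum_congr rfl fun v _ => hp'v v v.2
      rw [h₃] at hle
      refine le_trans ?_ hle
      rw [← Finset.sum_range fun v => (P v : ℝ)]
      exact_mod_cast h₂
  -- The hypothesis on `P` presupposes a feasible choice. Feasibility of `P` is therefore drawn from
  -- a solution that always exists, with the sum of its row as the power of each vertex.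
  refine ⟨(key (fun u => ∑ v, I.w u v) fun u v _ => .inl ?_).1, fun p hp => ?_⟩
  · push_cast
    exact Finset.single_le_sum (f := fun v => (I.w u v : ℝ≥0)) (fun _ _ => by positivity)
      (Finset.mem_univ v)
  · have := (key p hp).2
    push_cast
    exact this

theorem approximationScheme_runs (hn : 0 < n) (hε : 0 < ε) :
    ∃ (s : State) (t k l L : ℕ), Exec approximationScheme (initialState I T ε) s t ∧
      t ≤ (L ^ (T.width + 1) + 1) * (n + N + 2) ^ 101 ∧
      (k = 1 ∨ (k - 1) * ε.num.toNat < 2 * ε.den) ∧ (l = 0 ∨ 2 ^ (l - 1) < n) ∧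
      0 < L ∧ L ≤ n ∧ L ≤ 3 * (k * l) + 1 ∧ I.IsApproxSolution (1 + (ε : ℝ)) (output n s) := by
  obtain ⟨s₁, t₁, h₁, h₂, k, l, M, h₃⟩ := prepareP_runs (m := n + N) (s := initialState I T ε)
    (n := n) rfl hn (Nat.le_add_right n N)
  have F := h₁.frame
  set L := s₁.reg 8
  set cand := s₁.mem 4
  have c : Ctx (I.data T L cand) (n + N) s₁ :=
    { n_le := by change n ≤ _; omega
      N_le := by change N ≤ _; omega
      L_le := by
        have := h₃.L_le_n
        change L ≤ _
        omega
      n := F.reg rfl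
      N := F.reg rfl
      L := rfl
      w := F.mem rfl
      bag := F.mem rfl
      adj := F.mem rfl
      cand := rfl }
  obtain ⟨s₂, t₂, h₄, h₅, h₆⟩ := mainP_runs (K := L ^ (T.width + 1)) c h₃.L_pos
    data_isDecomposition (fun i => by rw [F.mem rfl]; rfl) (fun i => by rw [F.mem rfl]; rfl)
    (fun i hi => place_radix_le h₃.L_pos hi)
  refine ⟨s₂, t₁ + t₂, k, l, L, .seq h₁ h₄, ?_, h₃.k_le, h₃.l_le, h₃.L_pos, h₃.L_le_n, h₃.L_le,
    isApproxSolution hε h₃ h₆⟩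
  refine (Nat.add_le_add (h₂.trans ?_) h₅).trans (Runs.two_mul_bound 100)
  exact Nat.mul_le_mul (by omega) (Nat.pow_le_pow_right (by omega) (by omega))

end Correct

/-! ### The running time -/

theorem ApproximatesInTime.mono {P : Program} {b b' : ℕ → ℕ → ℕ → ℚ → ℝ}
    (h : ApproximatesInTime P b) (hb : ∀ n N t ε, 0 < n → 0 < ε → b n N t ε ≤ b' n N t ε) :
    ApproximatesInTime P b' := by
  intro n N hn I D ε hε
  obtain ⟨s, T, h₁, h₂, h₃⟩ := h n N hn I D ε hε
  exact ⟨s, T, h₁, h₂.trans (hb _ _ _ _ hn hε), h₃⟩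

/-- The number of candidates per vertex. -/
theorem candidates_le {n k l L : ℕ} {ε : ℚ} (hn : 2 ≤ n) (hε : 0 < ε)
    (hk : k = 1 ∨ (k - 1) * ε.num.toNat < 2 * ε.den) (hl : l = 0 ∨ 2 ^ (l - 1) < n)
    (hL : L ≤ 3 * (k * l) + 1) :
    (L : ℝ) ≤ 29 * (Real.log n / min (ε : ℝ) 1) := by
  set μ : ℝ := min (ε : ℝ) 1 with hμ
  have hε' : (0 : ℝ) < ε := by exact_mod_cast hε
  have hμ0 : 0 < μ := lt_min hε' one_pos
  have hμ1 : μ ≤ 1 := min_le_right _ _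
  have hlog2 : (0.69 : ℝ) < Real.log 2 := by linarith [Real.log_two_gt_d9]
  have hlogn : Real.log 2 ≤ Real.log n :=
    Real.log_le_log two_pos (by exact_mod_cast hn)
  -- Minimality of `k` gives `(k - 1) * ε ≤ 2`, and one more `μ ≤ 1` makes 3.
  have hkμ : (k : ℝ) * μ ≤ 3 := by
    rcases hk with rfl | hk
    · push_cast
      linarith
    · rcases Nat.eq_zero_or_pos k with rfl | hk0
      · push_cast
        linarith
      have h₁ : ((k : ℝ) - 1) * ε ≤ 2 := by
        have hden : (0 : ℝ) < ε.den := by exact_mod_cast ε.den_pos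
        have h₂ : ((k : ℝ) - 1) * ε.num.toNat < 2 * ε.den := by
          have : (((k - 1 : ℕ) : ℝ)) * ε.num.toNat < 2 * ε.den := by exact_mod_cast hk
          rwa [Nat.cast_pred hk0] at this
        rw [ratCast_eq_toNat_div hε, ← mul_div_assoc, div_le_iff₀ hden]
        exact h₂.le
      have hk1 : (0 : ℝ) ≤ (k : ℝ) - 1 := by
        have : (1 : ℝ) ≤ k := by exact_mod_cast hk0
        linarith
      have := mul_le_mul_of_nonneg_left (min_le_left (ε : ℝ) 1) hk1
      rw [← hμ] at this
      linarith
  -- From `(l - 1) * log 2 ≤ log n` and `log 2 ≤ log n`, with `2 / 0.69 < 3`. In the end `29 = 9 * 3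
  -- + 2`, where `2 * log n ≥ 1` pays for the summand 1.
  have hl' : (l : ℝ) ≤ 3 * Real.log n := by
    rcases hl with rfl | hl
    · push_cast
      linarith
    · rcases Nat.eq_zero_or_pos l with rfl | hl0
      · push_cast
        linarith
      have h₁ : ((l : ℝ) - 1) * Real.log 2 ≤ Real.log n := by
        rw [← Nat.cast_pred hl0, ← Real.log_pow]
        exact Real.log_le_log (by positivity) (by exact_mod_cast hl.le)
      nlinarith
  have hL' : (L : ℝ) ≤ 3 * (k * l) + 1 := by exact_mod_cast hL
  rw [← mul_div_assoc, le_div_iff₀ hμ0]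
  have hl0 : (0 : ℝ) ≤ l := Nat.cast_nonneg l
  calc (L : ℝ) * μ ≤ (3 * (k * l) + 1) * μ := mul_le_mul_of_nonneg_right hL' hμ0.le
    _ = 3 * (k * μ) * l + μ := by ring
    _ ≤ 3 * 3 * l + 1 := by gcongr
    _ ≤ 9 * (3 * Real.log n) + 2 * Real.log n := by linarith
    _ = 29 * Real.log n := by ring

/-- For `n = 1` the logarithm is zero, and the time bound holds only because its exponent is zero
too. -/
theorem width_eq_zero {N : ℕ} {G : SimpleGraph (Fin 1)} (T : TreeDecomposition G (Fin N)) :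
    T.width = 0 := by
  unfold TreeDecomposition.width
  have : (Finset.univ.sup fun i => (T.bag i).card) ≤ 1 :=
    Finset.sup_le fun i _ => (Finset.card_le_univ _).trans (by simp)
  omega

/-- The surplus factor of `L ^ (w + 1)` is at most `n` and joins the polynomial part, so only `L ^
w` is compared with `B ^ w`. Since `n + N ≥ 2`, the base `n + N + 2` is at most `(n + N) ^ 2`. -/
theorem time_le {t L n N w a : ℕ} {B : ℝ} (hn : 0 < n) (hN : 0 < N) (hL0 : 0 < L) (hLn : L ≤ n)
    (hLB : (L : ℝ) ^ w ≤ B ^ w) (h : t ≤ (L ^ (w + 1) + 1) * (n + N + 2) ^ a) :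
    (t : ℝ) ≤ B ^ w * ((n : ℝ) + (N : ℝ)) ^ (2 * a + 2) := by
  set x : ℝ := (n : ℝ) + N with hx
  have hn1 : (1 : ℝ) ≤ n := by exact_mod_cast hn
  have hN1 : (1 : ℝ) ≤ N := by exact_mod_cast hN
  have hx2 : 2 ≤ x := by linarith
  have hL1 : (1 : ℝ) ≤ (L : ℝ) ^ (w + 1) := one_le_pow₀ (by exact_mod_cast hL0)
  calc (t : ℝ) ≤ ((L : ℝ) ^ (w + 1) + 1) * (x + 2) ^ a := by rw [hx]; exact_mod_cast h
    _ ≤ (2 * (L : ℝ) ^ (w + 1)) * (x ^ 2) ^ a := by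
      gcongr
      · linarith
      · nlinarith
    _ = (L : ℝ) ^ w * (2 * L) * x ^ (2 * a) := by rw [← pow_mul]; ring
    _ ≤ B ^ w * (x * x) * x ^ (2 * a) := by
      have : (L : ℝ) ≤ n := by exact_mod_cast hLn
      have h0 : 0 ≤ (L : ℝ) ^ w := by positivity
      have : 2 * (L : ℝ) ≤ x * x := by nlinarith
      gcongr
      exact h0.trans hLB
    _ = B ^ w * x ^ (2 * a + 2) := by ring

theorem approximationScheme_time : ApproximatesInTime approximationScheme fun n N t ε =>
    (29 * (Real.log (n : ℝ) / min (ε : ℝ) 1)) ^ t * ((n : ℝ) + (N : ℝ)) ^ 204 := by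
  intro n N hn I T ε hε
  obtain ⟨s, t, k, l, L, h₁, h₂, hk, hl, hL0, hLn, hL, h₃⟩ :=
    approximationScheme_runs (I := I) (T := T) hn hε
  obtain ⟨i⟩ := T.isTree.connected.nonempty
  refine ⟨s, t, h₁, time_le (a := 101) hn i.pos hL0 hLn ?_ h₂, h₃⟩
  rcases Nat.lt_or_ge 1 n with h | h
  · exact pow_le_pow_left₀ (Nat.cast_nonneg L) (candidates_le h hε hk hl hL) _
  · obtain rfl : n = 1 := by omega
    simp [width_eq_zero T]

theorem computable_pow : Computable fun m : ℕ => (29 * (m * m)) ^ m := by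
  have hpow : Primrec₂ fun a b : ℕ => a ^ b := Primrec₂.unpaired'.1 Nat.Primrec.pow
  exact (hpow.comp (Primrec.nat_mul.comp (Primrec.const 29)
    (Primrec.nat_mul.comp Primrec.id Primrec.id)) Primrec.id).to_comp

/-- The factor `(log n) ^ t` is traded for a function of `t` times one more factor `n`, which
explains the exponent `c + 1`. -/
theorem fpt_bound_le {n N t c : ℕ} {ε : ℚ} (hn : 0 < n) (hε : 0 < ε) :
    (29 * (Real.log (n : ℝ) / min (ε : ℝ) 1)) ^ t * ((n : ℝ) + (N : ℝ)) ^ c ≤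
      (((29 * ((t + ⌈1 / ε⌉₊) * (t + ⌈1 / ε⌉₊))) ^ (t + ⌈1 / ε⌉₊) : ℕ) : ℝ) *
        ((n : ℝ) + (N : ℝ)) ^ (c + 1) := by
  set K := ⌈1 / ε⌉₊ with hK
  have hn1 : (1 : ℝ) ≤ n := by exact_mod_cast hn
  have hlog : 0 ≤ Real.log n := Real.log_nonneg hn1
  have hε' : (0 : ℝ) < ε := by exact_mod_cast hε
  have hK1 : 1 ≤ K := Nat.ceil_pos.mpr (by positivity)
  have hμ : 1 / min (ε : ℝ) 1 ≤ K := by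
    rcases min_cases (ε : ℝ) 1 with ⟨h, _⟩ | ⟨h, _⟩
    · rw [h]
      have : (1 / ε : ℚ) ≤ K := Nat.le_ceil _
      exact_mod_cast this
    · rw [h]
      simpa using hK1
  -- The inequality `x ^ t / t! ≤ exp x` at `x = log n`, together with `t! ≤ t ^ t`.
  have hfac : Real.log n ^ t ≤ (t : ℝ) ^ t * n := by
    have h₁ := Real.pow_div_factorial_le_exp _ hlog t
    rw [Real.exp_log (by linarith), div_le_iff₀ (by positivity)] at h₁
    have h₂ : ((t.factorial : ℕ) : ℝ) ≤ (t : ℝ) ^ t := by exact_mod_cast t.factorial_le_pow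
    calc Real.log n ^ t ≤ n * t.factorial := h₁
      _ ≤ n * (t : ℝ) ^ t := by gcongr
      _ = (t : ℝ) ^ t * n := mul_comm _ _
  set m : ℝ := ((t + K : ℕ) : ℝ) with hm
  have htm : (t : ℝ) ≤ m := by simp [hm]
  have hKm : (K : ℝ) ≤ m := by simp [hm]
  have hm1 : 1 ≤ m := by
    have : (1 : ℝ) ≤ K := by exact_mod_cast hK1
    linarith
  have hμ0 : 0 ≤ 1 / min (ε : ℝ) 1 := by positivity
  have hpow : (29 * (Real.log (n : ℝ) / min (ε : ℝ) 1)) ^ t ≤ (29 * (m * m)) ^ (t + K) * n :=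
    calc (29 * (Real.log (n : ℝ) / min (ε : ℝ) 1)) ^ t
        = (29 * (1 / min (ε : ℝ) 1)) ^ t * Real.log n ^ t := by 
          rw [← mul_pow, mul_assoc, one_div_mul_eq_div]
      _ ≤ (29 * m) ^ t * (m ^ t * n) := by
        gcongr
        · exact hμ.trans hKm
        · exact hfac.trans (by gcongr)
      _ = (29 * (m * m)) ^ t * n := by rw [← mul_assoc, ← mul_pow, mul_assoc]
      _ ≤ (29 * (m * m)) ^ (t + K) * n := by
        gcongr
        · nlinarith
        · omega
  have hcast : (((29 * ((t + K) * (t + K))) ^ (t + K) : ℕ) : ℝ) = (29 * (m * m)) ^ (t + K) := by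
    simp [hm]
  rw [hcast]
  have hN0 : (0 : ℝ) ≤ N := Nat.cast_nonneg N
  calc (29 * (Real.log (n : ℝ) / min (ε : ℝ) 1)) ^ t * ((n : ℝ) + (N : ℝ)) ^ c
      ≤ (29 * (m * m)) ^ (t + K) * n * ((n : ℝ) + (N : ℝ)) ^ c := by gcongr
    _ ≤ (29 * (m * m)) ^ (t + K) * ((n : ℝ) + N) * ((n : ℝ) + (N : ℝ)) ^ c := by
      gcongr
      linarith
    _ = _ := by ring

end DPVC

theorem mainTheorem1 :
    ∃ P : DPVC.Program,
      (∃ (C : ℝ) (c : ℕ), DPVC.ApproximatesInTime P fun n N t ε =>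
        (C * (Real.log (n : ℝ) / min (ε : ℝ) 1)) ^ t * ((n : ℝ) + (N : ℝ)) ^ c) ∧
      (∃ f : ℕ → ℕ, Computable f ∧ ∃ c : ℕ, DPVC.ApproximatesInTime P fun n N t ε =>
        (f (t + ⌈1 / ε⌉₊) : ℝ) * ((n : ℝ) + (N : ℝ)) ^ c) :=
  ⟨DPVC.approximationScheme, ⟨29, 204, DPVC.approximationScheme_time⟩,
    fun m => (29 * (m * m)) ^ m, DPVC.computable_pow, 205,
    DPVC.approximationScheme_time.mono fun _ _ _ _ hn hε => DPVC.fpt_bound_le hn hε⟩
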